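/- Let $N\ge 1$ and $p\ge 0$ be integers. Let $\mathbb{E}^{(H)}_N$ denote expectation over $N\times N$ GUE matrices $M$, whose eigenvalues $x_1,\dots,x_N$ have joint density $$\frac{1}{\mathscr{Z}_N}\prod_{1\le j<k\le N}|x_j-x_k|^2\prod_{j=1}^N e^{-Nx_j^2/2}\quad\text{on }\mathbb{R}^N,$$ with $\mathscr{Z}_N$ the normalization constant, so that $\det(t-M)=\prod_{j=1}^N(t-x_j)$. Put $\lambda=(N^{2p})=(N,\dots,N)$ ($2p$ parts), $|\nu|=\sum_j\nu_j$, and $$C_\lambda(2p)=\prod_{j=1}^{2p}\frac{(\lambda_j+2p-j)!}{(2p-j)!},\qquad \gamma_p=\prod_{j=0}^{p-1}\frac{j!}{(p+j)!},$$ $$D_e=\prod_{j=0}^{p-1}\frac{j!^2}{(m+j)!^2}\ \ (N=2m),\qquad D_o=(-1)^p\frac{m!}{(m+p)!}\prod_{j=0}^{p-1}\frac{j!^2}{(m+j)!^2}\ \ (N=2m+1).$$ For a partition $\nu\subseteq\lambda$, written $\nu=(\nu_1\ge\dots\ge\nu_{2p}\ge 0)$ with $\nu_1\le N$, put $$\frac{\dim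 V_\nu}{|\nu|!}=\frac{\prod_{1\le j<k\le 2p}(\nu_j-\nu_k-j+k)}{\prod_{j=1}^{2p}(\nu_j+2p-j)!},\qquad D_{\lambda\nu}=\det\left[\mathbf 1_{\lambda_j-\nu_k-j+k\equiv 0\,(2)}\frac{1}{\left(\frac{\lambda_j-\nu_k-j+k}{2}\right)!}\right]_{j,k=1}^{2p},$$ where $1/n!=0$ for $n<0$ ($D_{\lambda\nu}=0$ when $|\nu|$ is odd). (a) For every $N\ge1$ and every $t\in\mathbb{C}$ the integral defining the moment converges absolutely and $$\mathbb{E}^{(H)}_N[\det(t-M)^{2p}]=C_\lambda(2p)\sum_{\nu\subseteq\lambda}\left(-\frac{1}{2N}\right)^{\frac{|\lambda|-|\nu|}{2}}\frac{\dim V_\nu}{|\nu|!}\,D_{\lambda\nu}\,t^{|\nu|}.$$ (b) For fixed $N$ and $t\to0$, if $N$ is even, $$\mathbb{E}^{(H)}_N[\det(t-M)^{2p}]=\left(-\tfrac{1}{2N}\right)^{Np}C_\lambda(2p)D_e\Big[1+\tfrac{2^2N^2}{4!}Np\,t^4+\tfrac{2^3N^3}{6!}2Np(2p-N)t^6+\tfrac{2^4N^4}{8!}Np(4N^2-17Np+16p^2+2)t^8+O(t^{10})\Big],$$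 and if $N$ is odd, $$\mathbb{E}^{(H)}_N[\det(t-M)^{2p}]=\left(-\tfrac{1}{2N}\right)^{Np}C_\lambda(2p)D_o\Big[1+\tfrac{2N}{2!}p\,t^2+\tfrac{2^2N^2}{4!}(p^2-Np)t^4+\tfrac{2^3N^3}{6!}p(2N^2-3Np+p^2)t^6$$ $$\qquad+\tfrac{2^4N^4}{8!}p(-4N^3+15N^2p-6Np^2-2N+p^3-4p)t^8+O(t^{10})\Big].$$ (c) Let $(2N)^{p^2}e^{-Np}\gamma_p\,a_k(N)$ be the coefficient of $t^k$ in $\mathbb{E}^{(H)}_N[\det(t-M)^{2p}]$. For fixed $p$, as $N\to\infty$ through even integers, $$a_0=1+O(N^{-1}),\qquad a_2=0\ \text{ identically},$$ $$a_4=\tfrac{N^3p}{6}\Big(1+\tfrac{p}{6N}(4p^2+1)+\tfrac{p^2}{72N^2}(16p^4-16p^2-11)+\tfrac{p}{6480N^3}(320p^8-1200p^6+708p^4+1265p^2-756)\Big)+O(N^{-1}),$$ and as $N\to\infty$ through odd integers, $$a_0=1+O(N^{-1}),\qquad a_2=Np+\tfrac{p^2}{3}(2p^2-1)+O(N^{-1}),$$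 $$a_4=\tfrac{N^3p}{6}\Big(-1-\tfrac{2p}{3N}(p^2-2)-\tfrac{p^2}{18N^2}(4p^4-22p^2+13)-\tfrac{p}{405N^3}(20p^8-210p^6+483p^4-385p^2+54)\Big)+O(N^{-1}).$$ -/

import Mathlib

open Filter Topology Asymptotics MeasureTheory
open scoped Nat

/-- The unnormalised joint eigenvalue density of the `N × N` Gaussian Unitary Ensemble,
`∏_{j<k} |x_j - x_k|² ∏_j exp(-N x_j² / 2)`. -/
noncomputable def gueWeight (N : ℕ) (x : Fin N → ℝ) : ℝ :=
  (∏ j : Fin N, ∏ k ∈ Finset.Ioi j, |x j - x k| ^ 2) *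
    ∏ j : Fin N, Real.exp (-((N : ℝ) * x j ^ 2 / 2))

/-- The normalisation constant (partition function) of the GUE. -/
noncomputable def guePartitionFunction (N : ℕ) : ℝ :=
  ∫ x : Fin N → ℝ, gueWeight N x

/-- The joint probability density of the eigenvalues of an `N × N` GUE matrix. -/
noncomputable def gueDensity (N : ℕ) (x : Fin N → ℝ) : ℝ :=
  gueWeight N x / guePartitionFunction N

/-- The integrand of the moment: `det (t - M) ^ (2p)` in terms of the eigenvalues `x` of `M`,
times the joint eigenvalue density. -/
noncomputable def gueMomentIntegrand (N p : ℕ) (t : ℂ) (x : Fin N → ℝ) : ℂ :=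
  (∏ j : Fin N, (t - (x j : ℂ))) ^ (2 * p) * (gueDensity N x : ℂ)

/-- The moment `E_N [det (t - M) ^ (2p)]` of the characteristic polynomial of an `N × N` GUE
matrix. -/
noncomputable def gueMoment (N p : ℕ) (t : ℂ) : ℂ :=
  ∫ x : Fin N → ℝ, gueMomentIntegrand N p t x

/-- The coefficient of `t ^ k` in the Taylor expansion of the moment at `t = 0`. -/
noncomputable def gueMomentCoeff (N p k : ℕ) : ℂ :=
  iteratedDeriv k (gueMoment N p) 0 / (k ! : ℂ)

/-- `C_μ(n) = ∏_{j=1}^n (μ_j + n - j)! / (n - j)!` for a partition `μ` with at most `n` parts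
(the index `j` runs from `0` to `n - 1` here). -/
noncomputable def partitionC (n : ℕ) (μ : Fin n → ℕ) : ℝ :=
  ∏ j : Fin n, ((μ j + (n - 1 - (j : ℕ)))! : ℝ) / ((n - 1 - (j : ℕ))! : ℝ)

/-- `dim V_ν / |ν|!` for the irreducible representation `V_ν` of the symmetric group labelled by
the partition `ν`, written with `n` parts, zeros allowed:
`∏_{j<k} (ν_j - ν_k - j + k) / ∏_j (ν_j + n - j)!`.
The value does not change when zeros are appended to `ν`. -/
noncomputable def dimOverFactorial (n : ℕ) (ν : Fin n → ℕ) : ℝ :=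
  (∏ j : Fin n, ∏ k ∈ Finset.Ioi j,
      ((ν j : ℝ) - (ν k : ℝ) - ((j : ℕ) : ℝ) + ((k : ℕ) : ℝ))) /
    ∏ j : Fin n, ((ν j + (n - 1 - (j : ℕ)))! : ℝ)

/-- The entry `1 / (e/2)!` if `e` is even, and `0` otherwise, where `1 / (e/2)! = 0` for
negative `e`. -/
noncomputable def hermiteEntry (e : ℤ) : ℝ :=
  if Even e ∧ 0 ≤ e then 1 / (((e / 2).toNat)! : ℝ) else 0

/-- The determinant `D_{λν} = det [ 1_{λ_j - ν_k - j + k even} / ((λ_j - ν_k - j + k)/2)! ]`. -/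
noncomputable def hermiteD (n : ℕ) (lam ν : Fin n → ℕ) : ℝ :=
  Matrix.det (Matrix.of fun j k : Fin n =>
    hermiteEntry ((lam j : ℤ) - (ν k : ℤ) - ((j : ℕ) : ℤ) + ((k : ℕ) : ℤ)))

/-- The rectangular partition `(N^n)`. -/
def rectPartition (N n : ℕ) : Fin n → ℕ := fun _ => N

open Classical in
/-- The partitions `ν ⊆ (N^n)`, as weakly decreasing sequences of length `n` with entries
at most `N`. -/
noncomputable def subRect (N n : ℕ) : Finset (Fin n → ℕ) :=
  (Fintype.piFinset fun _ : Fin n => Finset.range (N + 1)).filter Antitone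

/-- `D_e = ∏_{j=0}^{p-1} j!² / (m+j)!²`, for `N = 2m`. -/
noncomputable def Deven (p m : ℕ) : ℝ :=
  ∏ j ∈ Finset.range p, ((j ! : ℝ) ^ 2 / ((m + j)! : ℝ) ^ 2)

/-- `D_o = (-1)^p (m! / (m+p)!) ∏_{j=0}^{p-1} j!² / (m+j)!²`, for `N = 2m + 1`. -/
noncomputable def Dodd (p m : ℕ) : ℝ :=
  (-1) ^ p * ((m ! : ℝ) / ((m + p)! : ℝ)) *
    ∏ j ∈ Finset.range p, ((j ! : ℝ) ^ 2 / ((m + j)! : ℝ) ^ 2)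

/-- `γ_p = ∏_{j=0}^{p-1} j! / (p+j)!`. -/
noncomputable def gammaConst (p : ℕ) : ℝ :=
  ∏ j ∈ Finset.range p, ((j ! : ℝ) / ((p + j)! : ℝ))

/-- The common leading factor `(2N)^{p²} e^{-Np} γ_p`. -/
noncomputable def leadingFactor (N p : ℕ) : ℝ :=
  (2 * (N : ℝ)) ^ (p ^ 2) * Real.exp (-((N : ℝ) * p)) * gammaConst p

/-- The coefficient of `t ^ k` in the moment, divided by the leading factor. -/
noncomputable def normalizedCoeff (N p k : ℕ) : ℂ :=
  gueMomentCoeff N p k / (leadingFactor N p : ℂ)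

/-! ### Determinant identities -/

section DeterminantIdentities

open Matrix Polynomial

variable {ι R : Type*} [Fintype ι] [DecidableEq ι] [CommRing R]

/-! Put s = -1/(2N) and let h_m(X) be the coefficient of z^m in exp(Xz + sz²), so that m! h_m is the
monic Hermite polynomial orthogonal for exp(-Nx²/2). Everything is read off from the polynomial T =
det[h_{N+j-k}] of size 2p (`rectHermiteDet`), because the moment equals C_λ T(t).

The moment. The product of ∏(x_j - t)^{2p} with the Vandermonde determinant of x is a confluent
Vandermonde determinant of size N + 2p; it is multiplied by one more Vandermonde determinant and the
Gaussian weight. With both determinants written in Hermite polynomials, integration variable by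
variable and orthogonality leave only a 2p × 2p block of Taylor coefficients at t of the Hermite
polynomials of degrees N, …, N+2p-1 (`integral_pow_mul_vandermonde_sq`, `det_taylor_monicHermite`).
Since h_m' = h_{m-1}, that block is T up to row and column factors.

(a) The factorisation exp(tz + sz²) = exp(sz²) exp(tz) writes the matrix as a product of rectangular
ones. Cauchy–Binet then sums over strictly decreasing sequences ν_j + 2p - j: one minor is a power
of s times D_{λν}, the other is t^{|ν|} dim V_ν/|ν|!, by a Vandermonde evaluation.

(b) Let T_μ be T with its last columns shifted by a partition μ. Differentiation sums over the ways
of adding a box. The Plücker relation T T_22 = T_1 T_21 - T_2 T_11 is the KP equation in Hirota form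
for three commuting flows, the first being d/dX. The recurrence of h_m yields two linear relations
(`sum_sub_mul_hermiteDet`, `content_mul_hermiteDet`) that express the second and third flows through
X and d/dX. What remains is a fourth order bilinear differential equation for T
(`satisfiesBilinear_rectHermiteDet`). As T is even, the equation determines the coefficients of t⁴,
t⁶, t⁸ from those of 1 and t². At t = 0 the matrix splits by parity of the indices, which evaluates
T(0) and the coefficient of t².

(c) By (b), a_2 and a_4 are explicit polynomials in N times the normalised constant coefficient, up
to its sign. The latter is a product over p of quotients of four factorials (`leadingStep`); the
quotient for p = 0 is expanded by Stirling's series through N^{-3}, later ones differ by explicit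
factors 1 + c/N, and induction on p gives the closed forms. -/

theorem sum_det_updateCol_eq_trace (M V : Matrix ι ι R) :
    ∑ k, (M.updateCol k fun i => V i k).det = (M.adjugate * V).trace := by
  refine Finset.sum_congr rfl fun k _ => ?_
  rw [← cramer_apply, cramer_eq_adjugate_mulVec]
  rfl

theorem sum_det_updateRow_eq_trace (M V : Matrix ι ι R) :
    ∑ j, (M.updateRow j (V j)).det = (V * M.adjugate).trace := by
  have := sum_det_updateCol_eq_trace Mᵀ Vᵀ
  rw [← adjugate_transpose, ← transpose_mul, trace_transpose] at this
  rw [← this]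
  refine Finset.sum_congr rfl fun j _ => ?_
  rw [← det_transpose, ← updateCol_transpose]
  rfl

/-- Cyclicity of the trace. It trades column shifts for row shifts, and for consecutive rows nearly
all of the latter vanish. -/
theorem sum_det_updateCol_eq_sum_det_updateRow (M V : Matrix ι ι R) :
    ∑ k, (M.updateCol k fun i => V i k).det = ∑ j, (M.updateRow j (V j)).det := by
  rw [sum_det_updateCol_eq_trace, sum_det_updateRow_eq_trace, trace_mul_comm]

theorem sum_det_updateCol_mul_left (M L : Matrix ι ι R) :
    ∑ k, (M.updateCol k fun i => (L * M) i k).det = L.trace * M.det := by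
  rw [sum_det_updateCol_eq_trace, trace_mul_comm, Matrix.mul_assoc, mul_adjugate]
  simp [mul_comm]

theorem det_updateCol_updateCol_swap (M : Matrix ι ι R) {i j : ι} (hij : i ≠ j) (w : ι → R) :
    ((M.updateCol j w).updateCol i fun k => M k j).det = -(M.updateCol i w).det := by
  have h := det_permute' (Equiv.swap i j) (M.updateCol i w)
  rw [Equiv.Perm.sign_swap hij] at h
  have h2 : (M.updateCol i w).submatrix id (Equiv.swap i j) =
      (M.updateCol j w).updateCol i fun k => M k j := by
    ext a b
    rcases eq_or_ne b i with rfl | hb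
    · simp [hij.symm]
    · rcases eq_or_ne b j with rfl | hb'
      · simp [hij.symm]
      · simp [hb, hb', Equiv.swap_apply_of_ne_of_ne hb hb']
  rw [← h2, h]
  simp

/-- The three-term Plücker relation. -/
theorem det_mul_det_updateCol_updateCol (M : Matrix ι ι R) {i j : ι} (hij : i ≠ j) (v w : ι → R) :
    M.det * ((M.updateCol j w).updateCol i v).det =
      (M.updateCol i v).det * (M.updateCol j w).det -
        (M.updateCol j v).det * (M.updateCol i w).det := by
  -- Cramer's rule, det M • v = M · cramer v, with column j of M exchanged for w and the difference
  -- compensated. Substituted in column i, the sum over columns contributes only its term at i.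
  have h1 : M.det • v = (fun k => ∑ l, M.cramer v l • (M.updateCol j w) k l) +
      (M.cramer v j • (fun k => M k j) + (-M.cramer v j) • w) := by
    rw [← mulVec_cramer]
    ext k
    simp only [mulVec, dotProduct, Pi.add_apply, Pi.smul_apply, smul_eq_mul]
    rw [← Finset.add_sum_erase _ _ (Finset.mem_univ j),
      ← Finset.add_sum_erase (s := Finset.univ) (a := j) (f := fun l => M.cramer v l *
        (M.updateCol j w) k l) (Finset.mem_univ j)]
    have : ∑ x ∈ Finset.univ.erase j, M k x * M.cramer v x =
        ∑ x ∈ Finset.univ.erase j, M.cramer v x * (M.updateCol j w) k x :=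
      Finset.sum_congr rfl fun x hx => by
        rw [updateCol_ne (Finset.ne_of_mem_erase hx), mul_comm]
    rw [this, updateCol_self]
    ring
  rw [← det_updateCol_smul, h1, det_updateCol_add, det_updateCol_add, det_updateCol_sum,
    det_updateCol_smul, det_updateCol_smul, det_updateCol_updateCol_swap M hij]
  have h2 : ((M.updateCol j w).updateCol i w).det = 0 :=
    det_zero_of_column_eq hij fun k => by simp [hij.symm]
  rw [h2, cramer_apply, cramer_apply]
  simp only [smul_eq_mul]
  ring

theorem derivative_det (M : Matrix ι ι R[X]) :
    derivative M.det = ∑ k, (M.updateCol k fun i => derivative (M i k)).det := by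
  simp_rw [det_apply, derivative_sum, Units.smul_def, derivative_smul, derivative_prod_finset]
  rw [Finset.sum_comm]
  refine Finset.sum_congr rfl fun σ _ => ?_
  rw [← Finset.smul_sum]
  congr 1
  refine Finset.sum_congr rfl fun k _ => ?_
  rw [← Finset.prod_erase_mul _ _ (Finset.mem_univ k), updateCol_self]
  congr 1
  exact Finset.prod_congr rfl fun x hx => by rw [updateCol_ne (Finset.ne_of_mem_erase hx)]

end DeterminantIdentities

/-! ### Hermite polynomials divided by factorials -/

section HermiteSeries

open Polynomial

/-- The coefficient of `z ^ e` in `exp (s z²)`. -/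
noncomputable def gaussCoeff (s : ℂ) (e : ℤ) : ℂ :=
  if Even e ∧ 0 ≤ e then s ^ (e / 2).toNat / (((e / 2).toNat)! : ℂ) else 0

theorem gaussCoeff_of_neg (s : ℂ) {e : ℤ} (he : e < 0) : gaussCoeff s e = 0 :=
  if_neg fun h => absurd h.2 (not_le.2 he)

theorem gaussCoeff_of_odd (s : ℂ) {e : ℤ} (he : Odd e) : gaussCoeff s e = 0 :=
  if_neg fun h => Int.not_even_iff_odd.2 he h.1

theorem gaussCoeff_two_mul (s : ℂ) (k : ℕ) : gaussCoeff s (2 * k) = s ^ k / (k ! : ℂ) := by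
  rw [gaussCoeff, if_pos ⟨even_two_mul _, by positivity⟩]
  simp

theorem gaussCoeff_zero (s : ℂ) : gaussCoeff s 0 = 1 := by
  simp [gaussCoeff]

/-- Compare coefficients in z d/dz exp(sz²) = 2sz² exp(sz²). -/
theorem mul_gaussCoeff (s : ℂ) (e : ℤ) : e * gaussCoeff s e = 2 * s * gaussCoeff s (e - 2) := by
  rcases Int.even_or_odd e with he | he
  · rcases lt_trichotomy e 0 with h | rfl | h
    · rw [gaussCoeff_of_neg s h, gaussCoeff_of_neg s (by omega)]; simp
    · rw [gaussCoeff_of_neg s (by norm_num : (0 : ℤ) - 2 < 0)]; simp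
    · obtain ⟨k, rfl⟩ := he
      obtain ⟨l, rfl⟩ : ∃ l : ℕ, k = l + 1 := ⟨(k - 1).toNat, by omega⟩
      rw [show ((l : ℤ) + 1 + (l + 1)) - 2 = 2 * (l : ℕ) by ring,
        show ((l : ℤ) + 1 + (l + 1)) = 2 * ((l + 1 : ℕ) : ℤ) by push_cast; ring,
        gaussCoeff_two_mul, gaussCoeff_two_mul, Nat.factorial_succ]
      have h1 : (l ! : ℂ) ≠ 0 := by exact_mod_cast l.factorial_ne_zero
      have h2 : (l : ℂ) + 1 ≠ 0 := by exact_mod_cast l.succ_ne_zero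
      push_cast
      field_simp
      ring
  · rw [gaussCoeff_of_odd s he, gaussCoeff_of_odd s (he.sub_even even_two)]; simp

/-- The coefficient of `z ^ m` in `exp (X z + s z²)`, zero for negative `m`. -/
noncomputable def hermiteSeries (s : ℂ) (m : ℤ) : ℂ[X] :=
  ∑ k ∈ Finset.range (m.toNat + 1), monomial k (gaussCoeff s (m - k) / (k ! : ℂ))

theorem coeff_hermiteSeries (s : ℂ) (m : ℤ) (k : ℕ) :
    (hermiteSeries s m).coeff k = gaussCoeff s (m - k) / (k ! : ℂ) := by
  simp only [hermiteSeries, finsetSum_coeff, coeff_monomial, Finset.sum_ite_eq', Finset.mem_range]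
  split_ifs with h
  · rfl
  · rw [gaussCoeff_of_neg s (by omega), zero_div]

theorem hermiteSeries_zero (s : ℂ) : hermiteSeries s 0 = 1 := by
  simp [hermiteSeries, gaussCoeff_zero]

theorem derivative_hermiteSeries (s : ℂ) (m : ℤ) :
    derivative (hermiteSeries s m) = hermiteSeries s (m - 1) := by
  ext k
  rw [coeff_derivative, coeff_hermiteSeries, coeff_hermiteSeries, Nat.factorial_succ]
  have h1 : (k ! : ℂ) ≠ 0 := by exact_mod_cast k.factorial_ne_zero
  have h2 : (k : ℂ) + 1 ≠ 0 := by exact_mod_cast k.succ_ne_zero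
  rw [show m - 1 - (k : ℤ) = m - ((k + 1 : ℕ) : ℤ) by push_cast; ring]
  push_cast
  field_simp

/-- Compare coefficients in z d/dz exp(Xz + sz²) = (Xz + 2sz²) exp(Xz + sz²). This recurrence and
the derivative rule are the only properties of the entries behind the linear relations below. -/
theorem mul_hermiteSeries (s : ℂ) (m : ℤ) :
    (m : ℂ[X]) * hermiteSeries s m =
      X * hermiteSeries s (m - 1) + C (2 * s) * hermiteSeries s (m - 2) := by
  ext k
  rw [coeff_add, coeff_C_mul, show (m : ℂ[X]) = C (m : ℂ) by simp, coeff_C_mul]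
  have key := mul_gaussCoeff s (m - k)
  rcases k with _ | k
  · rw [coeff_X_mul_zero, coeff_hermiteSeries, coeff_hermiteSeries]
    simpa using key
  · rw [coeff_X_mul, coeff_hermiteSeries, coeff_hermiteSeries, coeff_hermiteSeries,
      Nat.factorial_succ]
    have h1 : (k ! : ℂ) ≠ 0 := by exact_mod_cast k.factorial_ne_zero
    have h2 : (k : ℂ) + 1 ≠ 0 := by exact_mod_cast k.succ_ne_zero
    rw [show m - 1 - (k : ℤ) = m - ((k + 1 : ℕ) : ℤ) by push_cast; ring,
      show m - 2 - ((k + 1 : ℕ) : ℤ) = m - ((k + 1 : ℕ) : ℤ) - 2 by ring]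
    push_cast at key ⊢
    field_simp
    linear_combination key

theorem comp_neg_X_hermiteSeries (s : ℂ) (m : ℤ) :
    (hermiteSeries s m).comp (-X) = C ((-1 : ℂ) ^ m) * hermiteSeries s m := by
  ext k
  have hX : (-X : ℂ[X]) = C (-1) * X := by simp
  rw [hX, comp_C_mul_X_coeff, coeff_C_mul, coeff_hermiteSeries]
  rcases Int.even_or_odd (m - k) with h | h
  · have : (-1 : ℂ) ^ m = (-1) ^ k := by
      rw [← sub_add_cancel m (k : ℤ), zpow_add₀ (by norm_num), h.neg_one_zpow, one_mul,
        zpow_natCast]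
    rw [this]
    ring
  · rw [gaussCoeff_of_odd s h]
    simp

end HermiteSeries

/-! ### Determinants with Hermite entries -/

section HermiteDet

open Matrix Polynomial

variable {ι : Type*}

/-- The matrix with entries `hermiteSeries s (a j - b k)`. -/
noncomputable def hermiteMatrix (s : ℂ) (a b : ι → ℤ) : Matrix ι ι ℂ[X] :=
  of fun j k => hermiteSeries s (a j - b k)

theorem hermiteMatrix_updateCol [DecidableEq ι] (s : ℂ) (a b : ι → ℤ) (k : ι) (c : ℤ) :
    (hermiteMatrix s a b).updateCol k (fun j => hermiteSeries s (a j - c)) =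
      hermiteMatrix s a (Function.update b k c) := by
  ext j l : 2
  rcases eq_or_ne l k with rfl | h <;> simp [hermiteMatrix, *]

theorem hermiteMatrix_updateRow [DecidableEq ι] (s : ℂ) (a b : ι → ℤ) (j : ι) (c : ℤ) :
    (hermiteMatrix s a b).updateRow j (fun k => hermiteSeries s (c - b k)) =
      hermiteMatrix s (Function.update a j c) b := by
  ext i l : 2
  rcases eq_or_ne i j with rfl | h <;> simp [hermiteMatrix, *]

variable [Fintype ι] [DecidableEq ι]

/-- The determinant with entries `hermiteSeries s (a j - b k)`. -/
noncomputable def hermiteDet (s : ℂ) (a b : ι → ℤ) : ℂ[X] :=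
  (hermiteMatrix s a b).det

theorem hermiteDet_eq_zero_of_eq (s : ℂ) (a b : ι → ℤ) {k l : ι} (hkl : k ≠ l) (h : b k = b l) :
    hermiteDet s a b = 0 :=
  det_zero_of_column_eq hkl fun j => by simp [hermiteMatrix, h]

theorem hermiteDet_eq_zero_of_row_eq (s : ℂ) (a b : ι → ℤ) {k l : ι} (hkl : k ≠ l)
    (h : a k = a l) : hermiteDet s a b = 0 :=
  det_zero_of_row_eq hkl (by ext1 j; simp [hermiteMatrix, h])

theorem hermiteDet_update_eq_zero (s : ℂ) (a b : ι → ℤ) {k l : ι} (hkl : k ≠ l) {c : ℤ}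
    (h : b l = c) : hermiteDet s a (Function.update b k c) = 0 :=
  hermiteDet_eq_zero_of_eq s a _ hkl (by simp [hkl.symm, h])

theorem hermiteDet_comp_swap (s : ℂ) (a b : ι → ℤ) {k l : ι} (hkl : k ≠ l) :
    hermiteDet s a (b ∘ Equiv.swap k l) = -hermiteDet s a b := by
  have h := det_permute' (Equiv.swap k l) (hermiteMatrix s a b)
  rw [Equiv.Perm.sign_swap hkl] at h
  rw [Units.val_neg, Units.val_one, Int.cast_neg, Int.cast_one, neg_one_mul] at h
  exact h

theorem hermiteDet_comp_equiv {κ : Type*} [Fintype κ] [DecidableEq κ] (s : ℂ) (a b : ι → ℤ)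
    (e : κ ≃ ι) : hermiteDet s (a ∘ e) (b ∘ e) = hermiteDet s a b :=
  det_submatrix_equiv_self e (hermiteMatrix s a b)

theorem derivative_hermiteDet (s : ℂ) (a b : ι → ℤ) :
    derivative (hermiteDet s a b) = ∑ k, hermiteDet s a (Function.update b k (b k + 1)) := by
  rw [hermiteDet, derivative_det]
  refine Finset.sum_congr rfl fun k _ => ?_
  rw [hermiteDet, ← hermiteMatrix_updateCol]
  congr 2
  ext1 j
  rw [hermiteMatrix, of_apply, derivative_hermiteSeries, sub_sub]

/-- Homogeneity. -/
theorem sum_sub_mul_hermiteDet (s : ℂ) (a b : ι → ℤ) :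
    ((∑ j, a j - ∑ k, b k : ℤ) : ℂ[X]) * hermiteDet s a b =
      X * ∑ k, hermiteDet s a (Function.update b k (b k + 1)) +
        C (2 * s) * ∑ k, hermiteDet s a (Function.update b k (b k + 2)) := by
  -- Multiply row j by a_j = b_k + (a_j - b_k) and apply the recurrence to the second part: column k
  -- turns into itself and its shifts by 1 and 2.
  have h1 := sum_det_updateCol_mul_left (hermiteMatrix s a b) (diagonal fun j => (a j : ℂ[X]))
  have h2 : ∀ k, ((hermiteMatrix s a b).updateCol k fun i =>
      ((diagonal fun j => (a j : ℂ[X])) * hermiteMatrix s a b) i k).det =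
      (b k : ℂ[X]) * hermiteDet s a b + (X * hermiteDet s a (Function.update b k (b k + 1)) +
        C (2 * s) * hermiteDet s a (Function.update b k (b k + 2))) := by
    intro k
    have : (fun i => ((diagonal fun j => (a j : ℂ[X])) * hermiteMatrix s a b) i k) =
        (b k : ℂ[X]) • (fun i => hermiteMatrix s a b i k) +
          ((X : ℂ[X]) • (fun i => hermiteSeries s (a i - (b k + 1))) +
            (C (2 * s) : ℂ[X]) • fun i => hermiteSeries s (a i - (b k + 2))) := by
      ext1 i
      have := mul_hermiteSeries s (a i - b k)
      simp only [diagonal_mul, Pi.add_apply, Pi.smul_apply, smul_eq_mul, hermiteMatrix, of_apply,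
        ← sub_sub]
      push_cast at this
      linear_combination this
    rw [this, det_updateCol_add, det_updateCol_add, det_updateCol_smul, det_updateCol_smul,
      det_updateCol_smul, hermiteMatrix_updateCol, hermiteMatrix_updateCol, updateCol_eq_self]
    rfl
  simp_rw [h2, Finset.sum_add_distrib, ← Finset.mul_sum, ← Finset.sum_mul, trace_diagonal] at h1
  change _ = _ * hermiteDet s a b at h1
  push_cast
  linear_combination -h1

/-- For consecutive row indices starting at `c`, a second weighted shift relation. -/
theorem content_mul_hermiteDet (s : ℂ) (a b : ι → ℤ) (c : ℤ)
    (ha : ∀ j, a j = c ∨ ∃ i, i ≠ j ∧ a i = a j - 1) :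
    (c : ℂ[X]) * ∑ k, hermiteDet s a (Function.update b k (b k + 1)) =
      ∑ k, (b k + 1 : ℂ[X]) * hermiteDet s a (Function.update b k (b k + 1)) +
      (X * ∑ k, hermiteDet s a (Function.update b k (b k + 2)) +
        C (2 * s) * ∑ k, hermiteDet s a (Function.update b k (b k + 3))) := by
  have h0 := sum_det_updateCol_eq_sum_det_updateRow (hermiteMatrix s a b)
    (of fun j k => hermiteSeries s (a j - 1 - b k))
  have h1 := sum_det_updateCol_eq_sum_det_updateRow (hermiteMatrix s a b)
    (of fun j k => (a j : ℂ[X]) * hermiteSeries s (a j - 1 - b k))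
  have r0 : ∀ j, ((hermiteMatrix s a b).updateRow j
      ((of fun j k => hermiteSeries s (a j - 1 - b k)) j)).det =
      hermiteDet s (Function.update a j (a j - 1)) b := fun j =>
    congrArg det (hermiteMatrix_updateRow s a b j (a j - 1))
  have r1 : ∀ j, ((hermiteMatrix s a b).updateRow j
      ((of fun j k => (a j : ℂ[X]) * hermiteSeries s (a j - 1 - b k)) j)).det =
      (c : ℂ[X]) * hermiteDet s (Function.update a j (a j - 1)) b := by
    intro j
    have : ((hermiteMatrix s a b).updateRow j
      ((of fun j k => (a j : ℂ[X]) * hermiteSeries s (a j - 1 - b k)) j)).det =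
        (a j : ℂ[X]) * hermiteDet s (Function.update a j (a j - 1)) b := by
      rw [hermiteDet, ← hermiteMatrix_updateRow, ← det_updateRow_smul]
      rfl
    rw [this]
    -- Lowering row j reproduces row i unless a_j = c, so in the surviving term the weight a_j is
    -- the constant c.
    rcases ha j with h | ⟨i, hi, hij⟩
    · rw [h]
    · rw [hermiteDet_eq_zero_of_row_eq s _ b hi.symm (by simp [hi, hij]), mul_zero, mul_zero]
  have c0 : ∀ k, ((hermiteMatrix s a b).updateCol k fun i =>
      (of fun j k => hermiteSeries s (a j - 1 - b k) : Matrix ι ι ℂ[X]) i k).det =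
      hermiteDet s a (Function.update b k (b k + 1)) := by
    intro k
    rw [hermiteDet, ← hermiteMatrix_updateCol]
    congr 2
    ext1 i
    rw [of_apply]
    congr 1
    ring
  have c1 : ∀ k, ((hermiteMatrix s a b).updateCol k fun i =>
      (of fun j k => (a j : ℂ[X]) * hermiteSeries s (a j - 1 - b k) : Matrix ι ι ℂ[X]) i k).det =
      (b k + 1 : ℂ[X]) * hermiteDet s a (Function.update b k (b k + 1)) +
      (X * hermiteDet s a (Function.update b k (b k + 2)) +
        C (2 * s) * hermiteDet s a (Function.update b k (b k + 3))) := by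
    intro k
    have : (fun i => (of fun j k => (a j : ℂ[X]) * hermiteSeries s (a j - 1 - b k) :
        Matrix ι ι ℂ[X]) i k) =
        (b k + 1 : ℂ[X]) • (fun i => hermiteSeries s (a i - (b k + 1))) +
          ((X : ℂ[X]) • (fun i => hermiteSeries s (a i - (b k + 2))) +
            (C (2 * s) : ℂ[X]) • fun i => hermiteSeries s (a i - (b k + 3))) := by
      ext1 i
      have := mul_hermiteSeries s (a i - (b k + 1))
      rw [show a i - (b k + 1) - 1 = a i - (b k + 2) by ring,
        show a i - (b k + 1) - 2 = a i - (b k + 3) by ring] at this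
      simp only [Pi.add_apply, Pi.smul_apply, smul_eq_mul, of_apply]
      rw [show a i - 1 - b k = a i - (b k + 1) by ring]
      push_cast at this
      linear_combination this
    rw [this, det_updateCol_add, det_updateCol_add, det_updateCol_smul, det_updateCol_smul,
      det_updateCol_smul, hermiteMatrix_updateCol, hermiteMatrix_updateCol,
      hermiteMatrix_updateCol]
    rfl
  simp_rw [c0, r0] at h0
  simp_rw [c1, r1, Finset.sum_add_distrib, ← Finset.mul_sum] at h1
  rw [h0, ← h1]

theorem hermiteDet_plucker (s : ℂ) (a b : ι → ℤ) {i j : ι} (hij : i ≠ j) (c d : ℤ) :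
    hermiteDet s a b * hermiteDet s a (Function.update (Function.update b j d) i c) =
      hermiteDet s a (Function.update b i c) * hermiteDet s a (Function.update b j d) -
        hermiteDet s a (Function.update b j c) * hermiteDet s a (Function.update b i d) := by
  have := det_mul_det_updateCol_updateCol (hermiteMatrix s a b) hij
    (fun k => hermiteSeries s (a k - c)) (fun k => hermiteSeries s (a k - d))
  simp only [hermiteMatrix_updateCol] at this
  exact this

end HermiteDet

/-! ### A bilinear differential equation -/

section BilinearEquation

open Matrix Polynomial

/-- The fourth order bilinear differential equation satisfied by Wronskians of consecutive
Hermite polynomials. -/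
def SatisfiesBilinear (σ κ δ : ℂ) (T : ℂ[X]) : Prop :=
  ∃ A B K : ℂ[X], C σ * A = C κ * T - X * derivative T ∧
    C σ * B = C δ * derivative T - X * A ∧
    C σ * K = C (κ - 2) * A - X * derivative A ∧
    T * (derivative (derivative (derivative (derivative T))) + 3 * K - 4 * derivative B) -
      4 * derivative T * (derivative (derivative (derivative T)) - B) +
      3 * (derivative (derivative T) ^ 2 - A ^ 2) = 0

/-- The subscripts are partitions, and the derivative hypotheses say that differentiation adds a
box, as multiplication by the power sum p₁ does for Schur functions. In these terms the bilinear
equation is the Hirota form (D₁⁴ + 3D₂² - 4D₁D₃) T·T = 0 of KP, which reduces to the single Plücker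
relation `pl`. The hypotheses `e`, `e2`, `e11`, `l` make the second and third flows expressible by X
and d/dX. -/
theorem satisfiesBilinear_of_relations (σ κ δ : ℂ)
    {T T1 T2 T11 T3 T21 T111 T4 T31 T22 T211 T1111 : ℂ[X]}
    (d : derivative T = T1) (d1 : derivative T1 = T2 + T11) (d2 : derivative T2 = T3 + T21)
    (d11 : derivative T11 = T21 + T111) (d3 : derivative T3 = T4 + T31)
    (d21 : derivative T21 = T31 + T22 + T211) (d111 : derivative T111 = T211 + T1111)
    (e : C κ * T = X * T1 + C σ * (T2 - T11))
    (e2 : C (κ - 2) * T2 = X * (T3 + T21) + C σ * (T4 + T22 - T211))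
    (e11 : C (κ - 2) * T11 = X * (T21 + T111) + C σ * (T31 - T22 - T1111))
    (l : C δ * T1 = X * (T2 - T11) + C σ * (T3 - T21 + T111))
    (pl : T * T22 = T1 * T21 - T2 * T11) : SatisfiesBilinear σ κ δ T := by
  -- The Schur expansions of p₂, p₃ and p₂², that is, the action on T of the second flow, the third
  -- flow, and the second flow twice.
  refine ⟨T2 - T11, T3 - T21 + T111, T4 + 2 * T22 - T211 - T31 + T1111, ?_, ?_, ?_, ?_⟩
  · rw [d, e]; ring
  · rw [d, l]; ring
  · rw [derivative_sub, d2, d11, mul_sub, e2, e11]; ring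
  · simp only [d, d1, d2, d11, d3, d21, d111, derivative_add, derivative_sub]
    linear_combination 12 * pl

/-- Rows and columns split into `q` initial and `r` final ones. -/
def splitIndex (q : ℕ) {r : ℕ} (v : Fin r → ℤ) : Fin q ⊕ Fin r → ℤ :=
  Sum.elim (fun i => (i : ℤ)) fun l => q + v l

/-- The determinant with consecutive rows, starting at `N`, and with only the last columns
shifted. -/
noncomputable def shiftedDet (s : ℂ) (N : ℤ) (q r : ℕ) (v : Fin r → ℤ) : ℂ[X] :=
  hermiteDet s (fun j => N + splitIndex q (fun l : Fin r => (l : ℤ)) j) (splitIndex q v)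

variable (s : ℂ) (N : ℤ) (q : ℕ)

theorem update_splitIndex_inr {r : ℕ} (v : Fin r → ℤ) (l : Fin r) (c : ℤ) :
    Function.update (splitIndex q v) (Sum.inr l) (splitIndex q v (Sum.inr l) + c) =
      splitIndex q (Function.update v l (v l + c)) := by
  rw [splitIndex, Sum.update_elim_inr, splitIndex]
  congr 1
  ext1 k
  rcases eq_or_ne k l with rfl | h
  · simp [add_assoc]
  · simp [h]

/-- An initial column moved by c lands on another initial column or on a position q + d with d < c,
which a final column occupies. Hence sums over all columns reduce to the final ones. The guard 0 < q
makes the occupancy condition void when there are no initial columns. -/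
theorem hermiteDet_update_splitIndex_inl {r : ℕ} (a : Fin q ⊕ Fin r → ℤ) (v : Fin r → ℤ)
    (i : Fin q) (c : ℕ) (hc : 0 < c) (h : 0 < q → ∀ d : ℕ, d < c → ∃ l, v l = d) :
    hermiteDet s a (Function.update (splitIndex q v) (Sum.inl i)
      (splitIndex q v (Sum.inl i) + c)) = 0 := by
  by_cases hi : (i : ℕ) + c < q
  · exact hermiteDet_update_eq_zero s a _ (l := Sum.inl ⟨i + c, hi⟩)
      (by simp [Fin.ext_iff]; omega) (by simp [splitIndex])
  · obtain ⟨l, hl⟩ := h (by omega) (i + c - q) (by omega)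
    refine hermiteDet_update_eq_zero s a _ (l := Sum.inr l) (by simp) ?_
    simp only [splitIndex, Sum.elim_inr, Sum.elim_inl, hl]
    omega

theorem sum_shift_shiftedDet {r : ℕ} (v : Fin r → ℤ) (f : Fin q ⊕ Fin r → ℂ[X]) (c : ℕ)
    (hc : 0 < c) (h : 0 < q → ∀ d : ℕ, d < c → ∃ l, v l = d) :
    ∑ k, f k * hermiteDet s (fun j => N + splitIndex q (fun l : Fin r => (l : ℤ)) j)
      (Function.update (splitIndex q v) k (splitIndex q v k + c)) =
    ∑ l, f (Sum.inr l) * shiftedDet s N q r (Function.update v l (v l + c)) := by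
  rw [Fintype.sum_sum_type]
  simp_rw [hermiteDet_update_splitIndex_inl s q _ v _ c hc h, update_splitIndex_inr]
  simp [shiftedDet]

theorem sum_rows_sub_sum_cols {r : ℕ} (v : Fin r → ℤ) :
    ∑ j, (N + splitIndex q (fun l : Fin r => (l : ℤ)) j) - ∑ k, splitIndex q v k =
      N * (q + r) - ∑ l, (v l - l) := by
  simp only [splitIndex, Fintype.sum_sum_type, Sum.elim_inl, Sum.elim_inr, Finset.sum_add_distrib,
    Finset.sum_const, Finset.card_univ, Fintype.card_fin, Fintype.card_sum, Finset.sum_sub_distrib, nsmul_eq_mul]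
  push_cast
  ring

theorem derivative_shiftedDet {r : ℕ} (v : Fin r → ℤ) (h : 0 < q → ∃ l, v l = 0) :
    derivative (shiftedDet s N q r v) =
      ∑ l, shiftedDet s N q r (Function.update v l (v l + 1)) := by
  rw [shiftedDet, derivative_hermiteDet]
  have := sum_shift_shiftedDet s N q v (fun _ => 1) 1 one_pos
    (by intro hq d hd; obtain rfl : d = 0 := by omega
        simpa using h hq)
  simpa using this

theorem homogeneity_shiftedDet {r : ℕ} (v : Fin r → ℤ) (h : 0 < q → ∃ l, v l = 0) (h' : 0 < q → ∃ l, v l = 1) :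
    ((N * (q + r) - ∑ l, (v l - l) : ℤ) : ℂ[X]) * shiftedDet s N q r v =
      X * ∑ l, shiftedDet s N q r (Function.update v l (v l + 1)) +
      C (2 * s) * ∑ l, shiftedDet s N q r (Function.update v l (v l + 2)) := by
  have h1 := sum_shift_shiftedDet s N q v (fun _ => 1) 1 one_pos
    (by intro hq d hd; obtain rfl : d = 0 := by omega
        simpa using h hq)
  have h2 := sum_shift_shiftedDet s N q v (fun _ => 1) 2 two_pos
    (by intro hq d hd; interval_cases d
        · simpa using h hq
        · simpa using h' hq)
  simp only [one_mul, Nat.cast_one, Nat.cast_ofNat] at h1 h2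
  rw [← h1, ← h2, ← sum_rows_sub_sum_cols, shiftedDet, sum_sub_mul_hermiteDet]

theorem rows_consecutive (r : ℕ) (j : Fin q ⊕ Fin r) :
    N + splitIndex q (fun l : Fin r => (l : ℤ)) j = N ∨ ∃ i, i ≠ j ∧
      N + splitIndex q (fun l : Fin r => (l : ℤ)) i =
        N + splitIndex q (fun l : Fin r => (l : ℤ)) j - 1 := by
  rcases j with ⟨_ | i, hi⟩ | ⟨_ | l, hl⟩
  · left; simp [splitIndex]
  · right
    exact ⟨Sum.inl ⟨i, by omega⟩, by simp, by simp [splitIndex]; ring⟩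
  · rcases q with _ | q
    · left; simp [splitIndex]
    · right
      exact ⟨Sum.inl ⟨q, by omega⟩, by simp, by simp [splitIndex]; ring⟩
  · right
    exact ⟨Sum.inr ⟨l, by omega⟩, by simp, by simp [splitIndex]; ring⟩

theorem content_shiftedDet {r : ℕ} (v : Fin r → ℤ) (h : 0 < q → ∃ l, v l = 0) (h' : 0 < q → ∃ l, v l = 1)
    (h'' : 0 < q → ∃ l, v l = 2) :
    (N : ℂ[X]) * ∑ l, shiftedDet s N q r (Function.update v l (v l + 1)) =
      ∑ l, (q + v l + 1 : ℂ[X]) * shiftedDet s N q r (Function.update v l (v l + 1)) +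
      (X * ∑ l, shiftedDet s N q r (Function.update v l (v l + 2)) +
      C (2 * s) * ∑ l, shiftedDet s N q r (Function.update v l (v l + 3))) := by
  have h0 := sum_shift_shiftedDet s N q v (fun k => (splitIndex q v k + 1 : ℂ[X])) 1 one_pos
    (by intro hq d hd; obtain rfl : d = 0 := by omega
        simpa using h hq)
  have h1 := sum_shift_shiftedDet s N q v (fun _ => 1) 1 one_pos
    (by intro hq d hd; obtain rfl : d = 0 := by omega
        simpa using h hq)
  have h2 := sum_shift_shiftedDet s N q v (fun _ => 1) 2 two_pos
    (by intro hq d hd; interval_cases d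
        · simpa using h hq
        · simpa using h' hq)
  have h3 := sum_shift_shiftedDet s N q v (fun _ => 1) 3 three_pos
    (by intro hq d hd; interval_cases d
        · simpa using h hq
        · simpa using h' hq
        · simpa using h'' hq)
  simp only [one_mul, Nat.cast_one, Nat.cast_ofNat] at h0 h1 h2 h3
  have h4 : ∀ l, ((splitIndex q v (Sum.inr l) : ℂ[X]) + 1) = q + v l + 1 := by
    intro l; simp [splitIndex]
  simp only [h4] at h0
  rw [← h1, ← h2, ← h3, ← h0]
  exact content_mul_hermiteDet s _ _ N (rows_consecutive N q r)

theorem shiftedDet_eq_zero {r : ℕ} (v : Fin r → ℤ) {k l : Fin r} (hkl : k ≠ l) (h : v k = v l) :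
    shiftedDet s N q r v = 0 :=
  hermiteDet_eq_zero_of_eq s _ _ (k := Sum.inr k) (l := Sum.inr l) (by simpa using hkl)
    (by simp [splitIndex, h])

theorem shiftedDet_comp_swap {r : ℕ} (v : Fin r → ℤ) {k l : Fin r} (hkl : k ≠ l) :
    shiftedDet s N q r (v ∘ Equiv.swap k l) = -shiftedDet s N q r v := by
  rw [shiftedDet, shiftedDet, ← hermiteDet_comp_swap s _ _ (k := Sum.inr k) (l := Sum.inr l)
    (by simpa using hkl)]
  congr 1
  ext1 j
  rcases j with j | j
  · simp [splitIndex, Equiv.swap_apply_of_ne_of_ne]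
  · simp only [splitIndex, Sum.elim_inr, Function.comp_apply]
    rcases eq_or_ne j k with rfl | h
    · simp
    · rcases eq_or_ne j l with rfl | h'
      · simp
      · simp [Equiv.swap_apply_of_ne_of_ne, h, h']

theorem shiftedDet_plucker {r : ℕ} (v : Fin r → ℤ) {i j : Fin r} (hij : i ≠ j) (c d : ℤ) :
    shiftedDet s N q r v *
        shiftedDet s N q r (Function.update (Function.update v j (v j + d)) i (v i + c)) =
      shiftedDet s N q r (Function.update v i (v i + c)) *
        shiftedDet s N q r (Function.update v j (v j + d)) -
      shiftedDet s N q r (Function.update v j (v i + c)) *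
        shiftedDet s N q r (Function.update v i (v j + d)) := by
  have key : ∀ (w : Fin r → ℤ) (l : Fin r) (e : ℤ), splitIndex q (Function.update w l e) =
      Function.update (splitIndex q w) (Sum.inr l) (q + e) := by
    intro w l e
    rw [splitIndex, splitIndex, Sum.update_elim_inr]
    congr 1
    ext1 k
    rcases eq_or_ne k l with rfl | h <;> simp [*]
  simp only [shiftedDet, key]
  exact hermiteDet_plucker s _ _ (by simpa using hij) _ _

theorem update_vec_four (v w x y z : ℤ) :
    Function.update ![w, x, y, z] 0 v = ![v, x, y, z] ∧
    Function.update ![w, x, y, z] 1 v = ![w, v, y, z] ∧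
    Function.update ![w, x, y, z] 2 v = ![w, x, v, z] ∧
    Function.update ![w, x, y, z] 3 v = ![w, x, y, v] := by
  refine ⟨?_, ?_, ?_, ?_⟩ <;> · ext i; fin_cases i <;> rfl

theorem update_vec_two (v w x : ℤ) :
    Function.update ![w, x] 0 v = ![v, x] ∧ Function.update ![w, x] 1 v = ![w, v] := by
  refine ⟨?_, ?_⟩ <;> · ext i; fin_cases i <;> rfl

theorem shiftedDet_four_eq_zero (x y z : ℤ) :
    shiftedDet s N q 4 ![x, x, y, z] = 0 ∧ shiftedDet s N q 4 ![y, x, x, z] = 0 ∧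
    shiftedDet s N q 4 ![y, z, x, x] = 0 ∧ shiftedDet s N q 4 ![x, y, x, z] = 0 ∧
    shiftedDet s N q 4 ![y, x, z, x] = 0 :=
  ⟨shiftedDet_eq_zero s N q _ (k := 0) (l := 1) (by decide) rfl,
    shiftedDet_eq_zero s N q _ (k := 1) (l := 2) (by decide) rfl,
    shiftedDet_eq_zero s N q _ (k := 2) (l := 3) (by decide) rfl,
    shiftedDet_eq_zero s N q _ (k := 0) (l := 2) (by decide) rfl,
    shiftedDet_eq_zero s N q _ (k := 1) (l := 3) (by decide) rfl⟩

theorem shiftedDet_four_swap (w x y z : ℤ) :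
    shiftedDet s N q 4 ![x, w, y, z] = -shiftedDet s N q 4 ![w, x, y, z] ∧
    shiftedDet s N q 4 ![w, y, x, z] = -shiftedDet s N q 4 ![w, x, y, z] ∧
    shiftedDet s N q 4 ![w, x, z, y] = -shiftedDet s N q 4 ![w, x, y, z] := by
  refine ⟨?_, ?_, ?_⟩
  · rw [← shiftedDet_comp_swap s N q _ (k := 0) (l := 1) (by decide)]
    congr 1; ext i; fin_cases i <;> rfl
  · rw [← shiftedDet_comp_swap s N q _ (k := 1) (l := 2) (by decide)]
    congr 1; ext i; fin_cases i <;> rfl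
  · rw [← shiftedDet_comp_swap s N q _ (k := 2) (l := 3) (by decide)]
    congr 1; ext i; fin_cases i <;> rfl

/-- T_μ is the determinant whose last four columns are (0,1,2,3) plus the parts of μ in increasing
order; for instance T_22 is `![0, 1, 4, 5]`. Four columns suffice because only partitions of size at
most 4 occur. The content relation contributes N - (q+4), since only the last column can move by
one. -/
theorem satisfiesBilinear_shiftedDet_four :
    SatisfiesBilinear (2 * s) (N * (q + 4)) (N - (q + 4)) (shiftedDet s N q 4 ![0, 1, 2, 3]) := by
  have z1 := fun x y z => (shiftedDet_four_eq_zero s N q x y z).1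
  have z2 := fun x y z => (shiftedDet_four_eq_zero s N q x y z).2.1
  have z3 := fun x y z => (shiftedDet_four_eq_zero s N q x y z).2.2.1
  have z4 := fun x y z => (shiftedDet_four_eq_zero s N q x y z).2.2.2.1
  have z5 := fun x y z => (shiftedDet_four_eq_zero s N q x y z).2.2.2.2
  have D : ∀ v : Fin 4 → ℤ, v 0 = 0 → derivative (shiftedDet s N q 4 v) = _ :=
    fun v h => derivative_shiftedDet s N q v fun _ => ⟨0, h⟩
  have E : ∀ v : Fin 4 → ℤ, v 0 = 0 → v 1 = 1 → _ = _ :=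
    fun v h h' => homogeneity_shiftedDet s N q v (fun _ => ⟨0, h⟩) fun _ => ⟨1, h'⟩
  have d := D ![0, 1, 2, 3] rfl
  have d1 := D ![0, 1, 2, 4] rfl
  have d2 := D ![0, 1, 2, 5] rfl
  have d11 := D ![0, 1, 3, 4] rfl
  have d3 := D ![0, 1, 2, 6] rfl
  have d21 := D ![0, 1, 3, 5] rfl
  have d111 := D ![0, 2, 3, 4] rfl
  have e := E ![0, 1, 2, 3] rfl rfl
  have e2 := E ![0, 1, 2, 5] rfl rfl
  have e11 := E ![0, 1, 3, 4] rfl rfl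
  have l := content_shiftedDet s N q ![0, 1, 2, 3] (fun _ => ⟨0, rfl⟩) (fun _ => ⟨1, rfl⟩)
    fun _ => ⟨2, rfl⟩
  have pl := shiftedDet_plucker s N q ![0, 1, 2, 3] (i := 2) (j := 3) (by decide) 2 2
  -- Shifting can leave the columns unsorted; each transposition needed to sort them costs a sign.
  have w1 : shiftedDet s N q 4 ![2, 1, 3, 4] = -shiftedDet s N q 4 ![1, 2, 3, 4] :=
    (shiftedDet_four_swap s N q _ _ _ _).1
  have w2 : shiftedDet s N q 4 ![0, 1, 4, 3] = -shiftedDet s N q 4 ![0, 1, 3, 4] :=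
    (shiftedDet_four_swap s N q _ _ _ _).2.2
  have w3 : shiftedDet s N q 4 ![0, 4, 2, 3] = shiftedDet s N q 4 ![0, 2, 3, 4] := by
    rw [(shiftedDet_four_swap s N q 0 2 4 3).2.1, (shiftedDet_four_swap s N q 0 2 3 4).2.2, neg_neg]
  have w4 : shiftedDet s N q 4 ![0, 1, 5, 3] = -shiftedDet s N q 4 ![0, 1, 3, 5] :=
    (shiftedDet_four_swap s N q _ _ _ _).2.2
  have w5 : shiftedDet s N q 4 ![0, 3, 2, 5] = -shiftedDet s N q 4 ![0, 2, 3, 5] :=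
    (shiftedDet_four_swap s N q _ _ _ _).2.1
  have w6 : shiftedDet s N q 4 ![0, 1, 5, 4] = -shiftedDet s N q 4 ![0, 1, 4, 5] :=
    (shiftedDet_four_swap s N q _ _ _ _).2.2
  have w7 : shiftedDet s N q 4 ![3, 1, 2, 3] = 0 :=
    shiftedDet_eq_zero s N q _ (k := 0) (l := 3) (by decide) rfl
  have c2 : (C (2 : ℂ) : ℂ[X]) = 2 := rfl
  have c4 : (C (4 : ℂ) : ℂ[X]) = 4 := rfl
  simp [Fin.sum_univ_four, update_vec_four, z1, z2, z3, z4, z5,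
    c2] at d d1 d2 d11 d3 d21 d111 e e2 e11 l pl
  rw [w2] at e
  rw [w5] at e2
  rw [w1, w6] at e11
  rw [w2, w3, w4, w7] at l
  rw [w2, w4] at pl
  refine satisfiesBilinear_of_relations _ _ _
    (T22 := shiftedDet s N q 4 ![0, 1, 4, 5]) d (d1.trans (add_comm _ _)) (d2.trans (add_comm _ _))
    (d11.trans (add_comm _ _)) (d3.trans (add_comm _ _)) (d21.trans ?_) (d111.trans (add_comm _ _))
    ?_ ?_ ?_ ?_ ?_ <;> try simp [c2, c4]
  · ring
  · linear_combination e
  · linear_combination e2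
  · linear_combination e11
  · linear_combination l
  · linear_combination pl

/-- The case p = 1 has only two columns, so partitions with three or more parts contribute zero. -/
theorem satisfiesBilinear_shiftedDet_two :
    SatisfiesBilinear (2 * s) (N * 2) (N - 2) (shiftedDet s N 0 2 ![0, 1]) := by
  have z : ∀ x, shiftedDet s N 0 2 ![x, x] = 0 := fun x =>
    shiftedDet_eq_zero s N 0 _ (k := 0) (l := 1) (by decide) rfl
  have w : ∀ x y, shiftedDet s N 0 2 ![x, y] = -shiftedDet s N 0 2 ![y, x] := fun x y => by
    rw [← shiftedDet_comp_swap s N 0 _ (k := 0) (l := 1) (by decide)]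
    congr 1; ext i; fin_cases i <;> rfl
  have D := fun v : Fin 2 → ℤ => derivative_shiftedDet s N 0 v (by simp)
  have E := fun v : Fin 2 → ℤ => homogeneity_shiftedDet s N 0 v (by simp) (by simp)
  have d := D ![0, 1]
  have d1 := D ![0, 2]
  have d2 := D ![0, 3]
  have d11 := D ![1, 2]
  have d3 := D ![0, 4]
  have d21 := D ![1, 3]
  have e := E ![0, 1]
  have e2 := E ![0, 3]
  have e11 := E ![1, 2]
  have l := content_shiftedDet s N 0 ![0, 1] (by simp) (by simp) (by simp)
  have pl := shiftedDet_plucker s N 0 ![0, 1] (i := 0) (j := 1) (by decide) 2 2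
  have c2 : (C (2 : ℂ) : ℂ[X]) = 2 := rfl
  simp [Fin.sum_univ_two, update_vec_two, z, c2] at d d1 d2 d11 d3 d21 e e2 e11 l pl
  rw [w 2 1] at e
  rw [w 3 2] at e11
  rw [w 2 1, w 3 1] at l
  rw [w 2 1, w 3 1] at pl
  refine satisfiesBilinear_of_relations _ _ _ (T22 := shiftedDet s N 0 2 ![2, 3])
    (T111 := 0) (T211 := 0) (T1111 := 0)
    d (d1.trans (add_comm _ _)) (d2.trans (add_comm _ _))
    (d11.trans ?_) (d3.trans (add_comm _ _)) (d21.trans ?_) (by simp)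
    ?_ ?_ ?_ ?_ ?_ <;> try simp [c2]
  · ring
  · linear_combination e
  · linear_combination e2
  · linear_combination e11
  · linear_combination l
  · linear_combination pl

end BilinearEquation

/-! ### Low order coefficients -/

section Coefficients

open Matrix Polynomial

/-- The polynomial `det [hermiteSeries (N + j - k)]` of size `n`. -/
noncomputable def rectHermiteDet (s : ℂ) (N n : ℕ) : ℂ[X] :=
  hermiteDet s (fun j : Fin n => (N : ℤ) + j) (fun k : Fin n => (k : ℤ))

theorem rectHermiteDet_eq_shiftedDet (s : ℂ) (N q r : ℕ) :
    rectHermiteDet s N (q + r) = shiftedDet s N q r (fun l => l) := by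
  rw [rectHermiteDet, ← hermiteDet_comp_equiv s _ _ finSumFinEquiv, shiftedDet]
  congr 1 <;> ext1 j <;> rcases j with j | j <;> simp [splitIndex]

theorem satisfiesBilinear_rectHermiteDet (s : ℂ) (N p : ℕ) (hp : 1 ≤ p) :
    SatisfiesBilinear (2 * s) (2 * p * N) (N - 2 * p) (rectHermiteDet s N (2 * p)) := by
  obtain rfl | ⟨q, rfl⟩ : p = 1 ∨ ∃ q, p = q + 2 := by
    rcases eq_or_ne p 1 with h | h
    · exact Or.inl h
    · exact Or.inr ⟨p - 2, by omega⟩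
  · have h := satisfiesBilinear_shiftedDet_two s N
    have e : rectHermiteDet s N (2 * 1) = shiftedDet s N 0 2 ![0, 1] := by
      rw [show 2 * 1 = 0 + 2 from rfl, rectHermiteDet_eq_shiftedDet]
      congr 1; ext i; fin_cases i <;> rfl
    rw [e]
    convert h using 1 <;> push_cast <;> ring
  · have h := satisfiesBilinear_shiftedDet_four s N (2 * q)
    have e : rectHermiteDet s N (2 * (q + 2)) = shiftedDet s N (2 * q) 4 ![0, 1, 2, 3] := by
      rw [show 2 * (q + 2) = 2 * q + 4 by ring, rectHermiteDet_eq_shiftedDet]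
      congr 1; ext i; fin_cases i <;> rfl
    rw [e]
    convert h using 1 <;> push_cast <;> ring

theorem hermiteDet_comp_neg_X {ι : Type*} [Fintype ι] [DecidableEq ι] (s : ℂ) (a b : ι → ℤ) :
    (hermiteDet s a b).comp (-X) = C ((-1 : ℂ) ^ (∑ j, a j - ∑ k, b k)) * hermiteDet s a b := by
  have h1 : (hermiteDet s a b).comp (-X) =
      (of fun j k => C ((-1 : ℂ) ^ a j) * (of fun j k => C ((-1 : ℂ) ^ (-b k)) *
        hermiteMatrix s a b j k : Matrix ι ι ℂ[X]) j k).det := by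
    rw [← coe_compRingHom_apply, hermiteDet, RingHom.map_det]
    congr 1
    ext j k : 2
    rw [RingHom.mapMatrix_apply, map_apply, coe_compRingHom_apply, hermiteMatrix, of_apply,
      of_apply, of_apply, of_apply, comp_neg_X_hermiteSeries, ← mul_assoc, ← C_mul,
      ← zpow_add₀ (by norm_num), sub_eq_add_neg]
  rw [h1, det_mul_column, det_mul_row, ← mul_assoc, ← map_prod, ← map_prod, ← C_mul,
    ← hermiteDet]
  congr 2
  have key : ∀ c : ι → ℤ, ∏ i, (-1 : ℂ) ^ c i = (-1) ^ ∑ i, c i := fun c => by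
    induction (Finset.univ : Finset ι) using Finset.induction_on with
    | empty => simp
    | insert i t hi ih => rw [Finset.prod_insert hi, Finset.sum_insert hi, ih,
        zpow_add₀ (by norm_num)]
  rw [key, key, ← zpow_add₀ (by norm_num), Finset.sum_neg_distrib, sub_eq_add_neg]

theorem coeff_rectHermiteDet_of_odd (s : ℂ) (N p : ℕ) {k : ℕ} (hk : Odd k) :
    (rectHermiteDet s N (2 * p)).coeff k = 0 := by
  have h := hermiteDet_comp_neg_X s (fun j : Fin (2 * p) => (N : ℤ) + j) (fun k => (k : ℤ))
  -- The total degree is N · 2p, which makes T an even polynomial.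
  have e : Even (∑ j : Fin (2 * p), ((N : ℤ) + j) - ∑ k : Fin (2 * p), (k : ℤ)) := by
    rw [Finset.sum_add_distrib, add_sub_cancel_right]
    simp
  rw [e.neg_one_zpow, C_1, one_mul] at h
  have h2 := congrArg (fun P => P.coeff k) h
  have hX : (-X : ℂ[X]) = C (-1) * X := by simp
  simp only [hX, comp_C_mul_X_coeff, hk.neg_one_pow] at h2
  change _ = (rectHermiteDet s N (2 * p)).coeff k at h2
  change (rectHermiteDet s N (2 * p)).coeff k * -1 = _ at h2
  linear_combination -(1 / 2 : ℂ) * h2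

/-- These are the coefficients of X⁰, X² and X⁴ of the bilinear equation. In the last two σ ≠ 0 is
needed so that the odd coefficients of A vanish along with those of T. -/
theorem coeff_relations_of_satisfiesBilinear {σ κ δ : ℂ} {T : ℂ[X]} (h : SatisfiesBilinear σ κ δ T)
    (h1 : T.coeff 1 = 0) (h3 : T.coeff 3 = 0) (h5 : T.coeff 5 = 0) :
    ∃ A B K : ℕ → ℂ,
      (∀ k, σ * A k = (κ - k) * T.coeff k) ∧
      (∀ k, σ * B (k + 1) = δ * ((k + 2) * T.coeff (k + 2)) - A k) ∧
      (∀ k, σ * K k = (κ - 2 - k) * A k) ∧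
      T.coeff 0 * (24 * T.coeff 4 + 3 * K 0 - 4 * B 1) +
        3 * (4 * T.coeff 2 ^ 2 - A 0 ^ 2) = 0 ∧
      (σ ≠ 0 → T.coeff 0 * (360 * T.coeff 6 + 3 * K 2 - 12 * B 3) +
        T.coeff 2 * (24 * T.coeff 4 + 3 * K 0 - 4 * B 1) -
        8 * T.coeff 2 * (24 * T.coeff 4 - B 1) +
        3 * (48 * T.coeff 2 * T.coeff 4 - 2 * A 0 * A 2) = 0) ∧
      (σ ≠ 0 → T.coeff 0 * (1680 * T.coeff 8 + 3 * K 4 - 20 * B 5) +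
        T.coeff 2 * (360 * T.coeff 6 + 3 * K 2 - 12 * B 3) +
        T.coeff 4 * (24 * T.coeff 4 + 3 * K 0 - 4 * B 1) -
        8 * T.coeff 2 * (120 * T.coeff 6 - B 3) - 16 * T.coeff 4 * (24 * T.coeff 4 - B 1) +
        3 * (120 * T.coeff 2 * T.coeff 6 + 144 * T.coeff 4 ^ 2 - 2 * A 0 * A 4 - A 2 ^ 2) = 0) := by
  obtain ⟨A, B, K, hA, hB, hK, hE⟩ := h
  have hA' : ∀ k, σ * A.coeff k = (κ - k) * T.coeff k := by
    intro k
    have := congrArg (fun P => P.coeff k) hA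
    rcases k with _ | k
    · simpa using this
    · simp only [coeff_sub, coeff_C_mul, coeff_X_mul, coeff_derivative] at this
      rw [this]; push_cast; ring
  have hB' : ∀ k, σ * B.coeff (k + 1) = δ * ((k + 2) * T.coeff (k + 2)) - A.coeff k := by
    intro k
    have := congrArg (fun P => P.coeff (k + 1)) hB
    simp only [coeff_sub, coeff_C_mul, coeff_X_mul, coeff_derivative] at this
    rw [this]; push_cast; ring
  have hK' : ∀ k, σ * K.coeff k = (κ - 2 - k) * A.coeff k := by
    intro k
    have := congrArg (fun P => P.coeff k) hK
    rcases k with _ | k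
    · simpa using this
    · simp only [coeff_sub, coeff_C_mul, coeff_X_mul, coeff_derivative] at this
      rw [this]; push_cast; ring
  refine ⟨A.coeff, B.coeff, K.coeff, hA', hB', hK', ?_, fun hσ => ?_, fun hσ => ?_⟩
  · have := congrArg (fun P => P.coeff 0) hE
    rw [show (3 : ℂ[X]) = C 3 from rfl, show (4 : ℂ[X]) = C 4 from rfl] at this
    simp [coeff_mul, sq, coeff_derivative, h1] at this
    linear_combination this
  all_goals
    have a1 : A.coeff 1 = 0 := by simpa [h1, hσ] using hA' 1
    have a3 : A.coeff 3 = 0 := by simpa [h3, hσ] using hA' 3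
  · have := congrArg (fun P => P.coeff 2) hE
    rw [show (3 : ℂ[X]) = C 3 from rfl, show (4 : ℂ[X]) = C 4 from rfl] at this
    simp [coeff_mul, sq, coeff_derivative, h1, h3, a1, Finset.Nat.antidiagonal_succ] at this
    linear_combination this
  · have := congrArg (fun P => P.coeff 4) hE
    rw [show (3 : ℂ[X]) = C 3 from rfl, show (4 : ℂ[X]) = C 4 from rfl] at this
    simp [coeff_mul, sq, coeff_derivative, h1, h3, h5, a1, a3, Finset.Nat.antidiagonal_succ] at this
    linear_combination this

/-- After A, B, K are eliminated, the three equations contain the highest coefficient only through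
24 T₀T₄, 360 T₀T₆ and 1680 T₀T₈. With T₀ ≠ 0 they can therefore be solved in turn, starting from T₂.
-/
theorem coeffs_of_satisfiesBilinear {N p : ℂ} (hN : N ≠ 0) {T : ℂ[X]}
    (h : SatisfiesBilinear (2 * (-1 / (2 * N))) (2 * p * N) (N - 2 * p) T)
    (h1 : T.coeff 1 = 0) (h3 : T.coeff 3 = 0) (h5 : T.coeff 5 = 0) (h0 : T.coeff 0 ≠ 0) :
    (T.coeff 2 = 0 →
      T.coeff 4 = T.coeff 0 * (2 ^ 2 * N ^ 2 / 24 * (N * p)) ∧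
      T.coeff 6 = T.coeff 0 * (2 ^ 3 * N ^ 3 / 720 * (2 * N * p * (2 * p - N))) ∧
      T.coeff 8 = T.coeff 0 * (2 ^ 4 * N ^ 4 / 40320 *
        (N * p * (4 * N ^ 2 - 17 * N * p + 16 * p ^ 2 + 2)))) ∧
    (T.coeff 2 = N * p * T.coeff 0 →
      T.coeff 4 = T.coeff 0 * (2 ^ 2 * N ^ 2 / 24 * (p ^ 2 - N * p)) ∧
      T.coeff 6 = T.coeff 0 * (2 ^ 3 * N ^ 3 / 720 * (p * (2 * N ^ 2 - 3 * N * p + p ^ 2))) ∧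
      T.coeff 8 = T.coeff 0 * (2 ^ 4 * N ^ 4 / 40320 *
        (p * (-4 * N ^ 3 + 15 * N ^ 2 * p - 6 * N * p ^ 2 - 2 * N + p ^ 3 - 4 * p)))) := by
  obtain ⟨A, B, K, hA, hB, hK, e0, e2, e4⟩ := coeff_relations_of_satisfiesBilinear h h1 h3 h5
  have hσ : (2 * (-1 / (2 * N))) ≠ 0 := by
    simp [hN]
  replace e2 := e2 hσ
  replace e4 := e4 hσ
  have solve : ∀ x y : ℂ, 2 * (-1 / (2 * N)) * x = y → x = -N * y := by
    intro x y hxy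
    rw [← hxy]
    field_simp
  have A0 := solve _ _ (hA 0)
  have A2 := solve _ _ (hA 2)
  have A4 := solve _ _ (hA 4)
  have K0 := solve _ _ (hK 0)
  have K2 := solve _ _ (hK 2)
  have K4 := solve _ _ (hK 4)
  have B1 := solve _ _ (hB 0)
  have B3 := solve _ _ (hB 2)
  have B5 := solve _ _ (hB 4)
  norm_num at A0 A2 A4 K0 K2 K4 B1 B3 B5
  rw [A0] at K0 B1 e0 e2 e4
  rw [A2] at K2 B3 e2 e4
  rw [A4] at K4 B5 e4
  rw [K0, B1] at e0 e2 e4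
  rw [K2, B3] at e2 e4
  rw [K4, B5] at e4
  constructor
  · intro h2
    rw [h2] at e0 e2 e4
    have c4 : T.coeff 4 = T.coeff 0 * (2 ^ 2 * N ^ 2 / 24 * (N * p)) :=
      mul_left_cancel₀ h0 (by linear_combination (1 / 24) * e0)
    rw [c4] at e2 e4
    have c6 : T.coeff 6 = T.coeff 0 * (2 ^ 3 * N ^ 3 / 720 * (2 * N * p * (2 * p - N))) :=
      mul_left_cancel₀ h0 (by linear_combination (1 / 360) * e2)
    rw [c6] at e4
    exact ⟨c4, c6, mul_left_cancel₀ h0 (by linear_combination (1 / 1680) * e4)⟩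
  · intro h2
    rw [h2] at e0 e2 e4
    have c4 : T.coeff 4 = T.coeff 0 * (2 ^ 2 * N ^ 2 / 24 * (p ^ 2 - N * p)) :=
      mul_left_cancel₀ h0 (by linear_combination (1 / 24) * e0)
    rw [c4] at e2 e4
    have c6 : T.coeff 6 = T.coeff 0 *
        (2 ^ 3 * N ^ 3 / 720 * (p * (2 * N ^ 2 - 3 * N * p + p ^ 2))) :=
      mul_left_cancel₀ h0 (by linear_combination (1 / 360) * e2)
    rw [c6] at e4
    exact ⟨c4, c6, mul_left_cancel₀ h0 (by linear_combination (1 / 1680) * e4)⟩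

theorem coeff_zero_hermiteDet {ι : Type*} [Fintype ι] [DecidableEq ι] (s : ℂ) (a b : ι → ℤ) :
    (hermiteDet s a b).coeff 0 = (of fun j k => gaussCoeff s (a j - b k)).det := by
  rw [coeff_zero_eq_eval_zero, ← coe_evalRingHom, hermiteDet, RingHom.map_det]
  congr 1
  ext j k : 2
  rw [RingHom.mapMatrix_apply, map_apply, coe_evalRingHom, ← coeff_zero_eq_eval_zero, hermiteMatrix,
    of_apply, of_apply, coeff_hermiteSeries]
  simp

/-- Homogeneity restricted to the even columns, at `X = 0`. -/
theorem sum_even_coeff_zero_hermiteDet {ι : Type*} [Fintype ι] [DecidableEq ι] (s : ℂ)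
    (a b : ι → ℤ) :
    ∑ k, (if Even (b k) then b k * (hermiteDet s a b).coeff 0 +
      2 * s * (hermiteDet s a (Function.update b k (b k + 2))).coeff 0 else 0) =
    (∑ j, if Even (a j) then (a j : ℂ) else 0) * (hermiteDet s a b).coeff 0 := by
  -- At X = 0 an entry with indices of opposite parity vanishes, so weighting the even rows alone
  -- affects the even columns alone.
  have h := sum_det_updateCol_mul_left (of fun j k => gaussCoeff s (a j - b k))
    (diagonal fun j => if Even (a j) then (a j : ℂ) else 0)
  rw [trace_diagonal, ← coeff_zero_hermiteDet] at h
  rw [← h]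
  refine Finset.sum_congr rfl fun k _ => ?_
  simp only [diagonal_mul, of_apply]
  split_ifs with hk
  · have h1 : (fun i => (if Even (a i) then (a i : ℂ) else 0) * gaussCoeff s (a i - b k)) =
        (b k : ℂ) • (fun i => gaussCoeff s (a i - b k)) +
          (2 * s) • fun i => gaussCoeff s (a i - (b k + 2)) := by
      ext1 i
      have h2 := mul_gaussCoeff s (a i - b k)
      rw [sub_sub] at h2
      simp only [Pi.add_apply, Pi.smul_apply, smul_eq_mul]
      split_ifs with hi
      · push_cast at h2
        linear_combination h2
      · have h3 : gaussCoeff s (a i - b k) = 0 :=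
          gaussCoeff_of_odd s ((Int.not_even_iff_odd.1 hi).sub_even hk)
        rw [h3] at h2 ⊢
        linear_combination h2
    have h4 : (of fun j l => gaussCoeff s (a j - b l)).updateCol k
        (fun i => gaussCoeff s (a i - (b k + 2))) =
        of fun j l => gaussCoeff s (a j - Function.update b k (b k + 2) l) := by
      ext j l : 2
      rcases eq_or_ne l k with rfl | hl <;> simp [*]
    rw [h1, det_updateCol_add, det_updateCol_smul, det_updateCol_smul, h4, coeff_zero_hermiteDet,
      coeff_zero_hermiteDet]
    congr 3
    exact (updateCol_eq_self _ k).symm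
  · rw [eq_comm]
    have h1 : (fun i => (if Even (a i) then (a i : ℂ) else 0) * gaussCoeff s (a i - b k)) =
        fun _ => 0 := by
      ext1 i
      split_ifs with hi
      · rw [gaussCoeff_of_odd s (hi.sub_odd (Int.not_even_iff_odd.1 hk)), mul_zero]
      · rw [zero_mul]
    rw [h1]
    exact det_eq_zero_of_column_eq_zero k fun i => by simp

/-- The excess of the even row labels over the even column labels, computed by adding two
consecutive indices at a time. -/
theorem sum_even_index (N : ℤ) (p : ℕ) :
    ∑ i ∈ Finset.range (2 * p), ((if Even (N + i) then ((N + i : ℤ) : ℂ) else 0) -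
      if Even (i : ℤ) then (i : ℂ) else 0) = if Even N then (N * p : ℂ) else (N + 1) * p := by
  induction p with
  | zero => simp
  | succ p ih =>
    rw [show 2 * (p + 1) = 2 * p + 1 + 1 by ring, Finset.sum_range_succ, Finset.sum_range_succ, ih]
    have h2 : ¬ Even (2 * (p : ℤ) + 1) := by simp [parity_simps]
    by_cases hN : Even N
    · have h4 : ¬ Even (N + (2 * (p : ℤ) + 1)) := by
        rw [Int.even_add]; simp [hN, h2]
      have h3 : Even (N + 2 * (p : ℤ)) := hN.add (even_two_mul _)
      push_cast
      simp only [hN, h2, h3, h4, even_two_mul, if_true, if_false]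
      ring
    · have h3 : ¬ Even (N + 2 * (p : ℤ)) := by
        rw [Int.even_add]; simp [hN]
      have h4 : Even (N + (2 * (p : ℤ) + 1)) := by
        rw [Int.even_add]; simp [hN, h2]
      push_cast
      simp only [hN, h2, h3, h4, even_two_mul, if_true, if_false]
      ring

/-- Three relations at X = 0 determine the coefficient. The even-column relation moves only the
next-to-last column and gives T_11; homogeneity, 2pN T = 2s(T_2 - T_11), gives T_2; and twice the
coefficient of X² is T_2 + T_11. -/
theorem coeff_two_rectHermiteDet {s : ℂ} (hs : s ≠ 0) (N p : ℕ) (hp : 1 ≤ p) :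
    (rectHermiteDet s N (2 * p)).coeff 2 =
      if Even N then 0 else -p / (2 * s) * (rectHermiteDet s N (2 * p)).coeff 0 := by
  obtain ⟨q, rfl⟩ : ∃ q, p = q + 1 := ⟨p - 1, by omega⟩
  have e : rectHermiteDet s N (2 * (q + 1)) = shiftedDet s N (2 * q) 2 ![0, 1] := by
    rw [show 2 * (q + 1) = 2 * q + 2 by ring, rectHermiteDet_eq_shiftedDet]
    congr 1; ext i; fin_cases i <;> rfl
  have z : ∀ x, shiftedDet s N (2 * q) 2 ![x, x] = 0 := fun x =>
    shiftedDet_eq_zero s N (2 * q) _ (k := 0) (l := 1) (by decide) rfl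
  have w : shiftedDet s N (2 * q) 2 ![2, 1] = -shiftedDet s N (2 * q) 2 ![1, 2] := by
    rw [← shiftedDet_comp_swap s N (2 * q) _ (k := 0) (l := 1) (by decide)]
    congr 1; ext i; fin_cases i <;> rfl
  have d := derivative_shiftedDet s N (2 * q) ![0, 1] (fun _ => ⟨0, rfl⟩)
  have d1 := derivative_shiftedDet s N (2 * q) ![0, 2] (fun _ => ⟨0, rfl⟩)
  have e0 := homogeneity_shiftedDet s N (2 * q) ![0, 1] (fun _ => ⟨0, rfl⟩) (fun _ => ⟨1, rfl⟩)
  have c2 : (C (2 : ℂ) : ℂ[X]) = 2 := rfl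
  simp [Fin.sum_univ_two, update_vec_two, z, w] at d d1 e0
  have ev := sum_even_coeff_zero_hermiteDet s
    (fun j => (N : ℤ) + splitIndex (2 * q) (fun l : Fin 2 => (l : ℤ)) j)
    (splitIndex (2 * q) ![0, 1])
  have inl0 : ∀ i : Fin (2 * q), (hermiteDet s
      (fun j => (N : ℤ) + splitIndex (2 * q) (fun l : Fin 2 => (l : ℤ)) j)
      (Function.update (splitIndex (2 * q) ![0, 1]) (Sum.inl i)
        (splitIndex (2 * q) ![0, 1] (Sum.inl i) + 2))) = 0 := fun i => by
    have := hermiteDet_update_splitIndex_inl s (2 * q)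
      (fun j => (N : ℤ) + splitIndex (2 * q) (fun l : Fin 2 => (l : ℤ)) j) ![0, 1] i 2 two_pos
      (by intro _ d hd; interval_cases d
          · exact ⟨0, rfl⟩
          · exact ⟨1, rfl⟩)
    simpa using this
  rw [Fintype.sum_sum_type, Fintype.sum_sum_type, Fin.sum_univ_two, Fin.sum_univ_two] at ev
  simp only [inl0] at ev
  have i0 := update_splitIndex_inr (2 * q) ![0, 1] 0 2
  rw [show Function.update (![0, 1] : Fin 2 → ℤ) 0 ((![0, 1] : Fin 2 → ℤ) 0 + 2) = ![2, 1] from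
    (update_vec_two _ _ _).1] at i0
  rw [i0, if_pos (by simp [splitIndex]), if_neg (by simp [splitIndex, parity_simps])] at ev
  have sd : ∀ v : Fin 2 → ℤ, hermiteDet s
      (fun j => (N : ℤ) + splitIndex (2 * q) (fun l : Fin 2 => (l : ℤ)) j)
      (splitIndex (2 * q) v) = shiftedDet s N (2 * q) 2 v := fun v => rfl
  simp only [sd, w] at ev
  have idx := sum_even_index N (q + 1)
  rw [show 2 * (q + 1) = 2 * q + 1 + 1 by ring, Finset.sum_range_succ, Finset.sum_range_succ,
    Finset.sum_sub_distrib, ← Fin.sum_univ_eq_sum_range (fun i : ℕ => if Even (N + i : ℤ) then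
      ((N + i : ℤ) : ℂ) else 0), ← Fin.sum_univ_eq_sum_range (fun i : ℕ => if Even (i : ℤ) then
      (i : ℂ) else 0)] at idx
  have e1 := congrArg (fun P => P.coeff 0) e0
  have e2 := congrArg (fun P => P.coeff 0) d1
  rw [← d, ← e] at e2
  rw [← e] at e1 ev
  have hs1 : ∀ x : Fin (2 * q), (if Even (splitIndex (2 * q) ![0, 1] (Sum.inl x)) then
      (splitIndex (2 * q) ![0, 1] (Sum.inl x) : ℂ) * (rectHermiteDet s N (2 * (q + 1))).coeff 0 +
        2 * s * coeff 0 0 else 0) = (if Even ((x : ℕ) : ℤ) then ((x : ℕ) : ℂ) else 0) *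
        (rectHermiteDet s N (2 * (q + 1))).coeff 0 := by
    intro x
    simp [splitIndex]
  have odd1 : ¬ Even (((2 * q + 1 : ℕ)) : ℤ) := by
    push_cast; simp [parity_simps]
  have even1 : Even (((2 * q : ℕ)) : ℤ) := by
    push_cast; simp
  rw [Finset.sum_congr rfl fun x _ => hs1 x, ← Finset.sum_mul] at ev
  rw [if_pos even1, if_neg odd1] at idx
  have r0 : splitIndex (2 * q) (fun l : Fin 2 => (l : ℤ)) (Sum.inr 0) = (2 * q : ℕ) := by
    simp [splitIndex]
  have r1 : splitIndex (2 * q) (fun l : Fin 2 => (l : ℤ)) (Sum.inr 1) = (2 * q + 1 : ℕ) := by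
    simp [splitIndex]
  have r2 : ∀ i : Fin (2 * q),
      splitIndex (2 * q) (fun l : Fin 2 => (l : ℤ)) (Sum.inl i) = (i : ℕ) := by
    simp [splitIndex]
  have r3 : splitIndex (2 * q) ![0, 1] (Sum.inr 0) = (2 * q : ℕ) := by
    simp [splitIndex]
  simp only [r0, r1, r2, r3, coeff_neg] at ev
  rw [mul_assoc, show (N : ℂ[X]) * ((2 * q + 2) * rectHermiteDet s N (2 * (q + 1))) =
    C (N * (2 * q + 2) : ℂ) * rectHermiteDet s N (2 * (q + 1)) by
      simp [c2]; ring, mul_assoc (C 2)] at e1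
  simp only [coeff_add, coeff_C_mul, coeff_X_mul_zero, coeff_neg, coeff_derivative] at e1 e2
  have hkey : (if Even (N : ℤ) then ((N : ℤ) : ℂ) * (q + 1 : ℕ) else (((N : ℤ) : ℂ) + 1) *
      (q + 1 : ℕ)) * (rectHermiteDet s N (2 * (q + 1))).coeff 0 =
      -(2 * s * (shiftedDet s N (2 * q) 2 ![1, 2]).coeff 0) := by
    rw [← idx]
    push_cast at ev ⊢
    linear_combination -ev
  norm_num at e2
  have hN : Even N ↔ Even (N : ℤ) := by simp
  by_cases hE : Even (N : ℤ)
  · rw [if_pos (hN.2 hE)]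
    rw [if_pos hE] at hkey
    refine mul_left_cancel₀ hs ?_
    push_cast at hkey e1
    linear_combination s * (1 / 2) * e2 - (1 / 4) * e1 + (1 / 2) * hkey
  · rw [if_neg (fun h => hE (hN.1 h))]
    rw [if_neg hE] at hkey
    refine mul_left_cancel₀ hs ?_
    push_cast at hkey e1 ⊢
    field_simp
    linear_combination s * e2 - (1 / 2) * e1 + hkey

/-- The entry `t ^ (b - k) / (b - k)!`, zero for `b < k`. -/
noncomputable def expEntry (t : ℂ) (b k : ℕ) : ℂ :=
  if k ≤ b then t ^ (b - k) / ((b - k)! : ℂ) else 0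

theorem expEntry_mul_pow (t : ℂ) (b k : ℕ) :
    t ^ k * expEntry t b k = t ^ b / (b ! : ℂ) * (descPochhammer ℂ k).eval (b : ℂ) := by
  rw [descPochhammer_eval_eq_descFactorial, expEntry]
  split_ifs with h
  · have h1 : ((b - k)! : ℂ) * (b.descFactorial k : ℂ) = (b ! : ℂ) := by
      exact_mod_cast Nat.factorial_mul_descFactorial h
    have h2 : ((b - k)! : ℂ) ≠ 0 := by exact_mod_cast Nat.factorial_ne_zero _
    have h3 : (b ! : ℂ) ≠ 0 := by exact_mod_cast Nat.factorial_ne_zero _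
    have h4 : t ^ b = t ^ k * t ^ (b - k) := by rw [← pow_add, Nat.add_sub_cancel' h]
    field_simp
    rw [h4, ← h1]
    ring
  · rw [Nat.descFactorial_of_lt (by omega)]
    simp

/-- The entries are t^{b-k}/b! times falling factorials, which are monic in b, so the determinant is
a Vandermonde. The powers of t stay on both sides to cover t = 0. -/
theorem det_expEntry_mul (t : ℂ) {n : ℕ} (b : Fin n → ℕ) :
    t ^ (∑ k : Fin n, (k : ℕ)) * (of fun i k : Fin n => expEntry t (b i) k).det =
      t ^ (∑ i, b i) * (∏ i, ((b i)! : ℂ)⁻¹) * (vandermonde fun i => (b i : ℂ)).det := by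
  have h1 := det_mul_row (fun k : Fin n => t ^ (k : ℕ))
    (of fun i k : Fin n => expEntry t (b i) k)
  have h2 := det_mul_column (fun i : Fin n => t ^ b i / ((b i)! : ℂ))
    (of fun i k : Fin n => (descPochhammer ℂ (k : ℕ)).eval (b i : ℂ))
  rw [← det_eval_matrixOfPolynomials_eq_det_vandermonde (fun i => (b i : ℂ))
    (fun k : Fin n => descPochhammer ℂ k) (fun k => descPochhammer_natDegree ℂ k)
    (fun k => monic_descPochhammer ℂ k)] at h2
  simp only [of_apply, expEntry_mul_pow] at h1 h2
  rw [Finset.prod_pow_eq_pow_sum] at h1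
  rw [← h1, h2, ← Finset.prod_pow_eq_pow_sum, ← Finset.prod_mul_distrib]
  simp only [div_eq_mul_inv]

theorem det_vandermonde_range (n : ℕ) :
    (vandermonde fun i : Fin n => ((i : ℕ) : ℂ)).det = ∏ i ∈ Finset.range n, (i ! : ℂ) := by
  rcases n with _ | n
  · simp
  · rw [det_vandermonde_id_eq_superFactorial, ← Nat.prod_range_succ_factorial]
    push_cast
    rfl

theorem det_expEntry_add {s : ℂ} (hs : s ≠ 0) (M p : ℕ) :
    (of fun i k : Fin p => expEntry s (M + i) k).det =
      s ^ (M * p) * ∏ i ∈ Finset.range p, ((i ! : ℂ) / ((M + i)! : ℂ)) := by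
  have h := det_expEntry_mul s (fun i : Fin p => M + (i : ℕ))
  have h1 : (vandermonde fun i : Fin p => ((M + (i : ℕ) : ℕ) : ℂ)).det =
      ∏ i ∈ Finset.range p, (i ! : ℂ) := by
    rw [← det_vandermonde_range, ← det_vandermonde_add (fun i : Fin p => ((i : ℕ) : ℂ)) (M : ℂ)]
    congr 2
    ext1 i
    push_cast
    ring
  rw [h1, Finset.sum_add_distrib, pow_add] at h
  refine mul_left_cancel₀ (pow_ne_zero (∑ k : Fin p, (k : ℕ)) hs) (h.trans ?_)
  rw [Fin.prod_univ_eq_prod_range (fun i => (((M + i)! : ℕ) : ℂ)⁻¹) p]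
  simp only [div_eq_mul_inv, Finset.prod_mul_distrib, Finset.sum_const, Finset.card_univ,
    Fintype.card_fin, smul_eq_mul, mul_comm p M]
  ring

theorem gaussCoeff_two_mul_sub (s : ℂ) (b k : ℕ) :
    gaussCoeff s (2 * b - 2 * k) = expEntry s b k := by
  rw [expEntry]
  split_ifs with h
  · rw [← gaussCoeff_two_mul]
    congr 1
    omega
  · exact gaussCoeff_of_neg s (by omega)

/-- The sign is the determinant of the block swap, and it becomes the (-1)^p in D_o. -/
theorem det_fromBlocks_zero_diagonal {m : Type*} [Fintype m] [DecidableEq m]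
    (B D : Matrix m m ℂ) :
    (fromBlocks 0 B D 0).det = (-1) ^ Fintype.card m * B.det * D.det := by
  have h1 : (fromBlocks 0 B D 0) = fromBlocks B 0 0 D * fromBlocks 0 1 1 0 := by
    simp [fromBlocks_multiply]
  have h2 : (fromBlocks 0 1 1 0 : Matrix (m ⊕ m) (m ⊕ m) ℂ) * fromBlocks 1 0 1 1 =
      fromBlocks 1 1 1 0 := by
    simp [fromBlocks_multiply]
  have h3 := congrArg det h2
  rw [det_mul, det_fromBlocks_zero₁₂, det_one, mul_one, mul_one, det_fromBlocks_one₁₁, mul_one,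
    zero_sub, det_neg, det_one, mul_one] at h3
  rw [h1, det_mul, h3, det_fromBlocks_zero₁₂]
  ring

/-- Even indices first, then odd ones. -/
noncomputable def parityEquiv (p : ℕ) : Fin p ⊕ Fin p ≃ Fin (2 * p) :=
  Equiv.ofBijective (Sum.elim (fun i => ⟨2 * i, by omega⟩) fun i => ⟨2 * i + 1, by omega⟩) <| by
    rw [Fintype.bijective_iff_injective_and_card]
    refine ⟨?_, by simp [two_mul]⟩
    rintro (i | i) (j | j) h <;> simp [Fin.ext_iff] at h ⊢ <;> omega

/-- With even indices listed before odd ones, the matrix at X = 0 becomes block diagonal for N even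
and block antidiagonal for N odd. -/
theorem coeff_zero_rectHermiteDet_eq (s : ℂ) (N p : ℕ) :
    (rectHermiteDet s N (2 * p)).coeff 0 =
      (fromBlocks (of fun i k : Fin p => gaussCoeff s (N + 2 * i - 2 * k))
        (of fun i k : Fin p => gaussCoeff s (N + 2 * i - (2 * k + 1)))
        (of fun i k : Fin p => gaussCoeff s (N + (2 * i + 1) - 2 * k))
        (of fun i k : Fin p => gaussCoeff s (N + (2 * i + 1) - (2 * k + 1)))).det := by
  rw [rectHermiteDet, coeff_zero_hermiteDet, ← det_submatrix_equiv_self (parityEquiv p)]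
  congr 1
  ext (i | i) (k | k) <;> simp [parityEquiv]

theorem coeff_zero_rectHermiteDet_even {s : ℂ} (hs : s ≠ 0) (m p : ℕ) :
    (rectHermiteDet s (2 * m) (2 * p)).coeff 0 = s ^ (2 * m * p) * Deven p m := by
  rw [coeff_zero_rectHermiteDet_eq]
  have h1 : (of fun i k : Fin p => gaussCoeff s ((2 * m : ℕ) + 2 * i - (2 * k + 1))) = 0 := by
    ext i k
    exact gaussCoeff_of_odd s ⟨m + i - k - 1, by push_cast; ring⟩
  have h2 : (of fun i k : Fin p => gaussCoeff s ((2 * m : ℕ) + 2 * i - 2 * k)) =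
      of fun i k : Fin p => expEntry s (m + i) k := by
    ext i k
    rw [of_apply, of_apply, ← gaussCoeff_two_mul_sub]
    congr 1; push_cast; ring
  have h3 : (of fun i k : Fin p => gaussCoeff s ((2 * m : ℕ) + (2 * i + 1) - (2 * k + 1))) =
      of fun i k : Fin p => expEntry s (m + i) k := by
    ext i k
    rw [of_apply, of_apply, ← gaussCoeff_two_mul_sub]
    congr 1; push_cast; ring
  rw [h1, h2, h3, det_fromBlocks_zero₁₂, det_expEntry_add hs, Deven]
  push_cast
  simp only [← div_pow, Finset.prod_pow]
  ring

theorem prod_factorial_succ_add (m p : ℕ) : ∏ i ∈ Finset.range p, ((m + 1 + i)! : ℂ) =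
    (∏ i ∈ Finset.range p, ((m + i)! : ℂ)) * ((m + p)! / m ! : ℂ) := by
  have : (m ! : ℂ) ≠ 0 := by exact_mod_cast Nat.factorial_ne_zero _
  induction p with
  | zero => simp [this]
  | succ p ih =>
    have : ((m + p)! : ℂ) ≠ 0 := by exact_mod_cast Nat.factorial_ne_zero _
    rw [Finset.prod_range_succ, ih, Finset.prod_range_succ, show m + 1 + p = m + (p + 1) by ring]
    field_simp

theorem coeff_zero_rectHermiteDet_odd {s : ℂ} (hs : s ≠ 0) (m p : ℕ) :
    (rectHermiteDet s (2 * m + 1) (2 * p)).coeff 0 = s ^ ((2 * m + 1) * p) * Dodd p m := by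
  rw [coeff_zero_rectHermiteDet_eq]
  have h1 : (of fun i k : Fin p => gaussCoeff s ((2 * m + 1 : ℕ) + 2 * i - 2 * k)) = 0 := by
    ext i k
    exact gaussCoeff_of_odd s ⟨m + i - k, by push_cast; ring⟩
  have h2 : (of fun i k : Fin p => gaussCoeff s ((2 * m + 1 : ℕ) + (2 * i + 1) - (2 * k + 1))) =
      0 := by
    ext i k
    exact gaussCoeff_of_odd s ⟨m + i - k, by push_cast; ring⟩
  have h3 : (of fun i k : Fin p => gaussCoeff s ((2 * m + 1 : ℕ) + 2 * i - (2 * k + 1))) =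
      of fun i k : Fin p => expEntry s (m + i) k := by
    ext i k
    rw [of_apply, of_apply, ← gaussCoeff_two_mul_sub]
    congr 1; push_cast; ring
  have h4 : (of fun i k : Fin p => gaussCoeff s ((2 * m + 1 : ℕ) + (2 * i + 1) - 2 * k)) =
      of fun i k : Fin p => expEntry s (m + 1 + i) k := by
    ext i k
    rw [of_apply, of_apply, ← gaussCoeff_two_mul_sub]
    congr 1; push_cast; ring
  rw [h1, h2, h3, h4, det_fromBlocks_zero_diagonal, det_expEntry_add hs, det_expEntry_add hs,
    Dodd, Fintype.card_fin]
  push_cast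
  simp only [← div_pow, Finset.prod_pow, Finset.prod_div_distrib, prod_factorial_succ_add]
  have : (m ! : ℂ) ≠ 0 := by exact_mod_cast Nat.factorial_ne_zero _
  have : ((m + p)! : ℂ) ≠ 0 := by exact_mod_cast Nat.factorial_ne_zero _
  have : ∏ i ∈ Finset.range p, ((m + i)! : ℂ) ≠ 0 :=
    Finset.prod_ne_zero_iff.2 fun i _ => by exact_mod_cast Nat.factorial_ne_zero _
  field_simp
  ring

end Coefficients

/-! ### Orthogonality of the Hermite polynomials -/

section GaussianFunctional

open Polynomial

/-- The Gaussian weight `exp (-N x² / 2)`. -/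
noncomputable def gaussWeight (N : ℕ) (x : ℝ) : ℝ := Real.exp (-((N : ℝ) * x ^ 2 / 2))

/-- Integration of a polynomial against the Gaussian weight. -/
noncomputable def gaussFunctional (N : ℕ) (f : ℂ[X]) : ℂ :=
  ∫ x : ℝ, f.eval (x : ℂ) * (gaussWeight N x : ℂ)

theorem integrable_eval_mul_gaussWeight {N : ℕ} (hN : 1 ≤ N) (f : ℂ[X]) :
    Integrable fun x : ℝ => f.eval (x : ℂ) * (gaussWeight N x : ℂ) := by
  induction f using Polynomial.induction_on' with
  | add p q hp hq =>
    simp only [eval_add, add_mul]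
    exact hp.add hq
  | monomial k a =>
    have hb : (0 : ℝ) < N / 2 := by positivity
    have h := (integrable_rpow_mul_exp_neg_mul_sq hb (s := k)
      (by linarith [(Nat.cast_nonneg k : (0 : ℝ) ≤ k)])).ofReal (𝕜 := ℂ)
    refine (h.const_mul a).congr (ae_of_all _ fun x => ?_)
    simp only [Real.rpow_natCast, eval_monomial, gaussWeight, Complex.coe_algebraMap]
    rw [show -((N : ℝ) / 2) * x ^ 2 = -((N : ℝ) * x ^ 2 / 2) by ring]
    push_cast
    ring

theorem gaussFunctional_add {N : ℕ} (hN : 1 ≤ N) (f g : ℂ[X]) :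
    gaussFunctional N (f + g) = gaussFunctional N f + gaussFunctional N g := by
  simp only [gaussFunctional, eval_add, add_mul]
  exact integral_add (integrable_eval_mul_gaussWeight hN f) (integrable_eval_mul_gaussWeight hN g)

theorem gaussFunctional_C_mul (N : ℕ) (a : ℂ) (f : ℂ[X]) :
    gaussFunctional N (C a * f) = a * gaussFunctional N f := by
  simp only [gaussFunctional, eval_mul, eval_C, mul_assoc]
  exact integral_const_mul _ _

/-- Integration by parts: the derivative of the weight w is -Nxw. -/
theorem gaussFunctional_X_mul {N : ℕ} (hN : 1 ≤ N) (f : ℂ[X]) :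
    gaussFunctional N (X * f) = 1 / N * gaussFunctional N (derivative f) := by
  have hN0 : (N : ℂ) ≠ 0 := by exact_mod_cast (by omega : N ≠ 0)
  have hw : ∀ x : ℝ, HasDerivAt (fun y : ℝ => (gaussWeight N y : ℂ))
      ((-(N * x) * gaussWeight N x : ℝ) : ℂ) x := by
    intro x
    have h1 : HasDerivAt (fun y : ℝ => -((N : ℝ) * y ^ 2 / 2)) (-(N * x)) x := by
      have := (((hasDerivAt_id' x).fun_pow 2).const_mul (N : ℝ)).div_const 2 |>.fun_neg
      refine this.congr_deriv ?_
      push_cast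
      ring
    refine h1.exp.ofReal_comp.congr_deriv ?_
    rw [mul_comm]
    rfl
  have hd : ∀ x : ℝ, HasDerivAt (fun y : ℝ => f.eval (y : ℂ) * (gaussWeight N y : ℂ))
      ((derivative f + C (-(N : ℂ)) * (X * f)).eval (x : ℂ) * (gaussWeight N x : ℂ)) x := by
    intro x
    have h1 : HasDerivAt (fun y : ℝ => f.eval (y : ℂ)) ((derivative f).eval (x : ℂ)) x :=
      (f.hasDerivAt (x : ℂ)).comp_ofReal
    refine (h1.fun_mul (hw x)).congr_deriv ?_
    simp only [eval_add, eval_mul, eval_C, eval_X]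
    push_cast
    ring
  have h := integral_eq_zero_of_hasDerivAt_of_integrable hd
    (integrable_eval_mul_gaussWeight hN _) (integrable_eval_mul_gaussWeight hN _)
  change gaussFunctional N _ = 0 at h
  rw [gaussFunctional_add hN, gaussFunctional_C_mul] at h
  field_simp
  linear_combination -h

theorem gaussFunctional_one_ne_zero {N : ℕ} (hN : 1 ≤ N) : gaussFunctional N 1 ≠ 0 := by
  have h : gaussFunctional N 1 = ((∫ x : ℝ, Real.exp (-((N : ℝ) / 2) * x ^ 2) : ℝ) : ℂ) := by
    rw [gaussFunctional, ← integral_complex_ofReal]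
    refine integral_congr_ae (ae_of_all _ fun x => ?_)
    simp only [eval_one, one_mul, gaussWeight]
    congr 2
    ring
  rw [h, integral_gaussian]
  have : (0 : ℝ) < N / 2 := by positivity
  exact_mod_cast (Real.sqrt_pos.2 (by positivity)).ne'

/-- The monic Hermite polynomials. -/
noncomputable def monicHermite (s : ℂ) (k : ℕ) : ℂ[X] :=
  C (k ! : ℂ) * hermiteSeries s k

theorem natDegree_monicHermite_le (s : ℂ) (k : ℕ) : (monicHermite s k).natDegree ≤ k := by
  rw [natDegree_le_iff_coeff_eq_zero]
  intro l hl
  rw [monicHermite, coeff_C_mul, coeff_hermiteSeries, gaussCoeff_of_neg s (by omega)]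
  simp

theorem coeff_monicHermite_self (s : ℂ) (k : ℕ) : (monicHermite s k).coeff k = 1 := by
  have : (k ! : ℂ) ≠ 0 := by exact_mod_cast Nat.factorial_ne_zero _
  rw [monicHermite, coeff_C_mul, coeff_hermiteSeries, sub_self, gaussCoeff_zero]
  field_simp

theorem monic_monicHermite (s : ℂ) (k : ℕ) : (monicHermite s k).Monic :=
  monic_of_natDegree_le_of_coeff_eq_one k (natDegree_monicHermite_le s k)
    (coeff_monicHermite_self s k)

theorem natDegree_monicHermite (s : ℂ) (k : ℕ) : (monicHermite s k).natDegree = k :=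
  natDegree_eq_of_le_of_coeff_ne_zero (natDegree_monicHermite_le s k)
    (by rw [coeff_monicHermite_self]; exact one_ne_zero)

theorem monicHermite_succ (s : ℂ) (k : ℕ) :
    monicHermite s (k + 1) =
      X * monicHermite s k + C (2 * s) * derivative (monicHermite s k) := by
  have h := mul_hermiteSeries s ((k + 1 : ℕ) : ℤ)
  rw [show ((k + 1 : ℕ) : ℤ) - 1 = k by push_cast; ring,
    show ((k + 1 : ℕ) : ℤ) - 2 = k - 1 by push_cast; ring] at h
  rw [monicHermite, monicHermite, derivative_C_mul, derivative_hermiteSeries, Nat.factorial_succ]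
  have e : (C (((k + 1) * k ! : ℕ) : ℂ) : ℂ[X]) = C (k ! : ℂ) * (((k + 1 : ℕ) : ℤ) : ℂ[X]) := by
    push_cast
    simp
    ring
  rw [e, mul_assoc, h]
  ring

theorem iterate_derivative_hermiteSeries (s : ℂ) (m : ℤ) (k : ℕ) :
    derivative^[k] (hermiteSeries s m) = hermiteSeries s (m - k) := by
  induction k with
  | zero => simp
  | succ k ih =>
    rw [Function.iterate_succ_apply', ih, derivative_hermiteSeries]
    congr 1
    push_cast
    ring

/-- In H_{k+1} = X H_k - (1/N) H_k', integrating the factor X by parts cancels the correction term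
and leaves one derivative on f. -/
theorem gaussFunctional_monicHermite_mul {N : ℕ} (hN : 1 ≤ N) (k : ℕ) (f : ℂ[X]) :
    gaussFunctional N (monicHermite (-1 / (2 * N)) k * f) =
      (1 / N : ℂ) ^ k * gaussFunctional N (derivative^[k] f) := by
  have hN0 : (N : ℂ) ≠ 0 := by exact_mod_cast (by omega : N ≠ 0)
  induction k generalizing f with
  | zero => simp [monicHermite, hermiteSeries_zero]
  | succ k ih =>
    have e : monicHermite (-1 / (2 * N)) (k + 1) * f =
        X * (monicHermite (-1 / (2 * N)) k * f) +
          C (-(1 / N : ℂ)) * (derivative (monicHermite (-1 / (2 * N)) k) * f) := by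
      rw [monicHermite_succ, show (2 * (-1 / (2 * N)) : ℂ) = -(1 / N) by field_simp]
      ring
    rw [e, gaussFunctional_add hN, gaussFunctional_X_mul hN, gaussFunctional_C_mul,
      derivative_mul, gaussFunctional_add hN, ih, Function.iterate_succ_apply]
    ring

theorem gaussFunctional_monicHermite_mul_monicHermite {N : ℕ} (hN : 1 ≤ N) (j k : ℕ) :
    gaussFunctional N (monicHermite (-1 / (2 * N)) j * monicHermite (-1 / (2 * N)) k) =
      if j = k then (1 / N : ℂ) ^ k * (k ! : ℂ) * gaussFunctional N 1 else 0 := by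
  wlog hjk : k ≤ j generalizing j k
  · rw [mul_comm, this k j (by omega)]
    split_ifs with h1 h2 h2
    · rw [h1]
    · exact absurd h1.symm h2
    · exact absurd h2.symm h1
    · rfl
  rw [gaussFunctional_monicHermite_mul hN]
  split_ifs with h
  · subst h
    have h2 : derivative^[j] (monicHermite (-1 / (2 * N)) j) = C (j ! : ℂ) * 1 := by
      rw [monicHermite, iterate_derivative_C_mul, iterate_derivative_hermiteSeries, sub_self,
        hermiteSeries_zero]
    rw [h2, gaussFunctional_C_mul]
    ring
  · rw [iterate_derivative_eq_zero (by rw [natDegree_monicHermite]; omega)]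
    simp [gaussFunctional]

end GaussianFunctional

/-! ### The moment as a determinant -/

section MomentDeterminant

open Matrix Polynomial

theorem Polynomial.Monic.taylor {f : ℂ[X]} (hf : f.Monic) (t : ℂ) : (Polynomial.taylor t f).Monic := by
  rw [Monic, leadingCoeff_taylor, hf.leadingCoeff]

/-- Confluent Vandermonde determinant, in terms of arbitrary monic polynomials. -/
theorem det_taylor_eval {n N : ℕ} (P : ℕ → ℂ[X]) (hdeg : ∀ i, (P i).natDegree = i)
    (hmonic : ∀ i, (P i).Monic) (t : ℂ) (x : Fin N → ℂ) :
    (of fun i : Fin n ⊕ Fin N => Sum.elim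
      (fun b : Fin n => (taylor t (P (finSumFinEquiv i))).coeff b)
      (fun j : Fin N => (P (finSumFinEquiv i)).eval (x j))).det =
    (∏ j, (x j - t) ^ n) * (vandermonde x).det := by
  -- The coefficient matrix of monic polynomials of degrees 0, 1, 2, … is triangular with unit
  -- diagonal.
  have hU : (of fun i k : Fin n ⊕ Fin N =>
      (taylor t (P (finSumFinEquiv i))).coeff (finSumFinEquiv k)).det = 1 := by
    rw [← det_matrixOfPolynomials (fun i : Fin (n + N) => taylor t (P i))
      (fun i => by rw [natDegree_taylor, hdeg]) (fun i => (hmonic i).taylor t), ← det_transpose,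
      ← det_submatrix_equiv_self finSumFinEquiv]
    rfl
  have hM : (of fun i : Fin n ⊕ Fin N => Sum.elim
      (fun b : Fin n => (taylor t (P (finSumFinEquiv i))).coeff b)
      (fun j : Fin N => (P (finSumFinEquiv i)).eval (x j))) =
      (of fun i k : Fin n ⊕ Fin N =>
        (taylor t (P (finSumFinEquiv i))).coeff (finSumFinEquiv k)) *
      fromBlocks 1 (of fun (b : Fin n) j => (x j - t) ^ (b : ℕ)) 0
        (of fun (i : Fin N) j => (x j - t) ^ (n + i : ℕ)) := by
    ext i (b | j)
    · simp [mul_apply, Fintype.sum_sum_type, one_apply]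
    · have h : (taylor t (P (finSumFinEquiv i))).natDegree < n + N := by
        rw [natDegree_taylor, hdeg]
        exact (finSumFinEquiv i).2
      have h2 := eval_eq_sum_range' h (x j - t)
      rw [taylor_eval_sub, Finset.sum_range, Fin.sum_univ_add] at h2
      simp [mul_apply, Fintype.sum_sum_type, h2]
  have hD : (of fun (i : Fin N) j => (x j - t) ^ (n + i : ℕ)) =
      of fun (i : Fin N) j => (x j - t) ^ n * (vandermonde fun j => x j - t)ᵀ i j := by
    ext i j
    simp [vandermonde_apply, pow_add]
  rw [hM, det_mul, hU, one_mul, det_fromBlocks_zero₂₁, det_one, one_mul, hD, det_mul_row,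
    det_transpose, det_vandermonde_sub]

/-- Integration of a product of two determinants, one of which is bordered by constant columns. -/
theorem integral_det_mul_det {n N : ℕ} (c : Fin n ⊕ Fin N → Fin n → ℂ)
    (f : Fin n ⊕ Fin N → ℝ → ℂ) (g : Fin N → ℝ → ℂ) (w : ℝ → ℂ)
    (h : ∀ i k, Integrable fun x => f i x * g k x * w x) :
    (Integrable fun x : Fin N → ℝ =>
      (of fun i => Sum.elim (c i) fun j => f i (x j)).det * (of fun i j => g i (x j)).det *
        ∏ j, w (x j)) ∧
    ∫ x : Fin N → ℝ, (of fun i => Sum.elim (c i) fun j => f i (x j)).det *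
        (of fun i j => g i (x j)).det * ∏ j, w (x j) =
      ∑ σ : Equiv.Perm (Fin N), (Equiv.Perm.sign σ : ℂ) *
        (of fun i => Sum.elim (c i) fun j => ∫ x, f i x * g (σ j) x * w x).det := by
  -- Both determinants are expanded over permutations so that each term is a product of functions of
  -- single variables; the sum over τ is reassembled into a determinant after integration.
  have key : ∀ x : Fin N → ℝ, (of fun i => Sum.elim (c i) fun j => f i (x j)).det *
      (of fun i j => g i (x j)).det * ∏ j, w (x j) =
      ∑ σ : Equiv.Perm (Fin N), ∑ τ : Equiv.Perm (Fin n ⊕ Fin N),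
        (Equiv.Perm.sign σ * Equiv.Perm.sign τ * ∏ b, c (τ (Sum.inl b)) b : ℂ) *
          ∏ j, (f (τ (Sum.inr j)) (x j) * g (σ j) (x j) * w (x j)) := by
    intro x
    rw [det_apply', det_apply', Finset.sum_mul_sum, Finset.sum_comm, Finset.sum_mul]
    refine Finset.sum_congr rfl fun σ _ => ?_
    rw [Finset.sum_mul]
    refine Finset.sum_congr rfl fun τ _ => ?_
    simp only [Fintype.prod_sum_type, of_apply, Sum.elim_inl, Sum.elim_inr,
      Finset.prod_mul_distrib]
    ring
  have hint : ∀ (σ : Equiv.Perm (Fin N)) (τ : Equiv.Perm (Fin n ⊕ Fin N)),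
      Integrable fun x : Fin N → ℝ =>
        (Equiv.Perm.sign σ * Equiv.Perm.sign τ * ∏ b, c (τ (Sum.inl b)) b : ℂ) *
          ∏ j, (f (τ (Sum.inr j)) (x j) * g (σ j) (x j) * w (x j)) := fun σ τ =>
    (Integrable.fintype_prod (f := fun j y => f (τ (Sum.inr j)) y * g (σ j) y * w y)
      fun j => h _ _).const_mul _
  simp_rw [key]
  refine ⟨integrable_finsetSum _ fun σ _ => integrable_finsetSum _ fun τ _ => hint σ τ, ?_⟩
  rw [integral_finsetSum _ fun σ _ => integrable_finsetSum _ fun τ _ => hint σ τ]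
  refine Finset.sum_congr rfl fun σ _ => ?_
  rw [integral_finsetSum _ fun τ _ => hint σ τ, det_apply', Finset.mul_sum]
  refine Finset.sum_congr rfl fun τ _ => ?_
  rw [integral_const_mul, integral_fintype_prod_volume_eq_prod
    (fun j y => f (τ (Sum.inr j)) y * g (σ j) y * w y)]
  simp only [Fintype.prod_sum_type, of_apply, Sum.elim_inl, Sum.elim_inr]
  ring

theorem val_finRotate (m : ℕ) (i : Fin m) : (finRotate m i : ℕ) = (i + 1) % m := by
  rcases m with _ | m
  · exact i.elim0
  · rw [finRotate_apply, Fin.val_add]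
    simp

theorem val_finRotate_pow (m k : ℕ) (i : Fin m) : ((finRotate m ^ k) i : ℕ) = (i + k) % m := by
  induction k with
  | zero => simp [Nat.mod_eq_of_lt i.2]
  | succ k ih =>
    rw [pow_succ', Equiv.Perm.mul_apply, val_finRotate, ih]
    simp [add_assoc]

theorem det_orthogonal_block {n N : ℕ} (hn : Even n) (c : ℕ → Fin n → ℂ) (h : Fin N → ℂ) :
    (of fun i : Fin n ⊕ Fin N => Sum.elim (c (finSumFinEquiv i))
      fun j : Fin N => if (finSumFinEquiv i : ℕ) = j then h j else 0).det =
      (of fun i b : Fin n => c (N + i) b).det * ∏ j, h j := by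
  -- Rotating by N places brings rows N, …, N+n-1 to the top. The sign is (-1)^{(n+N-1)N}, which is
  -- 1 because n is even.
  have hsign : Equiv.Perm.sign (finRotate (n + N) ^ N) = 1 := by
    rw [map_pow, sign_finRotate, ← pow_mul]
    refine Even.neg_one_pow ?_
    rcases Nat.even_or_odd N with hN | hN
    · exact hN.mul_left _
    · refine Even.mul_right ?_ _
      obtain ⟨a, rfl⟩ := hn
      obtain ⟨b, rfl⟩ := hN
      exact ⟨a + b, by omega⟩
  have h1 : (of fun i : Fin n ⊕ Fin N => Sum.elim (c (finSumFinEquiv i))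
      fun j : Fin N => if (finSumFinEquiv i : ℕ) = j then h j else 0).det =
      ((of fun i : Fin (n + N) => fun k : Fin (n + N) => Sum.elim (c i)
      (fun j : Fin N => if (i : ℕ) = j then h j else 0) (finSumFinEquiv.symm k))).det := by
    rw [← det_submatrix_equiv_self finSumFinEquiv]
    congr 1
    ext i j
    simp
  have h2 := det_permute (finRotate (n + N) ^ N)
    (of fun i : Fin (n + N) => fun k : Fin (n + N) => Sum.elim (c i)
      (fun j : Fin N => if (i : ℕ) = j then h j else 0) (finSumFinEquiv.symm k))
  rw [hsign, Units.val_one, Int.cast_one, one_mul, ← det_submatrix_equiv_self finSumFinEquiv] at h2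
  rw [h1, ← h2, ← det_diagonal, ← det_fromBlocks_zero₁₂ _
    (of fun (i : Fin N) (b : Fin n) => c i b)]
  congr 1
  have v1 : ∀ i : Fin n, (((finRotate (n + N) ^ N) (Fin.castAdd N i) : Fin (n + N)) : ℕ) = N + i := by
    intro i
    rw [val_finRotate_pow, Fin.val_castAdd, Nat.mod_eq_of_lt (by omega), add_comm]
  have v2 : ∀ i : Fin N, (((finRotate (n + N) ^ N) (Fin.natAdd n i) : Fin (n + N)) : ℕ) = i := by
    intro i
    rw [val_finRotate_pow, Fin.val_natAdd, show n + (i : ℕ) + N = i + (n + N) by ring,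
      Nat.add_mod_right, Nat.mod_eq_of_lt (by omega)]
  ext (i | i) (j | j)
  · simp [v1]
  · simp [v1]
    omega
  · simp [v2]
  · simp [v2, diagonal_apply, Fin.ext_iff]
    split_ifs with hij
    · rw [Fin.ext hij]
    · rfl

/-- The squared norm of the monic Hermite polynomial of degree `k`. -/
noncomputable def hermiteNorm (N k : ℕ) : ℂ :=
  (1 / N : ℂ) ^ k * (k ! : ℂ) * gaussFunctional N 1

theorem hermiteNorm_ne_zero {N : ℕ} (hN : 1 ≤ N) (k : ℕ) : hermiteNorm N k ≠ 0 := by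
  have hN0 : (N : ℂ) ≠ 0 := by exact_mod_cast (by omega : N ≠ 0)
  have : (k ! : ℂ) ≠ 0 := by exact_mod_cast Nat.factorial_ne_zero _
  exact mul_ne_zero (mul_ne_zero (pow_ne_zero _ (by simp [hN0])) this)
    (gaussFunctional_one_ne_zero hN)

theorem integral_pow_mul_vandermonde_sq {N n : ℕ} (hN : 1 ≤ N) (hn : Even n) (t : ℂ) :
    (Integrable fun x : Fin N → ℝ => (∏ j, ((x j : ℂ) - t) ^ n) *
      (vandermonde fun j => (x j : ℂ)).det * (vandermonde fun j => (x j : ℂ)).det *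
        ∏ j, (gaussWeight N (x j) : ℂ)) ∧
    ∫ x : Fin N → ℝ, (∏ j, ((x j : ℂ) - t) ^ n) * (vandermonde fun j => (x j : ℂ)).det *
      (vandermonde fun j => (x j : ℂ)).det * ∏ j, (gaussWeight N (x j) : ℂ) =
    (N ! : ℂ) * ((of fun i b : Fin n =>
      (taylor t (monicHermite (-1 / (2 * N)) (N + i))).coeff b).det *
        ∏ j : Fin N, hermiteNorm N j) := by
  set P := monicHermite (-1 / (2 * N : ℂ)) with hP
  have h := integral_det_mul_det (n := n) (N := N)
    (fun i b => (taylor t (P (finSumFinEquiv i))).coeff b)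
    (fun i y => (P (finSumFinEquiv i)).eval (y : ℂ)) (fun k y => (P k).eval (y : ℂ))
    (fun y => (gaussWeight N y : ℂ))
    (fun i k => by simpa only [eval_mul] using
      integrable_eval_mul_gaussWeight hN (P (finSumFinEquiv i) * P k))
  have e1 : ∀ x : Fin N → ℝ, (of fun i : Fin n ⊕ Fin N =>
      Sum.elim (fun b : Fin n => (taylor t (P (finSumFinEquiv i))).coeff b)
      fun j => (P (finSumFinEquiv i)).eval (x j : ℂ)).det =
      (∏ j, ((x j : ℂ) - t) ^ n) * (vandermonde fun j => (x j : ℂ)).det := fun x =>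
    det_taylor_eval P (natDegree_monicHermite _) (monic_monicHermite _) t fun j => (x j : ℂ)
  have e2 : ∀ x : Fin N → ℝ, (of fun i j : Fin N => (P i).eval (x j : ℂ)).det =
      (vandermonde fun j => (x j : ℂ)).det := fun x => by
    rw [det_eval_matrixOfPolynomials_eq_det_vandermonde _ (fun i : Fin N => P i)
      (fun i => natDegree_monicHermite _ _) (fun i => monic_monicHermite _ _), ← det_transpose]
    rfl
  simp only [e1, e2] at h
  refine ⟨h.1, h.2.trans ?_⟩
  have e3 : ∀ (i : Fin n ⊕ Fin N) (j : Fin N), (∫ x : ℝ, (P (finSumFinEquiv i)).eval (x : ℂ) *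
      (P j).eval (x : ℂ) * (gaussWeight N x : ℂ)) =
      if (finSumFinEquiv i : ℕ) = j then hermiteNorm N j else 0 := fun i j => by
    have := gaussFunctional_monicHermite_mul_monicHermite hN (finSumFinEquiv i) j
    rw [gaussFunctional] at this
    simpa only [eval_mul, hermiteNorm, hP] using this
  simp only [e3]
  rw [← det_orthogonal_block hn (fun i b => (taylor t (P i)).coeff b)]
  -- Permuting the last columns by σ produces a second factor sign σ. All N! terms are therefore
  -- equal.
  have e4 : ∀ σ : Equiv.Perm (Fin N), (Equiv.Perm.sign σ : ℂ) *
      (of fun i : Fin n ⊕ Fin N => Sum.elim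
        (fun b : Fin n => (taylor t (P (finSumFinEquiv i))).coeff b)
        fun j => if (finSumFinEquiv i : ℕ) = σ j then hermiteNorm N (σ j) else 0).det =
      (of fun i : Fin n ⊕ Fin N => Sum.elim
        (fun b : Fin n => (taylor t (P (finSumFinEquiv i))).coeff b)
        fun j : Fin N => if (finSumFinEquiv i : ℕ) = j then hermiteNorm N j else 0).det := by
    intro σ
    have := det_permute' (Equiv.sumCongr (Equiv.refl (Fin n)) σ)
      (of fun i : Fin n ⊕ Fin N => Sum.elim
        (fun b : Fin n => (taylor t (P (finSumFinEquiv i))).coeff b)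
        fun j : Fin N => if (finSumFinEquiv i : ℕ) = j then hermiteNorm N j else 0)
    have hs : Equiv.Perm.sign (Equiv.sumCongr (Equiv.refl (Fin n)) σ) = Equiv.Perm.sign σ := by
      have := Equiv.Perm.sign_sumCongr (1 : Equiv.Perm (Fin n)) σ
      rw [map_one, one_mul] at this
      exact this
    rw [hs] at this
    have e5 : (of fun i : Fin n ⊕ Fin N => Sum.elim
        (fun b : Fin n => (taylor t (P (finSumFinEquiv i))).coeff b)
        fun j => if (finSumFinEquiv i : ℕ) = σ j then hermiteNorm N (σ j) else 0) =
        (of fun i : Fin n ⊕ Fin N => Sum.elim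
        (fun b : Fin n => (taylor t (P (finSumFinEquiv i))).coeff b)
        fun j : Fin N => if (finSumFinEquiv i : ℕ) = j then hermiteNorm N j else 0).submatrix id
          (Equiv.sumCongr (Equiv.refl (Fin n)) σ) := by
      ext i (b | j) <;> simp
    rw [e5, this, ← mul_assoc]
    rcases Int.units_eq_one_or (Equiv.Perm.sign σ) with h | h <;> simp [h]
  rw [Finset.sum_congr rfl fun σ _ => e4 σ]
  simp [Fintype.card_perm]

/-- The b-th Taylor coefficient is the b-th derivative over b!, and differentiating lowers the index
of h. Row factors (N+i)! and column factors 1/b! combine to C_λ after reversing the indices. -/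
theorem det_taylor_monicHermite (s t : ℂ) (N n : ℕ) :
    (of fun i b : Fin n => (taylor t (monicHermite s (N + i))).coeff b).det =
      (partitionC n (rectPartition N n) : ℂ) * (rectHermiteDet s N n).eval t := by
  have h1 : (of fun i b : Fin n => (taylor t (monicHermite s (N + i))).coeff b) =
      of fun i b : Fin n => ((N + i)! : ℂ) * (of fun i b : Fin n => ((b : ℕ)! : ℂ)⁻¹ *
        (of fun i b : Fin n => (hermiteSeries s ((N : ℤ) + i - b)).eval t) i b) i b := by
    ext i b
    have h := congrArg (fun F => F (monicHermite s (N + i))) (factorial_smul_hasseDeriv (R := ℂ) (k := (b : ℕ)))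
    rw [of_apply, of_apply, of_apply, of_apply, taylor_coeff]
    have h2 : ((b : ℕ)! : ℂ) * (hasseDeriv (b : ℕ) (monicHermite s (N + i))).eval t =
        (derivative^[(b : ℕ)] (monicHermite s (N + i))).eval t := by
      rw [← h]
      simp
    rw [monicHermite, iterate_derivative_C_mul, iterate_derivative_hermiteSeries, eval_mul,
      eval_C] at h2
    have h3 : ((b : ℕ)! : ℂ) ≠ 0 := by exact_mod_cast Nat.factorial_ne_zero _
    rw [monicHermite]
    push_cast at h2 ⊢
    field_simp
    rw [mul_comm]
    exact h2
  have h4 : (rectHermiteDet s N n).eval t =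
      (of fun i b : Fin n => (hermiteSeries s ((N : ℤ) + i - b)).eval t).det := by
    rw [← coe_evalRingHom, rectHermiteDet, hermiteDet, RingHom.map_det]
    rfl
  rw [h1, det_mul_column, det_mul_row, h4, ← mul_assoc]
  congr 1
  rw [partitionC, ← Finset.prod_mul_distrib]
  push_cast
  refine Fintype.prod_equiv Fin.revPerm _ _ fun i => ?_
  rw [Fin.revPerm_apply, Fin.val_rev, rectPartition, show n - 1 - (n - ((i : ℕ) + 1)) = i by omega,
    div_eq_mul_inv]

theorem ofReal_gueWeight (N : ℕ) (x : Fin N → ℝ) : (gueWeight N x : ℂ) =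
    (vandermonde fun j => (x j : ℂ)).det * (vandermonde fun j => (x j : ℂ)).det *
      ∏ j, (gaussWeight N (x j) : ℂ) := by
  rw [det_vandermonde, ← Finset.prod_mul_distrib, gueWeight]
  simp only [gaussWeight, sq_abs]
  push_cast
  congr 1
  refine Finset.prod_congr rfl fun j _ => ?_
  rw [← Finset.prod_mul_distrib]
  exact Finset.prod_congr rfl fun k _ => by ring

/-- The case n = 0 of the same integral, where the remaining determinant is empty. -/
theorem ofReal_guePartitionFunction {N : ℕ} (hN : 1 ≤ N) :
    (guePartitionFunction N : ℂ) = (N ! : ℂ) * ∏ j : Fin N, hermiteNorm N j := by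
  have h := (integral_pow_mul_vandermonde_sq hN Even.zero 0).2
  rw [guePartitionFunction, ← integral_complex_ofReal]
  simp only [ofReal_gueWeight]
  simpa using h

theorem integrable_gueMomentIntegrand {N : ℕ} (hN : 1 ≤ N) (p : ℕ) (t : ℂ) :
    Integrable (gueMomentIntegrand N p t) ∧ gueMoment N p t =
      (partitionC (2 * p) (rectPartition N (2 * p)) : ℂ) *
        (rectHermiteDet (-1 / (2 * N)) N (2 * p)).eval t := by
  have h := integral_pow_mul_vandermonde_sq hN (even_two_mul p) t
  have hZ := ofReal_guePartitionFunction hN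
  have hN0 : (N ! : ℂ) ≠ 0 := by exact_mod_cast Nat.factorial_ne_zero _
  have hne : ∏ j : Fin N, hermiteNorm N j ≠ 0 :=
    Finset.prod_ne_zero_iff.2 fun j _ => hermiteNorm_ne_zero hN j
  have e : gueMomentIntegrand N p t = fun x : Fin N → ℝ => (∏ j, ((x j : ℂ) - t) ^ (2 * p)) *
      (vandermonde fun j => (x j : ℂ)).det * (vandermonde fun j => (x j : ℂ)).det *
        (∏ j, (gaussWeight N (x j) : ℂ)) / guePartitionFunction N := by
    ext1 x
    rw [gueMomentIntegrand, gueDensity, Complex.ofReal_div, ofReal_gueWeight,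
      ← Finset.prod_pow]
    have : ∀ j, (t - (x j : ℂ)) ^ (2 * p) = ((x j : ℂ) - t) ^ (2 * p) := fun j => by
      rw [← neg_sub, (even_two_mul p).neg_pow]
    simp only [this]
    ring
  rw [gueMoment, e]
  refine ⟨h.1.div_const _, ?_⟩
  rw [integral_div, h.2, hZ, det_taylor_monicHermite]
  field_simp

end MomentDeterminant

/-! ### Expansion over partitions -/

section CauchyBinet

open Matrix Polynomial

open Classical in
/-- The Cauchy–Binet formula. -/
theorem det_mul_eq_sum_strictAnti {R : Type*} [CommRing R] {n m : ℕ}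
    (A : Matrix (Fin n) (Fin m) R) (B : Matrix (Fin m) (Fin n) R) :
    (A * B).det = ∑ g ∈ (Finset.univ : Finset (Fin n → Fin m)).filter StrictAnti,
      (A.submatrix id g).det * (B.submatrix g id).det := by
  have h1 : (A * B).det = ∑ f : Fin n → Fin m, (∏ j, B (f j) j) * (A.submatrix id f).det := by
    simp only [det_apply', mul_apply, Finset.prod_univ_sum, Finset.mul_sum,
      Fintype.piFinset_univ, submatrix_apply, id]
    rw [Finset.sum_comm]
    refine Finset.sum_congr rfl fun f _ => Finset.sum_congr rfl fun σ _ => ?_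
    rw [Finset.prod_mul_distrib]
    ring
  have h2 : ∀ g : Fin n → Fin m, (A.submatrix id g).det * (B.submatrix g id).det =
      ∑ σ : Equiv.Perm (Fin n), (∏ j, B (g (σ j)) j) * (A.submatrix id (g ∘ σ)).det := by
    intro g
    rw [det_apply' (B.submatrix g id), Finset.mul_sum]
    refine Finset.sum_congr rfl fun σ _ => ?_
    have := det_permute' σ (A.submatrix id g)
    rw [submatrix_submatrix, Function.comp_id] at this
    rw [this]
    simp only [submatrix_apply, id]
    ring
  rw [h1, ← Finset.sum_filter_add_sum_filter_not Finset.univ Function.Injective,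
    Finset.sum_eq_zero (s := Finset.univ.filter fun f : Fin n → Fin m => ¬ Function.Injective f),
    add_zero]
  · simp_rw [h2]
    rw [← Finset.sum_product']
    symm
    refine Finset.sum_bij (fun x _ => x.1 ∘ x.2) ?_ ?_ ?_ ?_
    · rintro ⟨g, σ⟩ hg
      simp only [Finset.mem_product, Finset.mem_filter, Finset.mem_univ, true_and, and_true] at hg ⊢
      exact hg.injective.comp σ.injective
    · rintro ⟨g, σ⟩ hg ⟨g', σ'⟩ hg' h
      simp only [Finset.mem_product, Finset.mem_filter, Finset.mem_univ, true_and, and_true] at hg hg' h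
      -- Equal composites have equal ranges, and a strictly monotone sequence is determined by its
      -- range; the reversal makes the sequences increasing.
      have hr : Set.range (g ∘ Fin.rev) = Set.range (g' ∘ Fin.rev) := by
        have e1 : Set.range (g ∘ σ) = Set.range g := σ.surjective.range_comp g
        have e2 : Set.range (g' ∘ σ') = Set.range g' := σ'.surjective.range_comp g'
        rw [Fin.rev_surjective.range_comp, Fin.rev_surjective.range_comp, ← e1, ← e2, h]
      have hgg : g ∘ Fin.rev = g' ∘ Fin.rev :=
        ((hg.comp Fin.rev_strictAnti).range_inj (hg'.comp Fin.rev_strictAnti)).1 hr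
      have hg2 : g = g' := Fin.rev_surjective.injective_comp_right hgg
      subst hg2
      congr 1
      ext1 j
      exact hg.injective (congrFun h j)
    · intro f hf
      simp only [Finset.mem_filter, Finset.mem_univ, true_and] at hf
      refine ⟨(f ∘ Tuple.sort f ∘ Fin.rev, (Fin.revPerm.trans (Tuple.sort f)).symm), ?_, ?_⟩
      · simp only [Finset.mem_product, Finset.mem_filter, Finset.mem_univ, true_and, and_true]
        have hm : StrictMono (f ∘ Tuple.sort f) :=
          (Tuple.monotone_sort f).strictMono_of_injective (hf.comp (Tuple.sort f).injective)
        exact hm.comp_strictAnti Fin.rev_strictAnti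
      · ext1 j
        simp
    · rintro ⟨g, σ⟩ _
      rfl
  · intro f hf
    simp only [Finset.mem_filter, Finset.mem_univ, true_and, Function.Injective, not_forall] at hf
    obtain ⟨i, j, hij, hne⟩ := hf
    rw [det_zero_of_column_eq hne fun k => by simp [hij], mul_zero]

theorem StrictAnti.add_sub_le {n : ℕ} {f : Fin n → ℕ} (hf : StrictAnti f) {j k : Fin n}
    (h : j ≤ k) : f k + (k - j : ℕ) ≤ f j := by
  obtain ⟨d, hd⟩ : ∃ d : ℕ, (k : ℕ) = j + d := ⟨k - j, by have : (j : ℕ) ≤ k := h; omega⟩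
  induction d generalizing k with
  | zero =>
    obtain rfl : k = j := Fin.ext hd
    simp
  | succ d ih =>
    have hk : (j : ℕ) + d < n := by omega
    have h1 := ih (k := ⟨j + d, hk⟩) (by simp [Fin.le_def]) rfl
    have h2 : f k < f ⟨j + d, hk⟩ := hf (by simp [Fin.lt_def]; omega)
    simp only at h1
    omega

/-- Compare coefficients in exp(tz + sz²) = exp(sz²) exp(tz). Terms with b ≥ N + n vanish since then
N + j - b < 0. -/
theorem eval_hermiteSeries_eq_sum (s t : ℂ) {N n j k : ℕ} (hj : j < n) (hk : k < n) :
    (hermiteSeries s ((N : ℤ) + j - k)).eval t =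
      ∑ b : Fin (N + n), gaussCoeff s ((N : ℤ) + j - (b : ℕ)) * expEntry t b k := by
  have hdeg : (hermiteSeries s ((N : ℤ) + j - k)).natDegree < N + n - k := by
    refine lt_of_le_of_lt (natDegree_le_iff_coeff_eq_zero.2 fun i hi => ?_)
      (show N + n - k - 1 < N + n - k by omega)
    rw [coeff_hermiteSeries, gaussCoeff_of_neg s (by omega), zero_div]
  rw [eval_eq_sum_range' hdeg, Fin.sum_univ_eq_sum_range
    (fun b => gaussCoeff s ((N : ℤ) + j - (b : ℕ)) * expEntry t b k)]
  obtain ⟨M, hM⟩ : ∃ M, N + n = k + M := ⟨N + n - k, by omega⟩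
  rw [hM, Finset.sum_range_add, Finset.sum_eq_zero (s := Finset.range k), zero_add,
    Nat.add_sub_cancel_left]
  · refine Finset.sum_congr rfl fun i _ => ?_
    rw [coeff_hermiteSeries, expEntry, if_pos (Nat.le_add_right k i), Nat.add_sub_cancel_left,
      Nat.cast_add, sub_sub]
    ring
  · intro b hb
    rw [expEntry, if_neg (by simpa using hb), mul_zero]

theorem gaussCoeff_sq (w : ℂ) (e : ℤ) :
    gaussCoeff (w ^ 2) e = w ^ e * (hermiteEntry e : ℂ) := by
  rw [gaussCoeff, hermiteEntry]
  split_ifs with h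
  · obtain ⟨⟨k, rfl⟩, h0⟩ := h
    lift k to ℕ using by omega
    rw [show ((k : ℤ) + k) / 2 = k by omega, Int.toNat_natCast, ← pow_mul,
      show ((k : ℤ) + k) = ((2 * k : ℕ) : ℤ) by push_cast; ring, zpow_natCast]
    push_cast
    ring
  · simp

/-- With s = w², the entries are w^{a_j - b_k} times the entries for s = 1, and the powers of w
factor out of rows and columns to give w^d. -/
theorem det_gaussCoeff {n : ℕ} {s : ℂ} (hs : s ≠ 0) (a b : Fin n → ℤ) (d : ℕ)
    (hd : ∑ j, a j - ∑ k, b k = d) :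
    (of fun j k => gaussCoeff s (a j - b k)).det =
      s ^ (d / 2) * ((of fun j k => hermiteEntry (a j - b k)).det : ℂ) := by
  have hc : ((of fun j k => hermiteEntry (a j - b k)).det : ℂ) =
      (of fun j k => (hermiteEntry (a j - b k) : ℂ)).det := by
    rw [← Complex.coe_algebraMap, RingHom.map_det]
    rfl
  have key : ∀ w : ℂ, w ≠ 0 → (of fun j k => gaussCoeff (w ^ 2) (a j - b k)).det =
      w ^ d * (of fun j k => (hermiteEntry (a j - b k) : ℂ)).det := by
    intro w hw
    have e : (of fun j k => gaussCoeff (w ^ 2) (a j - b k)) =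
        of fun j k => w ^ a j * (of fun j k => w ^ (-b k) *
          (of fun j k => (hermiteEntry (a j - b k) : ℂ)) j k) j k := by
      ext j k
      rw [of_apply, of_apply, of_apply, of_apply, gaussCoeff_sq w, sub_eq_add_neg,
        zpow_add₀ hw]
      ring
    have hp : ∀ c : Fin n → ℤ, ∏ i, w ^ c i = w ^ ∑ i, c i := fun c => by
      induction (Finset.univ : Finset (Fin n)) using Finset.induction_on with
      | empty => simp
      | insert i t hi ih => rw [Finset.prod_insert hi, Finset.sum_insert hi, ih, zpow_add₀ hw]
    rw [e, det_mul_column, det_mul_row, hp, hp, ← mul_assoc, ← zpow_add₀ hw,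
      Finset.sum_neg_distrib, ← sub_eq_add_neg, hd, zpow_natCast]
  obtain ⟨w, rfl⟩ : ∃ w, s = w ^ 2 := by
    obtain ⟨w, hw⟩ := IsAlgClosed.exists_pow_nat_eq s two_pos
    exact ⟨w, hw.symm⟩
  have hw : w ≠ 0 := by rintro rfl; simp at hs
  rw [hc, key w hw]
  rcases Nat.even_or_odd d with he | ho
  · rw [← pow_mul, Nat.mul_div_cancel' he.two_dvd]
  -- For odd d the roots w and -w give opposite values, so the determinant is zero and the rounding
  -- in d / 2 is harmless.
  · have h1 := key (-w) (neg_ne_zero.2 hw)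
    rw [neg_sq, key w hw, ho.neg_pow] at h1
    have h2 : (of fun j k => (hermiteEntry (a j - b k) : ℂ)).det = 0 := by
      refine (mul_eq_zero.1 (?_ : w ^ d * _ = 0)).resolve_left (pow_ne_zero _ hw)
      linear_combination (1 / 2 : ℂ) * h1
    rw [h2, mul_zero, mul_zero]



theorem det_vandermonde_comp_rev {R : Type*} [CommRing R] {n : ℕ} (v : Fin n → R) :
    (vandermonde fun i => v i.rev).det = ∏ j : Fin n, ∏ k ∈ Finset.Ioi j, (v j - v k) := by
  rw [det_vandermonde, Finset.prod_sigma', Finset.prod_sigma']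
  refine Finset.prod_bij' (fun x _ => ⟨x.2.rev, x.1.rev⟩) (fun x _ => ⟨x.2.rev, x.1.rev⟩)
    ?_ ?_ ?_ ?_ ?_ <;> simp

theorem dimOverFactorial_eq {n : ℕ} (ν g : Fin n → ℕ) (h : ∀ j, g j = ν j + (n - 1 - j)) :
    (dimOverFactorial n ν : ℂ) =
      (∏ i, ((g i)! : ℂ)⁻¹) * (vandermonde fun i : Fin n => (g i.rev : ℂ)).det := by
  rw [det_vandermonde_comp_rev (fun i => (g i : ℂ)), dimOverFactorial]
  simp only [← h]
  push_cast
  rw [Finset.prod_inv_distrib, div_eq_inv_mul]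
  congr 1
  refine Finset.prod_congr rfl fun j _ => Finset.prod_congr rfl fun k _ => ?_
  rw [h, h]
  have h1 : ((n - 1 - (j : ℕ) : ℕ) : ℂ) = n - 1 - j := by
    rw [Nat.sub_sub, Nat.cast_sub (by omega)]; push_cast; ring
  have h2 : ((n - 1 - (k : ℕ) : ℕ) : ℂ) = n - 1 - k := by
    rw [Nat.sub_sub, Nat.cast_sub (by omega)]; push_cast; ring
  push_cast [h1, h2]
  ring

/-- The term of the expansion of `rectHermiteDet s N n` labelled by `ν`. -/
noncomputable def partitionCoeff (s : ℂ) (N n : ℕ) (ν : Fin n → ℕ) : ℂ :=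
  s ^ ((N * n - ∑ j, ν j) / 2) * (dimOverFactorial n ν : ℂ) *
    (hermiteD n (rectPartition N n) ν : ℂ)

theorem det_submatrix_mul_det_submatrix {s t : ℂ} (hs : s ≠ 0) (ht : t ≠ 0) {N n : ℕ}
    (ν : Fin n → ℕ) (hν : ∀ j, ν j ≤ N) (g : Fin n → ℕ) (h : ∀ j, g j = ν j + (n - 1 - j)) :
    (of fun i k : Fin n => gaussCoeff s ((N : ℤ) + (i.rev : ℕ) - (g k : ℕ))).det *
      (of fun i k : Fin n => expEntry t (g i) (k.rev : ℕ)).det =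
      partitionCoeff s N n ν * t ^ (∑ j, ν j) := by
  have hsum : ∑ j, g j = ∑ j, ν j + ∑ k : Fin n, (k : ℕ) := by
    simp only [h, Finset.sum_add_distrib]
    congr 1
    refine Fintype.sum_equiv Fin.revPerm _ _ fun i => ?_
    rw [Fin.revPerm_apply, Fin.val_rev]
    omega
  have hle : ∑ j, ν j ≤ N * n := by
    refine (Finset.sum_le_sum fun j _ => hν j).trans ?_
    simp [mul_comm]
  have h1 := det_gaussCoeff hs (fun i : Fin n => (N : ℤ) + (i.rev : ℕ)) (fun k => (g k : ℤ))
    (N * n - ∑ j, ν j) (by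
      have e1 : ∑ i : Fin n, ((i.rev : ℕ) : ℤ) = ∑ i : Fin n, ((i : ℕ) : ℤ) :=
        Equiv.sum_comp Fin.revPerm fun i : Fin n => ((i : ℕ) : ℤ)
      rw [Finset.sum_add_distrib, e1, ← Nat.cast_sum (f := g), hsum, Nat.cast_sub hle]
      push_cast
      simp only [Finset.sum_const, Finset.card_univ, Fintype.card_fin, nsmul_eq_mul]
      ring)
  have h2 : (of fun j k : Fin n => hermiteEntry ((N : ℤ) + (j.rev : ℕ) - (g k : ℤ))).det =
      hermiteD n (rectPartition N n) ν := by
    rw [hermiteD]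
    congr 1
    ext j k
    rw [of_apply, of_apply, rectPartition, h, Fin.val_rev]
    congr 1
    omega
  have h3 := det_expEntry_mul t fun i => g i.rev
  have h4 : (of fun i k : Fin n => expEntry t (g i.rev) k).det =
      (of fun i k : Fin n => expEntry t (g i) (k.rev : ℕ)).det := by
    rw [← det_submatrix_equiv_self Fin.revPerm]
    congr 1
    ext i k
    simp
  have h5 : ∏ i : Fin n, ((g i.rev)! : ℂ)⁻¹ = ∏ i, ((g i)! : ℂ)⁻¹ :=
    Equiv.prod_comp Fin.revPerm fun i => ((g i)! : ℂ)⁻¹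
  have h6 : ∑ i : Fin n, g i.rev = ∑ i, g i := Equiv.sum_comp Fin.revPerm g
  rw [h4, h5, h6, hsum, pow_add, mul_assoc, ← dimOverFactorial_eq ν g h] at h3
  have h7 : (of fun i k : Fin n => expEntry t (g i) (k.rev : ℕ)).det =
      t ^ (∑ j, ν j) * (dimOverFactorial n ν : ℂ) := by
    refine mul_left_cancel₀ (pow_ne_zero (∑ k : Fin n, (k : ℕ)) ht) ?_
    rw [h3]
    ring
  rw [h1, h2, h7, partitionCoeff]
  ring

theorem mem_subRect {N n : ℕ} {ν : Fin n → ℕ} :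
    ν ∈ subRect N n ↔ (∀ j, ν j ≤ N) ∧ Antitone ν := by
  simp [subRect]

theorem eval_rectHermiteDet_of_ne_zero {s t : ℂ} (hs : s ≠ 0) (ht : t ≠ 0) (N n : ℕ) :
    (rectHermiteDet s N n).eval t =
      ∑ ν ∈ subRect N n, partitionCoeff s N n ν * t ^ (∑ j, ν j) := by
  classical
  have h1 : (rectHermiteDet s N n).eval t =
      (of fun i b : Fin n => (hermiteSeries s ((N : ℤ) + i - b)).eval t).det := by
    rw [← coe_evalRingHom, rectHermiteDet, hermiteDet, RingHom.map_det]
    rfl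
  have h2 : (of fun i b : Fin n => (hermiteSeries s ((N : ℤ) + i - b)).eval t).submatrix
      Fin.revPerm Fin.revPerm =
      (of fun (i : Fin n) (b : Fin (N + n)) => gaussCoeff s ((N : ℤ) + (i.rev : ℕ) - (b : ℕ))) *
      (of fun (b : Fin (N + n)) (k : Fin n) => expEntry t b (k.rev : ℕ)) := by
    ext i k
    rw [mul_apply, submatrix_apply, of_apply, Fin.revPerm_apply, Fin.revPerm_apply,
      eval_hermiteSeries_eq_sum s t i.rev.isLt k.rev.isLt]
    rfl
  rw [h1, ← det_submatrix_equiv_self Fin.revPerm, h2, det_mul_eq_sum_strictAnti]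
  -- A strictly decreasing sequence satisfies g_j ≥ n - 1 - j, so the natural-number subtraction
  -- defining ν_j = g_j - (n - 1 - j) never truncates.
  have key : ∀ g : Fin n → Fin (N + n), StrictAnti g → ∀ j : Fin n, n - 1 - (j : ℕ) ≤ g j := by
    intro g hg j
    have := StrictAnti.add_sub_le (f := fun i => (g i : ℕ)) (fun a b hab => hg hab)
      (j := j) (k := ⟨n - 1, Nat.sub_one_lt j.pos.ne'⟩) (by simp [Fin.le_def]; omega)
    simp only at this
    omega
  refine Finset.sum_bij (fun g _ (j : Fin n) => (g j : ℕ) - (n - 1 - (j : ℕ))) ?_ ?_ ?_ ?_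
  · intro g hg
    simp only [Finset.mem_filter, Finset.mem_univ, true_and] at hg
    have hg' : StrictAnti fun i => (g i : ℕ) := fun a b hab => hg hab
    rw [mem_subRect]
    constructor
    · intro j
      have h3 := hg'.add_sub_le (j := ⟨0, j.pos⟩) (k := j) (by simp [Fin.le_def])
      have h4 := (g ⟨0, j.pos⟩).isLt
      simp only at h3
      omega
    · intro j k hjk
      have h3 := hg'.add_sub_le hjk
      have h4 := key g hg j
      have h5 := key g hg k
      have h6 : (j : ℕ) ≤ k := hjk
      show (g k : ℕ) - (n - 1 - (k : ℕ)) ≤ (g j : ℕ) - (n - 1 - (j : ℕ))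
      omega
  · intro g hg g' hg' h
    simp only [Finset.mem_filter, Finset.mem_univ, true_and] at hg hg'
    ext j
    have h3 := congrFun h j
    have h4 := key g hg j
    have h5 := key g' hg' j
    change (g j : ℕ) - (n - 1 - (j : ℕ)) = (g' j : ℕ) - (n - 1 - (j : ℕ)) at h3
    omega
  · intro ν hν
    rw [mem_subRect] at hν
    refine ⟨fun j => ⟨ν j + (n - 1 - j), by have := hν.1 j; omega⟩, ?_, ?_⟩
    · simp only [Finset.mem_filter, Finset.mem_univ, true_and]
      intro a b hab
      have h3 := hν.2 hab.le
      have h4 : (a : ℕ) < b := hab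
      simp only [Fin.lt_def]
      omega
    · ext j
      simp
  · intro g hg
    simp only [Finset.mem_filter, Finset.mem_univ, true_and] at hg
    have hg' : StrictAnti fun i => (g i : ℕ) := fun a b hab => hg hab
    refine det_submatrix_mul_det_submatrix hs ht _ (fun j => ?_) (fun j => (g j : ℕ)) fun j => ?_
    · have h3 := hg'.add_sub_le (j := ⟨0, j.pos⟩) (k := j) (by simp [Fin.le_def])
      have h4 := (g ⟨0, j.pos⟩).isLt
      simp only at h3
      omega
    · have := key g hg j
      omega

/-- The expansion for t ≠ 0, where a power of t could be cancelled, extends to t = 0 because both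
sides are polynomials. -/
theorem eval_rectHermiteDet {s : ℂ} (hs : s ≠ 0) (t : ℂ) (N n : ℕ) :
    (rectHermiteDet s N n).eval t =
      ∑ ν ∈ subRect N n, partitionCoeff s N n ν * t ^ (∑ j, ν j) := by
  have h : rectHermiteDet s N n =
      ∑ ν ∈ subRect N n, C (partitionCoeff s N n ν) * X ^ (∑ j, ν j) := by
    refine eq_of_infinite_eval_eq _ _ ((Set.finite_singleton (0 : ℂ)).infinite_compl.mono ?_)
    intro u hu
    simp only [Set.mem_ofPred_eq, eval_finsetSum, eval_mul, eval_C, eval_pow, eval_X]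
    exact eval_rectHermiteDet_of_ne_zero hs hu N n
  conv_lhs => rw [h]
  simp only [eval_finsetSum, eval_mul, eval_C, eval_pow, eval_X]

end CauchyBinet

/-! ### The expansion at the origin -/

section Origin

open Polynomial

theorem iteratedDeriv_polynomial_eval (f : ℂ[X]) (k : ℕ) :
    iteratedDeriv k (fun x => f.eval x) = fun x => (derivative^[k] f).eval x := by
  induction k with
  | zero => simp
  | succ k ih =>
    rw [iteratedDeriv_succ, ih, Function.iterate_succ_apply']
    ext x
    exact Polynomial.deriv _

theorem gueMomentCoeff_eq {N : ℕ} (hN : 1 ≤ N) (p k : ℕ) :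
    gueMomentCoeff N p k = (partitionC (2 * p) (rectPartition N (2 * p)) : ℂ) *
      (rectHermiteDet (-1 / (2 * N)) N (2 * p)).coeff k := by
  have h : gueMoment N p = fun t => (C (partitionC (2 * p) (rectPartition N (2 * p)) : ℂ) *
      rectHermiteDet (-1 / (2 * N)) N (2 * p)).eval t := by
    ext t
    rw [(integrable_gueMomentIntegrand hN p t).2, eval_mul, eval_C]
  have hk : (k ! : ℂ) ≠ 0 := by exact_mod_cast Nat.factorial_ne_zero k
  rw [gueMomentCoeff, h, iteratedDeriv_polynomial_eval, ← coeff_C_mul]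
  simp only
  rw [← coeff_zero_eq_eval_zero, coeff_iterate_derivative, zero_add, Nat.descFactorial_self,
    nsmul_eq_mul, mul_div_cancel_left₀ _ hk]

theorem isBigO_eval_of_coeff_eq_zero (f : ℂ[X]) (n : ℕ) (h : ∀ k < n, f.coeff k = 0) :
    (fun t => f.eval t) =O[𝓝 0] fun t : ℂ => t ^ n := by
  obtain ⟨q, rfl⟩ := X_pow_dvd_iff.2 h
  have hq : (fun t => q.eval t) =O[𝓝 0] fun _ : ℂ => (1 : ℂ) :=
    (q.continuous.tendsto 0).isBigO_one ℂ
  simpa using (isBigO_refl (fun t : ℂ => t ^ n) (𝓝 0)).mul hq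

theorem rectHermiteDet_zero (s : ℂ) (N : ℕ) : rectHermiteDet s N 0 = 1 := by
  rw [rectHermiteDet, hermiteDet]
  exact Matrix.det_isEmpty

theorem Deven_pos (p m : ℕ) : 0 < Deven p m := Finset.prod_pos fun _ _ => by positivity

theorem Dodd_ne_zero (p m : ℕ) : Dodd p m ≠ 0 := by
  have := (Deven_pos p m).ne'
  rw [Deven] at this
  rw [Dodd]
  have h1 : ((m ! : ℝ) / ((m + p)! : ℝ)) ≠ 0 := by positivity
  exact mul_ne_zero (mul_ne_zero (pow_ne_zero _ (by norm_num)) h1) this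

theorem neg_one_div_two_mul_ne_zero {N : ℕ} (hN : 1 ≤ N) : (-1 / (2 * N) : ℂ) ≠ 0 := by
  have : (N : ℂ) ≠ 0 := by exact_mod_cast (by omega : N ≠ 0)
  simp [this]

theorem coeffs_rectHermiteDet_even {N m : ℕ} (p : ℕ) (hN : 1 ≤ N) (hm : N = 2 * m)
    {T : ℂ[X]} (hT : T = rectHermiteDet (-1 / (2 * N)) N (2 * p)) :
    T.coeff 0 = (-1 / (2 * N : ℂ)) ^ (N * p) * Deven p m ∧ T.coeff 2 = 0 ∧
    T.coeff 4 = T.coeff 0 * (2 ^ 2 * N ^ 2 / 24 * (N * p)) ∧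
    T.coeff 6 = T.coeff 0 * (2 ^ 3 * N ^ 3 / 720 * (2 * N * p * (2 * p - N))) ∧
    T.coeff 8 = T.coeff 0 * (2 ^ 4 * N ^ 4 / 40320 *
      (N * p * (4 * N ^ 2 - 17 * N * p + 16 * p ^ 2 + 2))) := by
  have hs := neg_one_div_two_mul_ne_zero hN
  have h0 : T.coeff 0 = (-1 / (2 * N : ℂ)) ^ (N * p) * Deven p m := by
    rw [hT]
    generalize (-1 / (2 * N : ℂ)) = s at hs
    subst hm
    exact coeff_zero_rectHermiteDet_even hs m p
  refine ⟨h0, ?_⟩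
  -- For p = 0 the determinant is empty, T = 1, and the bilinear equation is not available.
  rcases Nat.eq_zero_or_pos p with rfl | hp
  · rw [mul_zero, rectHermiteDet_zero] at hT
    subst hT
    simp [coeff_one]
  · have h2 : T.coeff 2 = 0 := by
      rw [hT, coeff_two_rectHermiteDet hs N p hp, if_pos (hm ▸ even_two_mul m)]
    refine ⟨h2, (coeffs_of_satisfiesBilinear (N := N) (p := p) ?_ ?_ ?_ ?_ ?_ ?_).1 h2⟩
    · exact_mod_cast (by omega : N ≠ 0)
    · rw [hT]
      exact satisfiesBilinear_rectHermiteDet _ N p hp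
    · rw [hT]; exact coeff_rectHermiteDet_of_odd _ N p (by decide)
    · rw [hT]; exact coeff_rectHermiteDet_of_odd _ N p (by decide)
    · rw [hT]; exact coeff_rectHermiteDet_of_odd _ N p (by decide)
    · rw [h0]
      exact mul_ne_zero (pow_ne_zero _ hs) (by exact_mod_cast (Deven_pos p m).ne')

theorem coeffs_rectHermiteDet_odd {N m : ℕ} (p : ℕ) (hN : 1 ≤ N) (hm : N = 2 * m + 1)
    {T : ℂ[X]} (hT : T = rectHermiteDet (-1 / (2 * N)) N (2 * p)) :
    T.coeff 0 = (-1 / (2 * N : ℂ)) ^ (N * p) * Dodd p m ∧ T.coeff 2 = T.coeff 0 * (N * p) ∧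
    T.coeff 4 = T.coeff 0 * (2 ^ 2 * N ^ 2 / 24 * (p ^ 2 - N * p)) ∧
    T.coeff 6 = T.coeff 0 * (2 ^ 3 * N ^ 3 / 720 * (p * (2 * N ^ 2 - 3 * N * p + p ^ 2))) ∧
    T.coeff 8 = T.coeff 0 * (2 ^ 4 * N ^ 4 / 40320 *
      (p * (-4 * N ^ 3 + 15 * N ^ 2 * p - 6 * N * p ^ 2 - 2 * N + p ^ 3 - 4 * p))) := by
  have hs := neg_one_div_two_mul_ne_zero hN
  have hN0 : (N : ℂ) ≠ 0 := by exact_mod_cast (by omega : N ≠ 0)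
  have h0 : T.coeff 0 = (-1 / (2 * N : ℂ)) ^ (N * p) * Dodd p m := by
    rw [hT]
    generalize (-1 / (2 * N : ℂ)) = s at hs
    subst hm
    exact coeff_zero_rectHermiteDet_odd hs m p
  refine ⟨h0, ?_⟩
  rcases Nat.eq_zero_or_pos p with rfl | hp
  · rw [mul_zero, rectHermiteDet_zero] at hT
    subst hT
    simp [coeff_one]
  · have h2 : T.coeff 2 = N * p * T.coeff 0 := by
      rw [hT, coeff_two_rectHermiteDet hs N p hp,
        if_neg (by rw [hm]; exact Nat.not_even_two_mul_add_one m)]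
      congr 1
      field_simp
    refine ⟨by rw [h2]; ring, (coeffs_of_satisfiesBilinear (N := N) (p := p) hN0 ?_ ?_ ?_ ?_ ?_).2 h2⟩
    · rw [hT]
      exact satisfiesBilinear_rectHermiteDet _ N p hp
    · rw [hT]; exact coeff_rectHermiteDet_of_odd _ N p (by decide)
    · rw [hT]; exact coeff_rectHermiteDet_of_odd _ N p (by decide)
    · rw [hT]; exact coeff_rectHermiteDet_of_odd _ N p (by decide)
    · rw [h0]
      exact mul_ne_zero (pow_ne_zero _ hs) (by exact_mod_cast Dodd_ne_zero p m)

theorem isBigO_eval_sub {T : ℂ[X]} (hodd : ∀ k, Odd k → T.coeff k = 0) {c0 c2 c4 c6 c8 : ℂ}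
    (h0 : T.coeff 0 = c0) (h2 : T.coeff 2 = c0 * c2) (h4 : T.coeff 4 = c0 * c4)
    (h6 : T.coeff 6 = c0 * c6) (h8 : T.coeff 8 = c0 * c8) (a : ℂ) :
    (fun t => a * T.eval t - a * c0 * (1 + c2 * t ^ 2 + c4 * t ^ 4 + c6 * t ^ 6 + c8 * t ^ 8))
      =O[𝓝 0] fun t : ℂ => t ^ 10 := by
  have h := isBigO_eval_of_coeff_eq_zero (C a * (T - C c0 * (1 + C c2 * X ^ 2 + C c4 * X ^ 4 +
    C c6 * X ^ 6 + C c8 * X ^ 8))) 10 ?_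
  · refine h.congr_left fun t => ?_
    simp only [eval_mul, eval_sub, eval_add, eval_C, eval_pow, eval_X, eval_one]
    ring
  · intro k hk
    rw [coeff_C_mul, coeff_sub, coeff_C_mul]
    simp only [coeff_add, coeff_C_mul, coeff_X_pow, coeff_one]
    interval_cases k
    · simp [h0]
    · simp [hodd 1 (by decide)]
    · simp [h2]
    · simp [hodd 3 (by decide)]
    · simp [h4]
    · simp [hodd 5 (by decide)]
    · simp [h6]
    · simp [hodd 7 (by decide)]
    · simp [h8]
    · simp [hodd 9 (by decide)]

theorem isBigO_gueMoment_even {N m : ℕ} (p : ℕ) (hN : 1 ≤ N) (hm : N = 2 * m) :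
    (fun t : ℂ => gueMoment N p t -
        (-1 / (2 * (N : ℂ))) ^ (N * p) *
          (partitionC (2 * p) (rectPartition N (2 * p)) : ℂ) * (Deven p m : ℂ) *
          (1 + (2 ^ 2 * (N : ℂ) ^ 2 / (4 ! : ℂ)) * (N * p) * t ^ 4
            + (2 ^ 3 * (N : ℂ) ^ 3 / (6 ! : ℂ)) * (2 * N * p * (2 * p - N)) * t ^ 6
            + (2 ^ 4 * (N : ℂ) ^ 4 / (8 ! : ℂ)) *
                (N * p * (4 * (N : ℂ) ^ 2 - 17 * N * p + 16 * (p : ℂ) ^ 2 + 2)) * t ^ 8))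
        =O[𝓝 0] fun t : ℂ => t ^ 10 := by
  obtain ⟨h0, h2, h4, h6, h8⟩ := coeffs_rectHermiteDet_even p hN hm rfl
  refine (isBigO_eval_sub (fun k hk => coeff_rectHermiteDet_of_odd _ N p hk) rfl
    (h2.trans (mul_zero _).symm) h4 h6 h8
    (partitionC (2 * p) (rectPartition N (2 * p)) : ℂ)).congr_left fun t => ?_
  rw [(integrable_gueMomentIntegrand hN p t).2, h0]
  simp only [show (4 ! : ℂ) = 24 by norm_num [Nat.factorial],
    show (6 ! : ℂ) = 720 by norm_num [Nat.factorial],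
    show (8 ! : ℂ) = 40320 by norm_num [Nat.factorial]]
  ring

theorem isBigO_gueMoment_odd {N m : ℕ} (p : ℕ) (hN : 1 ≤ N) (hm : N = 2 * m + 1) :
    (fun t : ℂ => gueMoment N p t -
        (-1 / (2 * (N : ℂ))) ^ (N * p) *
          (partitionC (2 * p) (rectPartition N (2 * p)) : ℂ) * (Dodd p m : ℂ) *
          (1 + (2 * (N : ℂ) / (2 ! : ℂ)) * p * t ^ 2
            + (2 ^ 2 * (N : ℂ) ^ 2 / (4 ! : ℂ)) * ((p : ℂ) ^ 2 - N * p) * t ^ 4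
            + (2 ^ 3 * (N : ℂ) ^ 3 / (6 ! : ℂ)) *
                (p * (2 * (N : ℂ) ^ 2 - 3 * N * p + (p : ℂ) ^ 2)) * t ^ 6
            + (2 ^ 4 * (N : ℂ) ^ 4 / (8 ! : ℂ)) *
                (p * (-4 * (N : ℂ) ^ 3 + 15 * (N : ℂ) ^ 2 * p - 6 * N * (p : ℂ) ^ 2
                  - 2 * N + (p : ℂ) ^ 3 - 4 * p)) * t ^ 8))
        =O[𝓝 0] fun t : ℂ => t ^ 10 := by
  obtain ⟨h0, h2, h4, h6, h8⟩ := coeffs_rectHermiteDet_odd p hN hm rfl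
  refine (isBigO_eval_sub (fun k hk => coeff_rectHermiteDet_of_odd _ N p hk) rfl
    h2 h4 h6 h8
    (partitionC (2 * p) (rectPartition N (2 * p)) : ℂ)).congr_left fun t => ?_
  rw [(integrable_gueMomentIntegrand hN p t).2, h0]
  simp only [show (2 ! : ℂ) = 2 by norm_num [Nat.factorial],
    show (4 ! : ℂ) = 24 by norm_num [Nat.factorial],
    show (6 ! : ℂ) = 720 by norm_num [Nat.factorial],
    show (8 ! : ℂ) = 40320 by norm_num [Nat.factorial]]
  ring

end Origin

/-! ### Stirling's series and asymptotic expansions in `1 / N` -/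

section Stirling

open Stirling

/-- The first two terms of the remainder in Stirling's series. -/
noncomputable def stirlingTail (x : ℝ) : ℝ := 1 / (12 * x) - 1 / (360 * x ^ 3)

/-- The difference is ∑_{i≥1} y^i/(2i+1). Its tail after two terms is at most the geometric series
y³/(7(1-y)), and y ≤ 1/9. -/
theorem abs_log_stirlingSeq_sub_le {m : ℕ} (hm : 1 ≤ m) {y : ℝ} (hy : y = (1 / (2 * (m : ℝ) + 1)) ^ 2) :
    |Real.log (stirlingSeq m) - Real.log (stirlingSeq (m + 1)) - (y / 3 + y ^ 2 / 5)| ≤ y ^ 3 := by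
  obtain ⟨k, rfl⟩ : ∃ k, m = k + 1 := ⟨m - 1, by omega⟩
  have h := log_stirlingSeq_sdiff_hasSum k
  rw [← hy] at h
  have hy0 : 0 ≤ y := by rw [hy]; positivity
  have hy1 : y ≤ 1 / 9 := by
    have h1 : (1 : ℝ) ≤ ((k + 1 : ℕ) : ℝ) := by exact_mod_cast hm
    rw [hy, div_pow, one_pow]
    exact one_div_le_one_div_of_le (by norm_num) (by nlinarith)
  have h2 := (hasSum_nat_add_iff' 2).2 h
  have e : ∑ i ∈ Finset.range 2, (1 : ℝ) / (2 * ((i + 1 : ℕ) : ℝ) + 1) * y ^ (i + 1) =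
      y / 3 + y ^ 2 / 5 := by
    norm_num [Finset.sum_range_succ]
    ring
  rw [e] at h2
  have h3 : HasSum (fun i : ℕ => y ^ 3 * (1 / 7) * y ^ i) (y ^ 3 * (1 / 7) * (1 - y)⁻¹) :=
    (hasSum_geometric_of_lt_one hy0 (by linarith)).mul_left _
  have h4 := h2.nonneg fun i => by positivity
  have h5 := hasSum_le (fun i => ?_) h2 h3
  · rw [abs_of_nonneg h4]
    refine h5.trans ?_
    rw [mul_assoc]
    refine mul_le_of_le_one_right (by positivity) ?_
    rw [← div_eq_mul_inv, div_le_one (by linarith)]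
    linarith
  · have h6 : (1 : ℝ) / (2 * ((i + 2 + 1 : ℕ) : ℝ) + 1) ≤ 1 / 7 := by
      refine one_div_le_one_div_of_le (by norm_num) ?_
      push_cast
      have : (0 : ℝ) ≤ i := by positivity
      linarith
    calc (1 : ℝ) / (2 * ((i + 2 + 1 : ℕ) : ℝ) + 1) * y ^ (i + 2 + 1) ≤ 1 / 7 * y ^ (i + 2 + 1) := by
          gcongr
      _ = y ^ 3 * (1 / 7) * y ^ i := by ring

theorem abs_stirlingTail_sub_le {m : ℕ} (hm : 1 ≤ m) {y : ℝ} (hy : y = (1 / (2 * (m : ℝ) + 1)) ^ 2) :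
    |stirlingTail m - stirlingTail (m + 1) - (y / 3 + y ^ 2 / 5)| ≤ y ^ 3 := by
  have hm1 : (1 : ℝ) ≤ m := by exact_mod_cast hm
  have hy0 : 0 ≤ y := by rw [hy]; positivity
  have hy1 : y ≤ 1 / 9 := by
    rw [hy, div_pow, one_pow]
    exact one_div_le_one_div_of_le (by norm_num) (by nlinarith)
  -- This expresses m(m+1) through y, which turns the remainder into an exact rational function of
  -- y.
  have hy2 : (1 : ℝ) - y = 4 * m * (m + 1) * y := by
    rw [hy]
    field_simp
    ring
  have h1 : stirlingTail m - stirlingTail (m + 1) - (y / 3 + y ^ 2 / 5) =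
      y ^ 3 * ((-5 - 12 * y + 9 * y ^ 2) / (45 * (1 - y) ^ 3)) := by
    rw [hy2, hy, stirlingTail, stirlingTail]
    field_simp
    ring
  rw [h1, abs_mul, abs_of_nonneg (by positivity : 0 ≤ y ^ 3)]
  refine mul_le_of_le_one_right (by positivity) ?_
  have h2 : (1 / 2 : ℝ) ≤ (1 - y) ^ 3 := by
    calc (1 / 2 : ℝ) ≤ (1 - 1 / 9) ^ 3 := by norm_num
      _ ≤ _ := by gcongr
  rw [abs_div, abs_of_pos (by linarith : 0 < 45 * (1 - y) ^ 3), div_le_one (by linarith), abs_le]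
  constructor <;> nlinarith

theorem abs_log_stirlingSeq_sub_stirlingTail_le {m : ℕ} (hm : 1 ≤ m) :
    |Real.log (stirlingSeq m) - Real.log √Real.pi - stirlingTail m| ≤ 1 / (m : ℝ) ^ 4 := by
  set e : ℕ → ℝ := fun m => Real.log (stirlingSeq m) - Real.log √Real.pi - stirlingTail m with he
  have hstep : ∀ m : ℕ, 1 ≤ m → |e m - e (m + 1)| ≤ 1 / (m : ℝ) ^ 4 - 1 / ((m + 1 : ℕ) : ℝ) ^ 4 := by
    intro m hm
    have hm1 : (1 : ℝ) ≤ m := by exact_mod_cast hm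
    have h1 := abs_log_stirlingSeq_sub_le hm rfl
    have h2 := abs_stirlingTail_sub_le hm rfl
    set y : ℝ := (1 / (2 * (m : ℝ) + 1)) ^ 2 with hy
    have h3 : e m - e (m + 1) = (Real.log (stirlingSeq m) - Real.log (stirlingSeq (m + 1)) -
        (y / 3 + y ^ 2 / 5)) - (stirlingTail m - stirlingTail (m + 1) - (y / 3 + y ^ 2 / 5)) := by
      simp only [he]
      push_cast
      ring
    have h4 : 2 * y ^ 3 ≤ 1 / (m : ℝ) ^ 4 - 1 / ((m + 1 : ℕ) : ℝ) ^ 4 := by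
      -- Writing m = k + 1 leaves a numerator in k with only nonnegative coefficients.
      obtain ⟨k, rfl⟩ : ∃ k, m = k + 1 := ⟨m - 1, by omega⟩
      rw [hy, ← sub_nonneg]
      push_cast
      have h5 : 1 / ((k : ℝ) + 1) ^ 4 - 1 / ((k : ℝ) + 1 + 1) ^ 4 -
          2 * ((1 / (2 * ((k : ℝ) + 1) + 1)) ^ 2) ^ 3 =
          ((((k : ℝ) + 1 + 1) ^ 4 - ((k : ℝ) + 1) ^ 4) * (2 * ((k : ℝ) + 1) + 1) ^ 6 -
            2 * ((k : ℝ) + 1) ^ 4 * ((k : ℝ) + 1 + 1) ^ 4) /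
          (((k : ℝ) + 1) ^ 4 * ((k : ℝ) + 1 + 1) ^ 4 * (2 * ((k : ℝ) + 1) + 1) ^ 6) := by
        field_simp
      rw [h5]
      refine div_nonneg ?_ (by positivity)
      ring_nf
      positivity
    rw [h3]
    refine (abs_sub _ _).trans ?_
    linarith
  have hinv : Tendsto (fun m : ℕ => 1 / ((m + 1 : ℕ) : ℝ) ^ 4) atTop (𝓝 0) := by
    exact (tendsto_const_div_pow 1 4 (by norm_num)).comp (tendsto_add_atTop_nat 1)
  have hlim : Tendsto (fun m : ℕ => e (m + 1)) atTop (𝓝 0) := by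
    suffices h : Tendsto e atTop (𝓝 0) from h.comp (tendsto_add_atTop_nat 1)
    have h1 : Tendsto (fun m : ℕ => Real.log (stirlingSeq m)) atTop (𝓝 (Real.log √Real.pi)) :=
      (Real.continuousAt_log (by positivity)).tendsto.comp tendsto_stirlingSeq_sqrt_pi
    have h2 : Tendsto (fun m : ℕ => stirlingTail m) atTop (𝓝 0) := by
      have h3 := (tendsto_const_div_pow (1 / 12) 1 (by norm_num)).sub
        (tendsto_const_div_pow (1 / 360) 3 (by norm_num))
      rw [sub_zero] at h3
      refine h3.congr fun m => ?_
      rw [stirlingTail]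
      rw [div_div, div_div, pow_one]
    have := (h1.sub_const (Real.log √Real.pi)).sub h2
    rwa [sub_self, sub_zero] at this
  -- By `hstep` the sequences e_m ∓ 1/m⁴ are increasing and decreasing respectively, and both tend
  -- to 0; this traps e_m between ±1/m⁴.
  have hmono : Monotone fun m : ℕ => e (m + 1) - 1 / ((m + 1 : ℕ) : ℝ) ^ 4 := by
    refine monotone_nat_of_le_succ fun m => ?_
    have := (abs_le.1 (hstep (m + 1) (by omega))).2
    linarith
  have hanti : Antitone fun m : ℕ => e (m + 1) + 1 / ((m + 1 : ℕ) : ℝ) ^ 4 := by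
    refine antitone_nat_of_succ_le fun m => ?_
    have := (abs_le.1 (hstep (m + 1) (by omega))).1
    linarith
  obtain ⟨k, rfl⟩ : ∃ k, m = k + 1 := ⟨m - 1, by omega⟩
  have h1 := hmono.ge_of_tendsto (by simpa using hlim.sub hinv) k
  have h2 := hanti.le_of_tendsto (by simpa using hlim.add hinv) k
  change |e (k + 1)| ≤ _
  rw [abs_le]
  constructor
  · linarith
  · linarith

end Stirling

/-! ### Calculus of expansions in 1/N up to order N^{-3}. -/

section Expansion

/-- `f N = c₀ + c₁ / N + c₂ / N² + c₃ / N³ + O(1 / N⁴)` along `l`. -/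
def HasExpansion (l : Filter ℕ) (f : ℕ → ℝ) (c₀ c₁ c₂ c₃ : ℝ) : Prop :=
  (fun N : ℕ => f N - (c₀ + c₁ / N + c₂ / N ^ 2 + c₃ / N ^ 3)) =O[l] fun N : ℕ => 1 / (N : ℝ) ^ 4

variable {l : Filter ℕ} {f g : ℕ → ℝ} {c₀ c₁ c₂ c₃ d₀ d₁ d₂ d₃ : ℝ}

theorem isBigO_continuous_one_div (hl : l ≤ atTop) {P : ℝ → ℝ} (hP : Continuous P) :
    (fun N : ℕ => P (1 / N)) =O[l] fun _ => (1 : ℝ) :=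
  ((hP.tendsto 0).comp ((tendsto_one_div_atTop_nhds_zero_nat (𝕜 := ℝ)).mono_left hl)).isBigO_one ℝ

theorem HasExpansion.congr' (h : HasExpansion l f c₀ c₁ c₂ c₃) (hfg : f =ᶠ[l] g) :
    HasExpansion l g c₀ c₁ c₂ c₃ :=
  IsBigO.congr' h (hfg.mono fun N hN => by simp only [hN]) EventuallyEq.rfl

theorem hasExpansion_linear (l : Filter ℕ) (a b : ℝ) :
    HasExpansion l (fun N : ℕ => a + b / N) a b 0 0 := by
  simp only [HasExpansion, zero_div, add_zero, sub_self]
  exact isBigO_zero _ _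

theorem HasExpansion.add (hf : HasExpansion l f c₀ c₁ c₂ c₃) (hg : HasExpansion l g d₀ d₁ d₂ d₃) :
    HasExpansion l (fun N => f N + g N) (c₀ + d₀) (c₁ + d₁) (c₂ + d₂) (c₃ + d₃) :=
  (IsBigO.add hf hg).congr_left fun N => by ring

theorem HasExpansion.const_mul (hf : HasExpansion l f c₀ c₁ c₂ c₃) (a : ℝ) :
    HasExpansion l (fun N => a * f N) (a * c₀) (a * c₁) (a * c₂) (a * c₃) :=
  (IsBigO.const_mul_left hf a).congr_left fun N => by ring

theorem HasExpansion.mul (hl : l ≤ atTop) (hf : HasExpansion l f c₀ c₁ c₂ c₃)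
    (hg : HasExpansion l g d₀ d₁ d₂ d₃) :
    HasExpansion l (fun N => f N * g N) (c₀ * d₀) (c₀ * d₁ + c₁ * d₀)
      (c₀ * d₂ + c₁ * d₁ + c₂ * d₀) (c₀ * d₃ + c₁ * d₂ + c₂ * d₁ + c₃ * d₀) := by
  have hP : ∀ a b c d : ℝ, Continuous fun x : ℝ => a + b * x + c * x ^ 2 + d * x ^ 3 :=
    fun a b c d => by fun_prop
  have h1 := (isBigO_continuous_one_div hl (hP c₀ c₁ c₂ c₃)).mul hg
  have h2 := (isBigO_continuous_one_div hl (hP d₀ d₁ d₂ d₃)).mul hf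
  have h3 := (isBigO_continuous_one_div hl (hP 0 0 0 0)).mul hf
  have hone : (fun N : ℕ => 1 / (N : ℝ) ^ 4) =O[l] fun _ => (1 : ℝ) := by
    refine (isBigO_continuous_one_div hl (P := fun x => x ^ 4) (by fun_prop)).congr_left
      fun N => ?_
    rw [one_div_pow]
  have h4 := (IsBigO.trans hf hone).mul hg
  -- The terms of degree 4, 5 and 6 in 1/N in the product of the two truncations.
  have h5 := (isBigO_continuous_one_div hl
    (hP (c₁ * d₃ + c₂ * d₂ + c₃ * d₁) (c₂ * d₃ + c₃ * d₂) (c₃ * d₃) 0)).mul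
    (isBigO_refl (fun N : ℕ => 1 / (N : ℝ) ^ 4) l)
  have h := ((h1.add h2).add h4).add h5
  simp only [one_mul] at h
  refine h.congr_left fun N => ?_
  ring

theorem HasExpansion.exp (hl : l ≤ atTop) (hf : HasExpansion l f 0 c₁ c₂ c₃) :
    HasExpansion l (fun N => Real.exp (f N)) 1 c₁ (c₁ ^ 2 / 2 + c₂) (c₁ ^ 3 / 6 + c₁ * c₂ + c₃) := by
  have h2 := hf.mul hl hf
  have h3 := h2.mul hl hf
  have hlin : f =O[l] fun N : ℕ => 1 / (N : ℝ) := by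
    have h4 := (isBigO_continuous_one_div hl (P := fun x => c₁ + c₂ * x + c₃ * x ^ 2)
      (by fun_prop)).mul (isBigO_refl (fun N : ℕ => 1 / (N : ℝ)) l)
    have h5 := (isBigO_continuous_one_div hl (P := fun x => x ^ 3)
      (by fun_prop)).mul (isBigO_refl (fun N : ℕ => 1 / (N : ℝ)) l)
    have h6 : (fun N : ℕ => 1 / (N : ℝ) ^ 4) =O[l] fun N : ℕ => 1 * (1 / (N : ℝ)) :=
      h5.congr_left fun N => by ring
    have h7 := (IsBigO.trans hf h6).add h4
    simp only [one_mul] at h7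
    exact h7.congr_left fun N => by ring
  have htend : Tendsto f l (𝓝 0) :=
    hlin.trans_tendsto ((tendsto_one_div_atTop_nhds_zero_nat (𝕜 := ℝ)).mono_left hl)
  -- Since f = O(1/N), the quartic Taylor remainder of exp is O(1/N⁴).
  have hexp := ((Real.exp_sub_sum_range_isBigO_pow 4).comp_tendsto htend).trans (hlin.pow 4)
  have hpoly : HasExpansion l (fun N => 1 + f N + 1 / 2 * (f N * f N) +
      1 / 6 * (f N * f N * f N)) 1 c₁ (c₁ ^ 2 / 2 + c₂) (c₁ ^ 3 / 6 + c₁ * c₂ + c₃) := by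
    have h1 := (((hasExpansion_linear l 1 0).add hf).add (h2.const_mul (1 / 2))).add
      (h3.const_mul (1 / 6))
    refine IsBigO.congr_left h1 fun N => ?_
    ring
  have h := hexp.congr_right (fun N => one_div_pow (N : ℝ) 4) |>.add hpoly
  refine h.congr_left fun N => ?_
  simp only [Function.comp, Finset.sum_range_succ, Finset.sum_range_zero]
  norm_num [Nat.factorial]
  ring

end Expansion

/-! ### The normalised constant coefficient as a product over p. -/

section LeadingRatio

open Stirling

/-- The constant coefficient of the moment, up to sign, divided by the leading factor; `D` stands
for the constant `D_e` or `D_o`. -/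
noncomputable def leadingRatio (D : ℝ) (N p : ℕ) : ℝ :=
  partitionC (2 * p) (rectPartition N (2 * p)) / (2 * (N : ℝ)) ^ (N * p) * D / leadingFactor N p

/-- The quotient of consecutive values of `leadingRatio`. -/
noncomputable def leadingStep (N p a b : ℕ) : ℝ :=
  ((N + 2 * p)! : ℝ) * ((N + 2 * p + 1)! : ℝ) * Real.exp N /
    ((a ! : ℝ) * (b ! : ℝ) * (2 * (N : ℝ)) ^ (N + 2 * p + 1))

theorem partitionC_rectPartition (N n : ℕ) : partitionC n (rectPartition N n) =
    ∏ j ∈ Finset.range n, (((N + j)! : ℝ) / (j ! : ℝ)) := by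
  rw [← Fin.prod_univ_eq_prod_range (fun j => ((N + j)! : ℝ) / (j ! : ℝ)), partitionC]
  refine Fintype.prod_equiv Fin.revPerm _ _ fun i => ?_
  rw [Fin.revPerm_apply, Fin.val_rev, rectPartition, show n - ((i : ℕ) + 1) = n - 1 - i by omega]

theorem gammaConst_eq (p : ℕ) : gammaConst p =
    (∏ j ∈ Finset.range p, (j ! : ℝ)) ^ 2 / ∏ j ∈ Finset.range (2 * p), (j ! : ℝ) := by
  have h : ∏ j ∈ Finset.range p, (j ! : ℝ) ≠ 0 := Finset.prod_ne_zero_iff.2 fun _ _ => by positivity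
  rw [gammaConst, Finset.prod_div_distrib, two_mul, Finset.prod_range_add, sq,
    mul_div_mul_left _ _ h]

theorem gammaConst_succ (p : ℕ) : gammaConst (p + 1) =
    gammaConst p * ((p ! : ℝ) ^ 2 / (((2 * p)! : ℝ) * ((2 * p + 1)! : ℝ))) := by
  rw [gammaConst_eq, gammaConst_eq, show 2 * (p + 1) = 2 * p + 1 + 1 by ring,
    Finset.prod_range_succ, Finset.prod_range_succ, Finset.prod_range_succ]
  rw [div_mul_div_comm]
  ring

theorem gammaConst_pos (p : ℕ) : 0 < gammaConst p := Finset.prod_pos fun _ _ => by positivity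

/-- Raising p by one appends (N+2p)!(N+2p+1)!/((2p)!(2p+1)!) to C_λ, while γ_p gains
p!²/((2p)!(2p+1)!). The factorials free of N cancel, leaving `leadingStep`. -/
theorem leadingRatio_succ {N : ℕ} (hN : 1 ≤ N) (p a b : ℕ) (D : ℝ) :
    leadingRatio (D * ((p ! : ℝ) ^ 2 / ((a ! : ℝ) * (b ! : ℝ)))) N (p + 1) =
      leadingRatio D N p * leadingStep N p a b := by
  have hN0 : (0 : ℝ) < N := by exact_mod_cast hN
  have hg := (gammaConst_pos p).ne'
  have e1 : Real.exp (-((N : ℝ) * ((p + 1 : ℕ) : ℝ))) =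
      Real.exp (-((N : ℝ) * p)) * (Real.exp N)⁻¹ := by
    rw [← Real.exp_neg, ← Real.exp_add]
    congr 1
    push_cast
    ring
  rw [leadingRatio, leadingRatio, leadingStep, leadingFactor, leadingFactor, gammaConst_succ, e1,
    partitionC_rectPartition, partitionC_rectPartition, show 2 * (p + 1) = 2 * p + 1 + 1 by ring,
    Finset.prod_range_succ, Finset.prod_range_succ, ← add_assoc,
    show (p + 1) ^ 2 = p ^ 2 + (2 * p + 1) by ring, mul_add, mul_one, pow_add, pow_add,
    show N + 2 * p + 1 = N + (2 * p + 1) by ring, pow_add _ N]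
  field_simp

theorem leadingRatio_zero (N : ℕ) : leadingRatio 1 N 0 = 1 := by
  simp [leadingRatio, leadingFactor, partitionC, gammaConst]

theorem stirlingSeq_sq {n : ℕ} : stirlingSeq n ^ 2 =
    (n ! : ℝ) ^ 2 * Real.exp n ^ 2 / (2 * n * ((n : ℝ) ^ n) ^ 2) := by
  rw [stirlingSeq, div_pow, mul_pow, Real.sq_sqrt (by positivity), div_pow, ← Real.exp_nat_mul,
    mul_one, div_pow, ← mul_div_assoc, div_div_eq_mul_div]

theorem leadingStep_even_zero {m : ℕ} (hm : 1 ≤ m) : leadingStep (2 * m) 0 m m =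
    (stirlingSeq (2 * m) / stirlingSeq m) ^ 2 * (1 + 1 / ((2 * m : ℕ) : ℝ)) := by
  have hm0 : (0 : ℝ) < m := by exact_mod_cast hm
  have e1 : Real.exp ((2 * m : ℕ) : ℝ) = Real.exp m ^ 2 := by
    rw [← Real.exp_nat_mul]; push_cast; rfl
  have e2 : (2 * ((2 * m : ℕ) : ℝ)) ^ (2 * m + 1) =
      (2 ^ m) ^ 4 * ((m : ℝ) ^ m) ^ 2 * (4 * m) := by
    push_cast
    rw [pow_succ, pow_mul, show (2 * (2 * (m : ℝ))) = 2 ^ 2 * m by ring, mul_pow, mul_pow, ← pow_mul,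
      ← pow_mul]
    ring
  have e3 : ((2 * m : ℕ) : ℝ) ^ (2 * m) = (2 ^ m) ^ 2 * ((m : ℝ) ^ m) ^ 2 := by
    push_cast
    rw [mul_comm 2 m, pow_mul, mul_pow]
    ring
  rw [div_pow, stirlingSeq_sq, stirlingSeq_sq, leadingStep, mul_zero, add_zero, Nat.factorial_succ,
    e1, e2, e3]
  push_cast
  have := Real.exp_pos m
  field_simp
  ring

/-- Stirling's formula for m! involves powers of m = (N-1)/2 instead of N/2. The last factor
corrects for this; it tends to 1. -/
theorem leadingStep_odd_zero {m : ℕ} (hm : 1 ≤ m) : leadingStep (2 * m + 1) 0 m (m + 1) =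
    (stirlingSeq (2 * m + 1) / stirlingSeq m) ^ 2 *
      (Real.exp (-1) / (1 - 1 / ((2 * m + 1 : ℕ) : ℝ)) ^ (2 * m + 1)) := by
  have hm0 : (0 : ℝ) < m := by exact_mod_cast hm
  have e1 : Real.exp ((2 * m + 1 : ℕ) : ℝ) = Real.exp m ^ 2 * Real.exp 1 := by
    rw [← Real.exp_nat_mul, ← Real.exp_add]; push_cast; rfl
  have e2 : (1 - 1 / ((2 * m + 1 : ℕ) : ℝ)) ^ (2 * m + 1) =
      (2 ^ m) ^ 2 * ((m : ℝ) ^ m) ^ 2 * (2 * m) / ((2 * m + 1 : ℕ) : ℝ) ^ (2 * m + 1) := by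
    have h : (1 - 1 / ((2 * m + 1 : ℕ) : ℝ)) = (2 * m) / ((2 * m + 1 : ℕ) : ℝ) := by
      push_cast
      field_simp
      ring
    rw [h, div_pow]
    congr 1
    rw [pow_succ, mul_comm 2 m, pow_mul, mul_pow]
    ring
  have e3 : (2 * ((2 * m + 1 : ℕ) : ℝ)) ^ (2 * m + 1 + 1) =
      2 * ((2 * m + 1 : ℕ) : ℝ) * (2 * (2 ^ m) ^ 2) * ((2 * m + 1 : ℕ) : ℝ) ^ (2 * m + 1) := by
    rw [pow_succ, mul_pow, pow_succ 2, pow_mul, ← pow_mul, ← pow_mul]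
    ring
  rw [div_pow, stirlingSeq_sq, stirlingSeq_sq, leadingStep, mul_zero, add_zero,
    Nat.factorial_succ (2 * m + 1), Nat.factorial_succ m, e1, e2, e3, Real.exp_neg]
  have hM : ((2 * m + 1 : ℕ) : ℝ) ^ (2 * m + 1) ≠ 0 := by positivity
  have hM0 : ((2 * m + 1 : ℕ) : ℝ) ≠ 0 := by positivity
  have h1 : ((2 * m + 1 + 1 : ℕ) : ℝ) = 2 * (m + 1) := by push_cast; ring
  have := Real.exp_pos m
  have := Real.exp_pos 1
  push_cast at hM hM0 h1 ⊢
  rw [h1]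
  generalize (2 * (m : ℝ) + 1) ^ (2 * m + 1) = W at *
  field_simp

theorem leadingStep_even_succ {m : ℕ} (hm : 1 ≤ m) (p : ℕ) :
    leadingStep (2 * m) (p + 1) (m + (p + 1)) (m + (p + 1)) =
      leadingStep (2 * m) p (m + p) (m + p) *
        ((1 + (2 * p + 1 : ℝ) / ((2 * m : ℕ) : ℝ)) * (1 + (2 * p + 3 : ℝ) / ((2 * m : ℕ) : ℝ))) := by
  have hm0 : (0 : ℝ) < m := by exact_mod_cast hm
  rw [leadingStep, leadingStep, show 2 * m + 2 * (p + 1) = 2 * m + 2 * p + 1 + 1 by ring,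
    show m + (p + 1) = m + p + 1 by ring, Nat.factorial_succ (2 * m + 2 * p + 1 + 1),
    Nat.factorial_succ (2 * m + 2 * p + 1), Nat.factorial_succ (2 * m + 2 * p),
    Nat.factorial_succ (m + p), pow_succ _ (2 * m + 2 * p + 1 + 1), pow_succ _ (2 * m + 2 * p + 1)]
  push_cast
  generalize (2 * (2 * (m : ℝ))) ^ (2 * m + 2 * p + 1) = W at *
  field_simp
  ring

theorem leadingStep_odd_succ (m p : ℕ) :
    leadingStep (2 * m + 1) (p + 1) (m + (p + 1)) (m + (p + 1) + 1) =
      leadingStep (2 * m + 1) p (m + p) (m + p + 1) *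
        ((1 + (2 * p + 2 : ℝ) / ((2 * m + 1 : ℕ) : ℝ)) *
          (1 + (2 * p + 2 : ℝ) / ((2 * m + 1 : ℕ) : ℝ))) := by
  have hm0 : (0 : ℝ) < 2 * m + 1 := by positivity
  rw [leadingStep, leadingStep, show 2 * m + 1 + 2 * (p + 1) = 2 * m + 1 + 2 * p + 1 + 1 by ring,
    show m + (p + 1) = m + p + 1 by ring, Nat.factorial_succ (2 * m + 1 + 2 * p + 1 + 1),
    Nat.factorial_succ (2 * m + 1 + 2 * p + 1), Nat.factorial_succ (2 * m + 1 + 2 * p),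
    Nat.factorial_succ (m + p + 1), Nat.factorial_succ (m + p),
    pow_succ _ (2 * m + 1 + 2 * p + 1 + 1), pow_succ _ (2 * m + 1 + 2 * p + 1)]
  push_cast
  generalize (2 * (2 * (m : ℝ) + 1)) ^ (2 * m + 1 + 2 * p + 1) = W at *
  field_simp
  ring

end LeadingRatio

/-! ### Expansion of the normalised constant coefficient. -/

section LeadingExpansion

open Stirling

theorem hasExpansion_of_bound {l : Filter ℕ} {f : ℕ → ℝ} {c₀ c₁ c₂ c₃ : ℝ} (C : ℝ)
    (h : ∀ᶠ N : ℕ in l, |f N - (c₀ + c₁ / N + c₂ / N ^ 2 + c₃ / N ^ 3)| ≤ C / (N : ℝ) ^ 4) :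
    HasExpansion l f c₀ c₁ c₂ c₃ :=
  IsBigO.of_bound C <| h.mono fun N hN => by
    rw [Real.norm_eq_abs, Real.norm_eq_abs, abs_of_nonneg (by positivity : 0 ≤ 1 / (N : ℝ) ^ 4),
      mul_one_div]
    exact hN

theorem HasExpansion.congr_coeffs {l : Filter ℕ} {f : ℕ → ℝ} {c₀ c₁ c₂ c₃ d₀ d₁ d₂ d₃ : ℝ}
    (h : HasExpansion l f c₀ c₁ c₂ c₃) (h0 : c₀ = d₀) (h1 : c₁ = d₁) (h2 : c₂ = d₂)
    (h3 : c₃ = d₃) : HasExpansion l f d₀ d₁ d₂ d₃ := by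
  subst h0 h1 h2 h3
  exact h

theorem eventually_even_of_le {P : ℕ → Prop} (h : ∀ m, 1 ≤ m → P (2 * m)) :
    ∀ᶠ N in atTop ⊓ 𝓟 {N : ℕ | Even N}, P N := by
  rw [eventually_inf_principal]
  filter_upwards [eventually_ge_atTop 2] with N hN hE
  obtain ⟨m, rfl⟩ := hE.two_dvd
  exact h m (by omega)

theorem eventually_odd_of_le {P : ℕ → Prop} (h : ∀ m, 1 ≤ m → P (2 * m + 1)) :
    ∀ᶠ N in atTop ⊓ 𝓟 {N : ℕ | Odd N}, P N := by
  rw [eventually_inf_principal]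
  filter_upwards [eventually_ge_atTop 2] with N hN hO
  obtain ⟨m, rfl⟩ := hO
  exact h m (by omega)

theorem hasExpansion_log_stirlingSeq {l : Filter ℕ} (hl : l ≤ atTop) :
    HasExpansion l (fun N => Real.log (stirlingSeq N) - Real.log √Real.pi) 0 (1 / 12) 0
      (-1 / 360) := by
  refine hasExpansion_of_bound 1 ((eventually_ge_atTop 1).filter_mono hl |>.mono fun N hN => ?_)
  convert abs_log_stirlingSeq_sub_stirlingTail_le hN using 2
  rw [stirlingTail]
  have : (N : ℝ) ≠ 0 := by exact_mod_cast (by omega : N ≠ 0)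
  field_simp
  ring

theorem hasExpansion_log_stirlingSeq_half_even :
    HasExpansion (atTop ⊓ 𝓟 {N : ℕ | Even N})
      (fun N => Real.log (stirlingSeq (N / 2)) - Real.log √Real.pi) 0 (1 / 6) 0 (-1 / 45) := by
  refine hasExpansion_of_bound 16 (eventually_even_of_le fun m hm => ?_)
  have hm0 : (m : ℝ) ≠ 0 := by exact_mod_cast (by omega : m ≠ 0)
  rw [Nat.mul_div_cancel_left m two_pos]
  have h : (16 : ℝ) / ((2 * m : ℕ) : ℝ) ^ 4 = 1 / (m : ℝ) ^ 4 := by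
    push_cast
    field_simp
    ring
  rw [h]
  convert abs_log_stirlingSeq_sub_stirlingTail_le hm using 2
  rw [stirlingTail]
  push_cast
  field_simp
  ring

theorem hasExpansion_one_div_sub_one {l : Filter ℕ} (hl : l ≤ atTop) :
    HasExpansion l (fun N : ℕ => 1 / ((N : ℝ) - 1)) 0 1 1 1 := by
  refine hasExpansion_of_bound 2 ((eventually_ge_atTop 2).filter_mono hl |>.mono fun N hN => ?_)
  have h1 : (2 : ℝ) ≤ N := by exact_mod_cast hN
  have h2 : 0 < (N : ℝ) - 1 := by linarith
  have h3 : 1 / ((N : ℝ) - 1) - (0 + 1 / N + 1 / N ^ 2 + 1 / N ^ 3) =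
      N / (N - 1) / (N : ℝ) ^ 4 := by
    field_simp
    ring
  rw [h3, abs_of_nonneg (by positivity)]
  gcongr
  rw [div_le_iff₀ h2]
  linarith

/-- Here m = (N-1)/2, so the Stirling tail is 1/(6(N-1)) - 1/(45(N-1)³), re-expanded in 1/N. -/
theorem hasExpansion_log_stirlingSeq_half_odd :
    HasExpansion (atTop ⊓ 𝓟 {N : ℕ | Odd N})
      (fun N => Real.log (stirlingSeq (N / 2)) - Real.log √Real.pi) 0 (1 / 6) (1 / 6)
      (1 / 6 - 1 / 45) := by
  have hl : atTop ⊓ 𝓟 {N : ℕ | Odd N} ≤ atTop := inf_le_left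
  have h1 := hasExpansion_one_div_sub_one hl
  have h2 := (h1.const_mul (1 / 6)).add (((h1.mul hl h1).mul hl h1).const_mul (-1 / 45))
  have h3 : HasExpansion (atTop ⊓ 𝓟 {N : ℕ | Odd N}) (fun N : ℕ =>
      Real.log (stirlingSeq (N / 2)) - Real.log √Real.pi -
        (1 / 6 * (1 / ((N : ℝ) - 1)) + -1 / 45 *
          (1 / ((N : ℝ) - 1) * (1 / ((N : ℝ) - 1)) * (1 / ((N : ℝ) - 1))))) 0 0 0 0 := by
    -- The constant is 3⁴, from N = 2m + 1 ≤ 3m.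
    refine hasExpansion_of_bound 81 (eventually_odd_of_le fun m hm => ?_)
    have hm0 : (1 : ℝ) ≤ m := by exact_mod_cast hm
    have hd : (2 * m + 1) / 2 = m := by omega
    have h4 := abs_log_stirlingSeq_sub_stirlingTail_le hm
    have h5 : (1 / 6 * (1 / (((2 * m + 1 : ℕ) : ℝ) - 1)) + -1 / 45 *
        (1 / (((2 * m + 1 : ℕ) : ℝ) - 1) * (1 / (((2 * m + 1 : ℕ) : ℝ) - 1)) *
          (1 / (((2 * m + 1 : ℕ) : ℝ) - 1)))) = stirlingTail m := by
      rw [stirlingTail]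
      push_cast
      field_simp
      ring
    rw [hd, h5]
    simp only [zero_div, add_zero, sub_zero]
    refine h4.trans ?_
    rw [div_le_div_iff₀ (by positivity) (by positivity), one_mul]
    calc ((2 * m + 1 : ℕ) : ℝ) ^ 4 ≤ (3 * m) ^ 4 := by
          push_cast
          gcongr
          linarith
      _ = 81 * (m : ℝ) ^ 4 := by ring
  refine ((h3.add h2).congr' (Eventually.of_forall fun N => ?_)).congr_coeffs ?_ ?_ ?_ ?_
  · simp only
    ring
  all_goals norm_num

theorem hasExpansion_log_one_sub {l : Filter ℕ} (hl : l ≤ atTop) :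
    HasExpansion l (fun N : ℕ => -N * Real.log (1 - 1 / (N : ℝ)) - 1) 0 (1 / 2) (1 / 3)
      (1 / 4) := by
  refine hasExpansion_of_bound 2 ((eventually_ge_atTop 2).filter_mono hl |>.mono fun N hN => ?_)
  have h1 : (2 : ℝ) ≤ N := by exact_mod_cast hN
  have hx : (1 : ℝ) / N ≤ 1 / 2 := one_div_le_one_div_of_le two_pos h1
  have hx0 : (0 : ℝ) < 1 / N := by positivity
  have h2 := Real.abs_log_sub_add_sum_range_le (x := 1 / (N : ℝ))
    (by rw [abs_of_pos hx0]; linarith) 4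
  rw [abs_of_pos hx0] at h2
  have h3 : -N * Real.log (1 - 1 / (N : ℝ)) - 1 -
      (0 + 1 / 2 / (N : ℝ) + 1 / 3 / (N : ℝ) ^ 2 + 1 / 4 / (N : ℝ) ^ 3) =
      -N * ((∑ i ∈ Finset.range 4, (1 / (N : ℝ)) ^ (i + 1) / (i + 1)) +
        Real.log (1 - 1 / (N : ℝ))) := by
    rw [mul_add]
    norm_num [Finset.sum_range_succ]
    field_simp
    ring
  rw [h3, abs_mul, abs_neg, abs_of_nonneg (by positivity : (0 : ℝ) ≤ N)]
  calc (N : ℝ) * _ ≤ N * ((1 / (N : ℝ)) ^ (4 + 1) / (1 / 2)) := by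
        refine mul_le_mul_of_nonneg_left (h2.trans ?_) (by positivity)
        gcongr
        linarith
    _ = 2 / (N : ℝ) ^ 4 := by
        rw [one_div_pow]
        field_simp

theorem stirlingSeq_div_sq {a b : ℕ} (ha : 1 ≤ a) (hb : 1 ≤ b) :
    (stirlingSeq a / stirlingSeq b) ^ 2 = Real.exp (2 * ((Real.log (stirlingSeq a) -
      Real.log √Real.pi) + -1 * (Real.log (stirlingSeq b) - Real.log √Real.pi))) := by
  have h : ∀ n, 1 ≤ n → 0 < stirlingSeq n := fun n hn => by
    obtain ⟨k, rfl⟩ : ∃ k, n = k + 1 := ⟨n - 1, by omega⟩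
    exact stirlingSeq'_pos k
  rw [show 2 * ((Real.log (stirlingSeq a) - Real.log √Real.pi) +
    -1 * (Real.log (stirlingSeq b) - Real.log √Real.pi)) =
    ((2 : ℕ) : ℝ) * (Real.log (stirlingSeq a) - Real.log (stirlingSeq b)) by push_cast; ring,
    Real.exp_nat_mul, Real.exp_sub, Real.exp_log (h a ha), Real.exp_log (h b hb)]

/-- The case p = 0 is Stirling's series exponentiated; each further step multiplies by two linear
factors in 1/N, and the stated polynomials in p solve the resulting recursion. -/
theorem hasExpansion_leadingStep_even (p : ℕ) :
    HasExpansion (atTop ⊓ 𝓟 {N : ℕ | Even N}) (fun N => leadingStep N p (N / 2 + p) (N / 2 + p)) 1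
      ((5 + 12 * p + 12 * p ^ 2) / 6)
      ((-11 + 120 * p ^ 2 + 192 * p ^ 3 + 144 * p ^ 4) / 72)
      ((337 + 1980 * p - 1980 * p ^ 2 - 7200 * p ^ 3 + 2160 * p ^ 4 + 8640 * p ^ 5 +
        8640 * p ^ 6) / 6480) := by
  have hl : atTop ⊓ 𝓟 {N : ℕ | Even N} ≤ atTop := inf_le_left
  induction p with
  | zero =>
    have h1 := ((hasExpansion_log_stirlingSeq hl).add
      (hasExpansion_log_stirlingSeq_half_even.const_mul (-1))).const_mul 2
    have h2 := ((h1.congr_coeffs (d₀ := 0) (by norm_num) rfl rfl rfl).exp hl).mul hl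
      (hasExpansion_linear _ 1 1)
    refine (h2.congr' (eventually_even_of_le fun m hm => ?_)).congr_coeffs ?_ ?_ ?_ ?_
    · simp only [Nat.mul_div_cancel_left m two_pos, add_zero]
      rw [leadingStep_even_zero hm, stirlingSeq_div_sq (by omega) hm]
    all_goals norm_num
  | succ p ih =>
    have h2 := ih.mul hl ((hasExpansion_linear _ 1 (2 * p + 1)).mul hl
      (hasExpansion_linear _ 1 (2 * p + 3)))
    refine (h2.congr' (eventually_even_of_le fun m hm => ?_)).congr_coeffs ?_ ?_ ?_ ?_
    · simp only [Nat.mul_div_cancel_left m two_pos]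
      rw [leadingStep_even_succ hm]
    all_goals push_cast; ring

theorem hasExpansion_leadingStep_odd (p : ℕ) :
    HasExpansion (atTop ⊓ 𝓟 {N : ℕ | Odd N}) (fun N => leadingStep N p (N / 2 + p) (N / 2 + p + 1))
      1 ((1 + 6 * p + 6 * p ^ 2) / 3)
      ((1 + 12 * p ^ 2 + 48 * p ^ 3 + 36 * p ^ 4) / 18)
      ((-31 - 90 * p + 90 * p ^ 2 - 360 * p ^ 3 - 540 * p ^ 4 + 1080 * p ^ 5 + 1080 * p ^ 6) /
        810) := by
  have hl : atTop ⊓ 𝓟 {N : ℕ | Odd N} ≤ atTop := inf_le_left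
  have hd : ∀ m, (2 * m + 1) / 2 = m := fun m => by omega
  induction p with
  | zero =>
    have h1 := (((hasExpansion_log_stirlingSeq hl).add
      (hasExpansion_log_stirlingSeq_half_odd.const_mul (-1))).const_mul 2).add
      (hasExpansion_log_one_sub hl)
    have h2 := (h1.congr_coeffs (d₀ := 0) (by norm_num) rfl rfl rfl).exp hl
    refine (h2.congr' (eventually_odd_of_le fun m hm => ?_)).congr_coeffs ?_ ?_ ?_ ?_
    · simp only [hd, add_zero]
      have hpos : 0 < 1 - 1 / ((2 * m + 1 : ℕ) : ℝ) := by
        rw [sub_pos, div_lt_one (by positivity)]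
        exact_mod_cast (by omega : 1 < 2 * m + 1)
      rw [leadingStep_odd_zero hm, stirlingSeq_div_sq (by omega) hm, Real.exp_add]
      congr 1
      rw [sub_eq_add_neg, Real.exp_add, neg_mul, Real.exp_neg, Real.exp_nat_mul,
        Real.exp_log hpos]
      ring
    all_goals norm_num
  | succ p ih =>
    have h2 := ih.mul hl ((hasExpansion_linear _ 1 (2 * p + 2)).mul hl
      (hasExpansion_linear _ 1 (2 * p + 2)))
    refine (h2.congr' (eventually_odd_of_le fun m hm => ?_)).congr_coeffs ?_ ?_ ?_ ?_
    · simp only [hd]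
      rw [leadingStep_odd_succ]
    all_goals push_cast; ring

theorem Deven_succ (p m : ℕ) : Deven (p + 1) m =
    Deven p m * ((p ! : ℝ) ^ 2 / (((m + p)! : ℝ) * ((m + p)! : ℝ))) := by
  rw [Deven, Deven, Finset.prod_range_succ, sq ((m + p)! : ℝ)]

theorem Dodd_succ (p m : ℕ) : (-1) ^ (p + 1) * Dodd (p + 1) m =
    (-1) ^ p * Dodd p m * ((p ! : ℝ) ^ 2 / (((m + p)! : ℝ) * ((m + p + 1)! : ℝ))) := by
  rw [Dodd, Dodd, Finset.prod_range_succ, ← add_assoc, Nat.factorial_succ]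
  push_cast
  field_simp
  ring

theorem hasExpansion_leadingRatio_even (p : ℕ) :
    HasExpansion (atTop ⊓ 𝓟 {N : ℕ | Even N}) (fun N => leadingRatio (Deven p (N / 2)) N p) 1
      (p / 6 * (4 * p ^ 2 + 1)) (p ^ 2 / 72 * (16 * p ^ 4 - 16 * p ^ 2 - 11))
      (p / 6480 * (320 * p ^ 8 - 1200 * p ^ 6 + 708 * p ^ 4 + 1265 * p ^ 2 - 756)) := by
  induction p with
  | zero =>
    refine ((hasExpansion_linear _ 1 0).congr' (Eventually.of_forall fun N => ?_)).congr_coeffs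
      ?_ ?_ ?_ ?_
    · simp [Deven, leadingRatio_zero]
    all_goals norm_num
  | succ p ih =>
    refine ((ih.mul inf_le_left (hasExpansion_leadingStep_even p)).congr'
      (eventually_even_of_le fun m hm => ?_)).congr_coeffs ?_ ?_ ?_ ?_
    · simp only
      rw [Deven_succ, leadingRatio_succ (by omega)]
    all_goals push_cast; ring

/-- The factor (-1)^p removes the sign of D_o, so that the ratio tends to 1; in the moment it is
supplied by (-1/(2N))^{Np} with N odd. -/
theorem hasExpansion_leadingRatio_odd (p : ℕ) :
    HasExpansion (atTop ⊓ 𝓟 {N : ℕ | Odd N})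
      (fun N => leadingRatio ((-1) ^ p * Dodd p (N / 2)) N p) 1
      (p / 3 * (2 * p ^ 2 - 1)) (p ^ 2 / 18 * (4 * p ^ 4 - 10 * p ^ 2 + 7))
      (p / 810 * (40 * p ^ 8 - 240 * p ^ 6 + 516 * p ^ 4 - 455 * p ^ 2 + 108)) := by
  induction p with
  | zero =>
    refine ((hasExpansion_linear _ 1 0).congr' (Eventually.of_forall fun N => ?_)).congr_coeffs
      ?_ ?_ ?_ ?_
    · have : (N / 2)! ≠ 0 := Nat.factorial_ne_zero _
      simp [Dodd, leadingRatio_zero, this]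
    all_goals norm_num
  | succ p ih =>
    refine ((ih.mul inf_le_left (hasExpansion_leadingStep_odd p)).congr'
      (eventually_odd_of_le fun m hm => ?_)).congr_coeffs ?_ ?_ ?_ ?_
    · simp only
      rw [Dodd_succ, leadingRatio_succ (by omega)]
    all_goals push_cast; ring

end LeadingExpansion

/-! ### Asymptotics of the coefficients of t⁰, t² and t⁴. -/

section Asymptotics

theorem normalizedCoeff_eq {N : ℕ} (hN : 1 ≤ N) (p k : ℕ) (D : ℝ) (c : ℂ)
    (h0 : (rectHermiteDet (-1 / (2 * N)) N (2 * p)).coeff 0 =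
      ((((1 / (2 * N)) ^ (N * p) * D : ℝ)) : ℂ))
    (hk : (rectHermiteDet (-1 / (2 * N)) N (2 * p)).coeff k =
      (rectHermiteDet (-1 / (2 * N)) N (2 * p)).coeff 0 * c) :
    normalizedCoeff N p k = (leadingRatio D N p : ℂ) * c := by
  rw [normalizedCoeff, gueMomentCoeff_eq hN, hk, h0, leadingRatio]
  push_cast
  rw [one_div_pow]
  ring

theorem normalizedCoeff_even {m : ℕ} (hm : 1 ≤ m) (p : ℕ) :
    normalizedCoeff (2 * m) p 0 = (leadingRatio (Deven p m) (2 * m) p : ℂ) ∧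
    normalizedCoeff (2 * m) p 4 = (((((2 * m : ℕ) : ℝ) ^ 3 * p / 6) *
      leadingRatio (Deven p m) (2 * m) p : ℝ) : ℂ) := by
  obtain ⟨h0, -, h4, -, -⟩ := coeffs_rectHermiteDet_even p (by omega : 1 ≤ 2 * m) rfl rfl
  have h : (-1 / (2 * ((2 * m : ℕ) : ℂ))) ^ (2 * m * p) * (Deven p m : ℂ) =
      (((1 / (2 * ((2 * m : ℕ) : ℝ))) ^ (2 * m * p) * Deven p m : ℝ) : ℂ) := by
    rw [mul_assoc 2 m p, neg_div, (even_two_mul (m * p)).neg_pow]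
    push_cast
    rfl
  refine ⟨?_, ?_⟩
  · rw [normalizedCoeff_eq (by omega) p 0 (Deven p m) 1 (h0.trans h) (mul_one _).symm, mul_one]
  · rw [normalizedCoeff_eq (by omega) p 4 (Deven p m) _ (h0.trans h) h4]
    push_cast
    ring

theorem normalizedCoeff_odd (m p : ℕ) :
    normalizedCoeff (2 * m + 1) p 0 = (leadingRatio ((-1) ^ p * Dodd p m) (2 * m + 1) p : ℂ) ∧
    normalizedCoeff (2 * m + 1) p 2 = (((2 * m + 1 : ℕ) : ℝ) * p *
      leadingRatio ((-1) ^ p * Dodd p m) (2 * m + 1) p : ℝ) ∧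
    normalizedCoeff (2 * m + 1) p 4 = (((((2 * m + 1 : ℕ) : ℝ) ^ 3 * p / 6) *
      (leadingRatio ((-1) ^ p * Dodd p m) (2 * m + 1) p *
        (-1 + p / ((2 * m + 1 : ℕ) : ℝ))) : ℝ) : ℂ) := by
  obtain ⟨h0, h2, h4, -, -⟩ := coeffs_rectHermiteDet_odd p (by omega : 1 ≤ 2 * m + 1) rfl rfl
  have h : (-1 / (2 * ((2 * m + 1 : ℕ) : ℂ))) ^ ((2 * m + 1) * p) * (Dodd p m : ℂ) =
      (((1 / (2 * ((2 * m + 1 : ℕ) : ℝ))) ^ ((2 * m + 1) * p) * ((-1) ^ p * Dodd p m) : ℝ) : ℂ) := by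
    rw [neg_div, neg_pow, pow_mul (-1) (2 * m + 1), Odd.neg_one_pow ⟨m, rfl⟩]
    push_cast
    ring
  have hN : ((2 * m + 1 : ℕ) : ℂ) ≠ 0 := by exact_mod_cast Nat.succ_ne_zero (2 * m)
  refine ⟨?_, ?_, ?_⟩
  · rw [normalizedCoeff_eq (by omega) p 0 _ 1 (h0.trans h) (mul_one _).symm, mul_one]
  · rw [normalizedCoeff_eq (by omega) p 2 _ _ (h0.trans h) h2]
    push_cast
    ring
  · rw [normalizedCoeff_eq (by omega) p 4 _ _ (h0.trans h) h4]
    rw [Complex.ofReal_mul, Complex.ofReal_mul, Complex.ofReal_add, Complex.ofReal_div,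
      Complex.ofReal_div, Complex.ofReal_mul, Complex.ofReal_pow]
    simp only [Complex.ofReal_natCast, Complex.ofReal_neg, Complex.ofReal_one,
      Complex.ofReal_ofNat]
    field_simp
    ring

theorem isBigO_one_div_pow {l : Filter ℕ} (hl : l ≤ atTop) (j : ℕ) :
    (fun N : ℕ => 1 / (N : ℝ) ^ (j + 1)) =O[l] fun N : ℕ => 1 / (N : ℝ) := by
  have h := (isBigO_continuous_one_div hl (P := fun x => x ^ j) (by fun_prop)).mul
    (isBigO_refl (fun N : ℕ => 1 / (N : ℝ)) l)
  simp only [one_mul] at h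
  exact h.congr_left fun N => by rw [pow_succ, one_div_pow]; field_simp

theorem HasExpansion.isBigO_sub_one {l : Filter ℕ} (hl : l ≤ atTop) {f : ℕ → ℝ} {c₁ c₂ c₃ : ℝ}
    (h : HasExpansion l f 1 c₁ c₂ c₃) : (fun N => f N - 1) =O[l] fun N : ℕ => 1 / (N : ℝ) := by
  have h1 := (isBigO_continuous_one_div hl (P := fun x => c₁ + c₂ * x + c₃ * x ^ 2)
    (by fun_prop)).mul (isBigO_refl (fun N : ℕ => 1 / (N : ℝ)) l)
  simp only [one_mul] at h1
  exact ((IsBigO.trans h (isBigO_one_div_pow hl 3)).add h1).congr_left fun N => by ring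

theorem HasExpansion.isBigO_mul_sub {l : Filter ℕ} (hl : l ≤ atTop) {f : ℕ → ℝ} {c₁ c₂ c₃ : ℝ}
    (h : HasExpansion l f 1 c₁ c₂ c₃) (a : ℝ) :
    (fun N : ℕ => N * a * f N - (N * a + a * c₁)) =O[l] fun N : ℕ => 1 / (N : ℝ) := by
  have hN : ∀ᶠ N : ℕ in l, (N : ℝ) ≠ 0 :=
    (eventually_ge_atTop 1).filter_mono hl |>.mono fun N hN => by
      exact_mod_cast (by omega : N ≠ 0)
  have h1 := (isBigO_continuous_one_div hl (P := fun x => a * (c₂ + c₃ * x))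
    (by fun_prop)).mul (isBigO_refl (fun N : ℕ => 1 / (N : ℝ)) l)
  have h2 := (isBigO_refl (fun N : ℕ => (N : ℝ) * a) l).mul h
  have h3 : (fun N : ℕ => (N : ℝ) * a * (1 / (N : ℝ) ^ 4)) =O[l] fun N : ℕ => 1 / (N : ℝ) :=
    ((isBigO_one_div_pow hl 2).const_mul_left a).congr' (hN.mono fun N hN => by
      simp only; field_simp) EventuallyEq.rfl
  simp only [one_mul] at h1
  refine ((h2.trans h3).add h1).congr' (hN.mono fun N hN => ?_) EventuallyEq.rfl
  simp only
  field_simp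
  ring

theorem HasExpansion.isBigO_cube_mul_sub {l : Filter ℕ} (hl : l ≤ atTop) {f : ℕ → ℝ}
    {c₀ c₁ c₂ c₃ : ℝ} (h : HasExpansion l f c₀ c₁ c₂ c₃) (a : ℝ) :
    (fun N : ℕ => (N : ℝ) ^ 3 * a * f N -
      (N : ℝ) ^ 3 * a * (c₀ + c₁ / N + c₂ / N ^ 2 + c₃ / N ^ 3)) =O[l]
      fun N : ℕ => 1 / (N : ℝ) := by
  have hN : ∀ᶠ N : ℕ in l, (N : ℝ) ≠ 0 :=
    (eventually_ge_atTop 1).filter_mono hl |>.mono fun N hN => by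
      exact_mod_cast (by omega : N ≠ 0)
  have h2 := (isBigO_refl (fun N : ℕ => (N : ℝ) ^ 3 * a) l).mul h
  have h3 : (fun N : ℕ => (N : ℝ) ^ 3 * a * (1 / (N : ℝ) ^ 4)) =O[l] fun N : ℕ => 1 / (N : ℝ) :=
    ((isBigO_refl _ l).const_mul_left a).congr' (hN.mono fun N hN => by
      simp only; field_simp) EventuallyEq.rfl
  exact (h2.trans h3).congr_left fun N => by ring

theorem isBigO_of_ofReal_eq {l : Filter ℕ} {f : ℕ → ℂ} {g r : ℕ → ℝ}
    (h : g =O[l] r) (hf : ∀ᶠ N in l, f N = (g N : ℂ)) : f =O[l] r :=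
  (Complex.isBigO_ofReal_left.2 h).congr' (hf.mono fun _ hN => hN.symm) EventuallyEq.rfl

theorem isBigO_normalizedCoeff_even (p : ℕ) :
    ((fun N : ℕ => normalizedCoeff N p 0 - 1)
        =O[atTop ⊓ 𝓟 {N : ℕ | Even N}] fun N : ℕ => 1 / (N : ℝ)) ∧
    ((fun N : ℕ => normalizedCoeff N p 4 -
        ((N : ℂ) ^ 3 * p / 6) *
          (1 + (p : ℂ) / (6 * N) * (4 * (p : ℂ) ^ 2 + 1)
            + (p : ℂ) ^ 2 / (72 * (N : ℂ) ^ 2) * (16 * (p : ℂ) ^ 4 - 16 * (p : ℂ) ^ 2 - 11)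
            + (p : ℂ) / (6480 * (N : ℂ) ^ 3) *
                (320 * (p : ℂ) ^ 8 - 1200 * (p : ℂ) ^ 6 + 708 * (p : ℂ) ^ 4
                  + 1265 * (p : ℂ) ^ 2 - 756)))
        =O[atTop ⊓ 𝓟 {N : ℕ | Even N}] fun N : ℕ => 1 / (N : ℝ)) := by
  have hl : atTop ⊓ 𝓟 {N : ℕ | Even N} ≤ atTop := inf_le_left
  have h := hasExpansion_leadingRatio_even p
  refine ⟨isBigO_of_ofReal_eq (h.isBigO_sub_one hl) (eventually_even_of_le fun m hm => ?_),
    isBigO_of_ofReal_eq (h.isBigO_cube_mul_sub hl (p / 6)) (eventually_even_of_le fun m hm => ?_)⟩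
  · rw [(normalizedCoeff_even hm p).1, Nat.mul_div_cancel_left m two_pos]
    push_cast
    rfl
  · rw [(normalizedCoeff_even hm p).2, Nat.mul_div_cancel_left m two_pos]
    push_cast
    ring

theorem isBigO_normalizedCoeff_odd (p : ℕ) :
    ((fun N : ℕ => normalizedCoeff N p 0 - 1)
        =O[atTop ⊓ 𝓟 {N : ℕ | Odd N}] fun N : ℕ => 1 / (N : ℝ)) ∧
    ((fun N : ℕ => normalizedCoeff N p 2 -
        ((N : ℂ) * p + (p : ℂ) ^ 2 / 3 * (2 * (p : ℂ) ^ 2 - 1)))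
        =O[atTop ⊓ 𝓟 {N : ℕ | Odd N}] fun N : ℕ => 1 / (N : ℝ)) ∧
    ((fun N : ℕ => normalizedCoeff N p 4 -
        ((N : ℂ) ^ 3 * p / 6) *
          (-1 - 2 * (p : ℂ) / (3 * N) * ((p : ℂ) ^ 2 - 2)
            - (p : ℂ) ^ 2 / (18 * (N : ℂ) ^ 2) * (4 * (p : ℂ) ^ 4 - 22 * (p : ℂ) ^ 2 + 13)
            - (p : ℂ) / (405 * (N : ℂ) ^ 3) *
                (20 * (p : ℂ) ^ 8 - 210 * (p : ℂ) ^ 6 + 483 * (p : ℂ) ^ 4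
                  - 385 * (p : ℂ) ^ 2 + 54)))
        =O[atTop ⊓ 𝓟 {N : ℕ | Odd N}] fun N : ℕ => 1 / (N : ℝ)) := by
  have hl : atTop ⊓ 𝓟 {N : ℕ | Odd N} ≤ atTop := inf_le_left
  have hd : ∀ m, (2 * m + 1) / 2 = m := fun m => by omega
  have h := hasExpansion_leadingRatio_odd p
  refine ⟨isBigO_of_ofReal_eq (h.isBigO_sub_one hl) (eventually_odd_of_le fun m hm => ?_),
    isBigO_of_ofReal_eq (h.isBigO_mul_sub hl p) (eventually_odd_of_le fun m hm => ?_),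
    -- The coefficient ratio T₄/T₀ equals (N³p/6)(-1 + p/N), so the expansion is multiplied by a
    -- linear factor in 1/N.
    isBigO_of_ofReal_eq ((h.mul hl (hasExpansion_linear _ (-1) p)).isBigO_cube_mul_sub hl (p / 6))
      (eventually_odd_of_le fun m hm => ?_)⟩
  · rw [(normalizedCoeff_odd m p).1, hd]
    push_cast
    rfl
  · rw [(normalizedCoeff_odd m p).2.1, hd]
    push_cast
    ring
  · rw [(normalizedCoeff_odd m p).2.2, hd]
    generalize leadingRatio ((-1) ^ p * Dodd p m) (2 * m + 1) p = r
    generalize 2 * m + 1 = M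
    push_cast
    ring

end Asymptotics

theorem mainTheorem6 (p : ℕ) :
    -- the moments are absolutely convergent and have an exact finite expansion in `t`
    (∀ N : ℕ, 1 ≤ N → ∀ t : ℂ,
      Integrable (gueMomentIntegrand N p t) ∧
      gueMoment N p t =
        (partitionC (2 * p) (rectPartition N (2 * p)) : ℂ) *
          ∑ ν ∈ subRect N (2 * p),
            (-1 / (2 * (N : ℂ))) ^ ((N * (2 * p) - ∑ j, ν j) / 2) *
              (dimOverFactorial (2 * p) ν : ℂ) *
              (hermiteD (2 * p) (rectPartition N (2 * p)) ν : ℂ) * t ^ (∑ j, ν j)) ∧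
    -- expansion up to `t ^ 8` for `N = 2m`
    (∀ N m : ℕ, 1 ≤ N → N = 2 * m →
      (fun t : ℂ => gueMoment N p t -
        (-1 / (2 * (N : ℂ))) ^ (N * p) *
          (partitionC (2 * p) (rectPartition N (2 * p)) : ℂ) * (Deven p m : ℂ) *
          (1 + (2 ^ 2 * (N : ℂ) ^ 2 / (4 ! : ℂ)) * (N * p) * t ^ 4
            + (2 ^ 3 * (N : ℂ) ^ 3 / (6 ! : ℂ)) * (2 * N * p * (2 * p - N)) * t ^ 6
            + (2 ^ 4 * (N : ℂ) ^ 4 / (8 ! : ℂ)) *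
                (N * p * (4 * (N : ℂ) ^ 2 - 17 * N * p + 16 * (p : ℂ) ^ 2 + 2)) * t ^ 8))
        =O[𝓝 0] fun t : ℂ => t ^ 10) ∧
    -- expansion up to `t ^ 8` for `N = 2m + 1`
    (∀ N m : ℕ, 1 ≤ N → N = 2 * m + 1 →
      (fun t : ℂ => gueMoment N p t -
        (-1 / (2 * (N : ℂ))) ^ (N * p) *
          (partitionC (2 * p) (rectPartition N (2 * p)) : ℂ) * (Dodd p m : ℂ) *
          (1 + (2 * (N : ℂ) / (2 ! : ℂ)) * p * t ^ 2
            + (2 ^ 2 * (N : ℂ) ^ 2 / (4 ! : ℂ)) * ((p : ℂ) ^ 2 - N * p) * t ^ 4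
            + (2 ^ 3 * (N : ℂ) ^ 3 / (6 ! : ℂ)) *
                (p * (2 * (N : ℂ) ^ 2 - 3 * N * p + (p : ℂ) ^ 2)) * t ^ 6
            + (2 ^ 4 * (N : ℂ) ^ 4 / (8 ! : ℂ)) *
                (p * (-4 * (N : ℂ) ^ 3 + 15 * (N : ℂ) ^ 2 * p - 6 * N * (p : ℂ) ^ 2
                  - 2 * N + (p : ℂ) ^ 3 - 4 * p)) * t ^ 8))
        =O[𝓝 0] fun t : ℂ => t ^ 10) ∧
    -- coefficients of `t ^ 0`, `t ^ 2`, `t ^ 4` as `N → ∞` through even `N`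
    ((fun N : ℕ => normalizedCoeff N p 0 - 1)
        =O[atTop ⊓ 𝓟 {N : ℕ | Even N}] fun N : ℕ => 1 / (N : ℝ)) ∧
    (∀ N : ℕ, 1 ≤ N → Even N → gueMomentCoeff N p 2 = 0) ∧
    ((fun N : ℕ => normalizedCoeff N p 4 -
        ((N : ℂ) ^ 3 * p / 6) *
          (1 + (p : ℂ) / (6 * N) * (4 * (p : ℂ) ^ 2 + 1)
            + (p : ℂ) ^ 2 / (72 * (N : ℂ) ^ 2) * (16 * (p : ℂ) ^ 4 - 16 * (p : ℂ) ^ 2 - 11)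
            + (p : ℂ) / (6480 * (N : ℂ) ^ 3) *
                (320 * (p : ℂ) ^ 8 - 1200 * (p : ℂ) ^ 6 + 708 * (p : ℂ) ^ 4
                  + 1265 * (p : ℂ) ^ 2 - 756)))
        =O[atTop ⊓ 𝓟 {N : ℕ | Even N}] fun N : ℕ => 1 / (N : ℝ)) ∧
    -- coefficients of `t ^ 0`, `t ^ 2`, `t ^ 4` as `N → ∞` through odd `N`
    ((fun N : ℕ => normalizedCoeff N p 0 - 1)
        =O[atTop ⊓ 𝓟 {N : ℕ | Odd N}] fun N : ℕ => 1 / (N : ℝ)) ∧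
    ((fun N : ℕ => normalizedCoeff N p 2 -
        ((N : ℂ) * p + (p : ℂ) ^ 2 / 3 * (2 * (p : ℂ) ^ 2 - 1)))
        =O[atTop ⊓ 𝓟 {N : ℕ | Odd N}] fun N : ℕ => 1 / (N : ℝ)) ∧
    ((fun N : ℕ => normalizedCoeff N p 4 -
        ((N : ℂ) ^ 3 * p / 6) *
          (-1 - 2 * (p : ℂ) / (3 * N) * ((p : ℂ) ^ 2 - 2)
            - (p : ℂ) ^ 2 / (18 * (N : ℂ) ^ 2) * (4 * (p : ℂ) ^ 4 - 22 * (p : ℂ) ^ 2 + 13)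
            - (p : ℂ) / (405 * (N : ℂ) ^ 3) *
                (20 * (p : ℂ) ^ 8 - 210 * (p : ℂ) ^ 6 + 483 * (p : ℂ) ^ 4
                  - 385 * (p : ℂ) ^ 2 + 54)))
        =O[atTop ⊓ 𝓟 {N : ℕ | Odd N}] fun N : ℕ => 1 / (N : ℝ)) := by 
  refine ⟨fun N hN t => ?_, fun N m hN hm => isBigO_gueMoment_even p hN hm,
    fun N m hN hm => isBigO_gueMoment_odd p hN hm, (isBigO_normalizedCoeff_even p).1,
    fun N hN hE => ?_, (isBigO_normalizedCoeff_even p).2, (isBigO_normalizedCoeff_odd p).1,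
    (isBigO_normalizedCoeff_odd p).2.1, (isBigO_normalizedCoeff_odd p).2.2⟩
  · obtain ⟨h1, h2⟩ := integrable_gueMomentIntegrand hN p t
    refine ⟨h1, ?_⟩
    rw [h2, eval_rectHermiteDet (neg_one_div_two_mul_ne_zero hN)]
    rfl
  · obtain ⟨m, hm⟩ := hE.two_dvd
    rw [gueMomentCoeff_eq hN, (coeffs_rectHermiteDet_even p hN hm rfl).2.1, mul_zero]
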